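/- Let $C$ be a smooth projective curve over $\mathbb{C}$ (irreducible), let $S$ be a normal variety over $\mathbb{C}$, let $k\ge 1$, and let $\mathscr{L}$ be a line bundle on $C\times S$. Let $C_k=C^k/\mathfrak{S}_k$ be the $k$-th symmetric product, $\pi\colon C^k\times S\to C_k\times S$ the quotient map by the symmetric group $\mathfrak{S}_k$ permuting the factors of $C^k$ (and acting trivially on $S$), $p_i\colon C^k\times S\to C\times S$ the projections ($1\le i\le k$), and $\mathscr{L}^{\boxtimes k}:=\bigotimes_{i=1}^k p_i^*\mathscr{L}$. For a $\mathfrak{S}_k$-equivariant structure on $\mathscr{L}^{\boxtimes k}$, let $\pi_*^{\mathfrak{S}_k}\mathscr{L}^{\boxtimes k}:=(\pi_*\mathscr{L}^{\boxtimes k})^{\mathfrak{S}_k}$ be the sheaf on $C_k\times S$ whose sections over an open $U$ are the $\mathfrak{S}_k$-invariant sections of $\mathscr{L}^{\boxtimes k}$ over $\pi^{-1}(U)$. Let $T_{\mathscr{L}}$ be $\pi_*^{\mathfrak{S}_k}\mathscr{L}^{\boxtimes k}$ for the natural permutation action of $\mathfrak{S}_k$ on $\mathscr{L}^{\boxtimes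 k}$. Let $\mathcal{D}=\{(x,\xi):x\in\xi\}\subset C\times C_k$ be the universal degree $k$ divisor, that is, the (scheme-theoretic) image of $C^k\to C\times C_k$, $(x_1,\dots,x_k)\mapsto(x_1,\,x_1+\dots+x_k)$, with projections $p\colon\mathcal{D}\times S\to C\times S$ and $q\colon\mathcal{D}\times S\to C_k\times S$. Put $E_{\mathscr{L}}=\mathscr{L}^{[k]}:=q_*p^*\mathscr{L}$, a bundle of rank $k$, and $N_{\mathscr{L}}:=\det E_{\mathscr{L}}=\bigwedge^kE_{\mathscr{L}}$. Let $\mu\in\{0,1\}$ and let $\mathfrak{S}_k$ act on $\mathscr{L}^{\boxtimes k}$ by $(-1)^{\mu}$ times the natural permutation action, i.e. $\sigma\in\mathfrak{S}_k$ acts by $\operatorname{sgn}(\sigma)^{\mu}$ times its natural action. Then, as $\mathscr{O}_{C_k\times S}$-modules, $$ \pi_*^{\mathfrak{S}_k}\mathscr{L}^{\boxtimes k}\;\cong\;\begin{cases}T_{\mathscr{L}} & \text{if }\mu=0,\\ N_{\mathscr{L}} & \text{if }\mu=1.\end{cases} $$ -/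

import Mathlib

open CategoryTheory Limits AlgebraicGeometry MonoidalCategory CartesianMonoidalCategory
open scoped TensorProduct

noncomputable section

namespace SymmetricProduct

section Algebra

variable {R S : Type} [CommRing R] [CommRing S] (φ : R →+* S)

/-- For a bijection `e : ι' → ι` and maps `f j : M (e j) → N j` that are semilinear along a ring
homomorphism `φ : R → S`, the induced semilinear map of tensor products
`⨂[R] i, M i → ⨂[S] j, N j`, sending `⨂ x i` to `⨂ f j (x (e j))`. -/
def piTensorMap {ι ι' : Type} {e : ι' → ι} (he : e.Bijective) {M : ι → Type} {N : ι' → Type}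
    [∀ i, AddCommGroup (M i)] [∀ i, Module R (M i)]
    [∀ j, AddCommGroup (N j)] [∀ j, Module S (N j)]
    (f : ∀ j, M (e j) →ₛₗ[φ] N j) : (⨂[R] i, M i) →ₛₗ[φ] ⨂[S] j, N j :=
  letI : Module R (⨂[S] j, N j) := Module.compHom _ φ
  let m : MultilinearMap R M (⨂[S] j, N j) :=
    { toFun := fun x => PiTensorProduct.tprod S fun j => f j (x (e j))
      map_update_add' := by
        classical
        intro _ x i a b
        obtain ⟨j, rfl⟩ := he.2 i
        have key : ∀ c : M (e j), (fun j' => f j' (Function.update x (e j) c (e j'))) =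
            Function.update (fun j' => f j' (x (e j'))) j (f j c) := by
          intro c
          funext j'
          by_cases h : j' = j
          · subst h; simp
          · simp [Function.update_of_ne h, Function.update_of_ne (he.1.ne h)]
        have := (PiTensorProduct.tprod S).map_update_add (fun j' => f j' (x (e j'))) j (f j a) (f j b)
        rw [← map_add] at this
        rw [← key, ← key, ← key] at this
        convert this
      map_update_smul' := by
        classical
        intro _ x i r a
        obtain ⟨j, rfl⟩ := he.2 i
        have key : ∀ c : M (e j), (fun j' => f j' (Function.update x (e j) c (e j'))) =
            Function.update (fun j' => f j' (x (e j'))) j (f j c) := by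
          intro c
          funext j'
          by_cases h : j' = j
          · subst h; simp
          · simp [Function.update_of_ne h, Function.update_of_ne (he.1.ne h)]
        have := (PiTensorProduct.tprod S).map_update_smul (fun j' => f j' (x (e j'))) j (φ r) (f j a)
        rw [← map_smulₛₗ] at this
        rw [← key, ← key] at this
        convert this
        rfl }
  { toFun := PiTensorProduct.lift m
    map_add' := map_add _
    map_smul' := fun r x => (PiTensorProduct.lift m).map_smul r x }

theorem piTensorMap_tprod {ι ι' : Type} {e : ι' → ι} (he : e.Bijective) {M : ι → Type} {N : ι' → Type}
    [∀ i, AddCommGroup (M i)] [∀ i, Module R (M i)]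
    [∀ j, AddCommGroup (N j)] [∀ j, Module S (N j)]
    (f : ∀ j, M (e j) →ₛₗ[φ] N j) (x : ∀ i, M i) :
    piTensorMap φ he f (PiTensorProduct.tprod R x) =
      PiTensorProduct.tprod S fun j => f j (x (e j)) := by
  let _ : Module R (⨂[S] j, N j) := Module.compHom _ φ
  exact PiTensorProduct.lift.tprod x

/-- The semilinear map `⋀[R]^n M → ⋀[S]^n N` induced by a semilinear map `f : M → N`, sending
`x₁ ∧ ⋯ ∧ xₙ` to `f x₁ ∧ ⋯ ∧ f xₙ`. -/
def exteriorMap (n : ℕ) {M N : Type} [AddCommGroup M] [Module R M] [AddCommGroup N] [Module S N]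
    (f : M →ₛₗ[φ] N) : (⋀[R]^n M) →ₛₗ[φ] ⋀[S]^n N :=
  letI : Module R (⋀[S]^n N) := Module.compHom _ φ
  let m : M [⋀^Fin n]→ₗ[R] (⋀[S]^n N) :=
    { toFun := fun x => exteriorPower.ιMulti S n (f ∘ x)
      map_update_add' := by
        intro _ x i a b
        have := (exteriorPower.ιMulti S n (M := N)).map_update_add (f ∘ x) i (f a) (f b)
        rw [← map_add] at this
        rw [← Function.comp_update, ← Function.comp_update, ← Function.comp_update] at this
        convert this
      map_update_smul' := by
        intro _ x i r a
        have := (exteriorPower.ιMulti S n (M := N)).map_update_smul (f ∘ x) i (φ r) (f a)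
        rw [← map_smulₛₗ] at this
        rw [← Function.comp_update, ← Function.comp_update] at this
        convert this
        rfl
      map_eq_zero_of_eq' := fun x i j h hij =>
        (exteriorPower.ιMulti S n (M := N)).map_eq_zero_of_eq (f ∘ x) (by simp [h]) hij }
  { toFun := exteriorPower.alternatingMapLinearEquiv m
    map_add' := map_add _
    map_smul' := fun r x => (exteriorPower.alternatingMapLinearEquiv m).map_smul r x }

theorem exteriorMap_ιMulti (n : ℕ) {M N : Type} [AddCommGroup M] [Module R M] [AddCommGroup N]
    [Module S N] (f : M →ₛₗ[φ] N) (x : Fin n → M) :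
    exteriorMap φ n f (exteriorPower.ιMulti R n x) = exteriorPower.ιMulti S n (f ∘ x) := by
  let _ : Module R (⋀[S]^n N) := Module.compHom _ φ
  exact exteriorPower.alternatingMapLinearEquiv_apply_ιMulti _ x

theorem piTensorMap_id {ι : Type} {M : ι → Type} [∀ i, AddCommGroup (M i)] [∀ i, Module R (M i)]
    {φ : R →+* R} (f : ∀ j, M j →ₛₗ[φ] M j) (hφ : ∀ r, φ r = r) (hf : ∀ j x, f j x = x)
    (t : ⨂[R] i, M i) : piTensorMap φ (e := fun i => i) Function.bijective_id f t = t := by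
  induction t using PiTensorProduct.induction_on with
  | smul_tprod r x =>
    rw [map_smulₛₗ, piTensorMap_tprod, hφ]
    simp [hf]
  | add a b ha hb => rw [map_add, ha, hb]

theorem piTensorMap_comp {T : Type} [CommRing T] {ι ι' ι'' : Type} {φ : R →+* S} {ψ : S →+* T}
    {χ : R →+* T} (hχ : ∀ r, χ r = ψ (φ r)) {e : ι' → ι} (he : e.Bijective)
    {e' : ι'' → ι'} (he' : e'.Bijective) {e'' : ι'' → ι} (he'' : e''.Bijective)
    {M : ι → Type} {N : ι' → Type} {P : ι'' → Type}
    [∀ i, AddCommGroup (M i)] [∀ i, Module R (M i)]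
    [∀ j, AddCommGroup (N j)] [∀ j, Module S (N j)]
    [∀ j, AddCommGroup (P j)] [∀ j, Module T (P j)]
    (f : ∀ j, M (e j) →ₛₗ[φ] N j) (g : ∀ j, N (e' j) →ₛₗ[ψ] P j) (h : ∀ j, M (e'' j) →ₛₗ[χ] P j)
    (hfg : ∀ (x : ∀ i, M i) j, h j (x (e'' j)) = g j (f (e' j) (x (e (e' j)))))
    (t : ⨂[R] i, M i) :
    piTensorMap χ he'' h t = piTensorMap ψ he' g (piTensorMap φ he f t) := by
  induction t using PiTensorProduct.induction_on with
  | smul_tprod r x =>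
    rw [map_smulₛₗ, map_smulₛₗ, map_smulₛₗ, piTensorMap_tprod, piTensorMap_tprod,
      piTensorMap_tprod, hχ]
    simp only [hfg x]
  | add a b ha hb => rw [map_add, map_add, map_add, ha, hb]

theorem exteriorMap_id (n : ℕ) {M : Type} [AddCommGroup M] [Module R M]
    {φ : R →+* R} (f : M →ₛₗ[φ] M) (hφ : ∀ r, φ r = r) (hf : ∀ x, f x = x)
    (t : ⋀[R]^n M) : exteriorMap φ n f t = t := by
  have ht : t ∈ Submodule.span R (Set.range (exteriorPower.ιMulti R n (M := M))) := by
    rw [exteriorPower.ιMulti_span]; trivial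
  induction ht using Submodule.span_induction with
  | mem x hx =>
    obtain ⟨y, rfl⟩ := hx
    rw [exteriorMap_ιMulti]
    congr 1
    funext i
    exact hf _
  | zero => rw [map_zero]
  | add a b _ _ ha hb => rw [map_add, ha, hb]
  | smul r a _ ha => rw [map_smulₛₗ, ha, hφ]

theorem exteriorMap_comp (n : ℕ) {T : Type} [CommRing T] {φ : R →+* S} {ψ : S →+* T}
    {χ : R →+* T} (hχ : ∀ r, χ r = ψ (φ r)) {M N P : Type} [AddCommGroup M] [Module R M]
    [AddCommGroup N] [Module S N] [AddCommGroup P] [Module T P]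
    (f : M →ₛₗ[φ] N) (g : N →ₛₗ[ψ] P) (h : M →ₛₗ[χ] P) (hfg : ∀ x, h x = g (f x))
    (t : ⋀[R]^n M) : exteriorMap χ n h t = exteriorMap ψ n g (exteriorMap φ n f t) := by
  have ht : t ∈ Submodule.span R (Set.range (exteriorPower.ιMulti R n (M := M))) := by
    rw [exteriorPower.ιMulti_span]; trivial
  induction ht using Submodule.span_induction with
  | mem x hx =>
    obtain ⟨y, rfl⟩ := hx
    rw [exteriorMap_ιMulti, exteriorMap_ιMulti, exteriorMap_ιMulti]
    congr 1
    funext i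
    exact hfg _
  | zero => rw [map_zero, map_zero, map_zero]
  | add a b _ _ ha hb => rw [map_add, map_add, map_add, ha, hb]
  | smul r a _ ha => rw [map_smulₛₗ, map_smulₛₗ, map_smulₛₗ, ha, hχ]

end Algebra

section Sheaves

open Scheme.Modules

variable {X Y Z : Scheme.{0}}

/-- The restriction map of an `𝒪_X`-module, as a semilinear map. -/
def res (M : X.Modules) {U V : X.Opens} (i : U ⟶ V) :
    Γ(M, V) →ₛₗ[(X.presheaf.map i.op).hom] Γ(M, U) where
  toFun := M.presheaf.map i.op
  map_add' := map_add _
  map_smul' := M.map_smul i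

/-- The presheaf `U ↦ ⨂[𝒪(U)] i, M i (U)`. -/
def tensorPresheaf {ι : Type} (M : ι → X.Modules) : X.PresheafOfModules where
  obj U := ModuleCat.of Γ(X, U.unop) (⨂[Γ(X, U.unop)] i, Γ(M i, U.unop))
  map {U V} i := ModuleCat.semilinearMapAddEquiv (X.presheaf.map i.unop.op).hom
    (ModuleCat.of Γ(X, U.unop) (⨂[Γ(X, U.unop)] i, Γ(M i, U.unop)))
    (ModuleCat.of Γ(X, V.unop) (⨂[Γ(X, V.unop)] i, Γ(M i, V.unop)))
    (piTensorMap (X.presheaf.map i.unop.op).hom (e := fun i => i) Function.bijective_id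
      fun j => res (M j) i.unop)
  map_id U := by
    refine ModuleCat.hom_ext (@LinearMap.ext _ _ _ _ _ _ _ _ (_) (_) _ _ _ (fun x => ?_))
    have h := piTensorMap_id (fun j => res (M j) (𝟙 U.unop))
      (fun r => congr($(X.presheaf.map_id U) r)) (fun j x => congr($((M j).presheaf.map_id U) x)) x
    exact h
  map_comp {U V W} i i' := by
    refine ModuleCat.hom_ext (@LinearMap.ext _ _ _ _ _ _ _ _ (_) (_) _ _ _ (fun x => ?_))
    have h := piTensorMap_comp (φ := (X.presheaf.map i.unop.op).hom)
      (ψ := (X.presheaf.map i'.unop.op).hom) (χ := (X.presheaf.map (i ≫ i').unop.op).hom)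
      (fun r => congr($(X.presheaf.map_comp i i') r))
      (e := fun i => i) Function.bijective_id (e' := fun i => i) Function.bijective_id
      (e'' := fun i => i) Function.bijective_id (fun j => res (M j) i.unop)
      (fun j => res (M j) i'.unop) (fun j => res (M j) (i ≫ i').unop)
      (fun x j => congr($((M j).presheaf.map_comp i i') (x j))) x
    exact h

/-- The presheaf `U ↦ ⋀[𝒪(U)]^n M(U)`. -/
def exteriorPresheaf (n : ℕ) (M : X.Modules) : X.PresheafOfModules where
  obj U := ModuleCat.of Γ(X, U.unop) (⋀[Γ(X, U.unop)]^n Γ(M, U.unop))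
  map {U V} i := ModuleCat.semilinearMapAddEquiv (X.presheaf.map i.unop.op).hom
    (ModuleCat.of Γ(X, U.unop) (⋀[Γ(X, U.unop)]^n Γ(M, U.unop)))
    (ModuleCat.of Γ(X, V.unop) (⋀[Γ(X, V.unop)]^n Γ(M, V.unop)))
    (exteriorMap (X.presheaf.map i.unop.op).hom n (res M i.unop))
  map_id U := by
    refine ModuleCat.hom_ext (@LinearMap.ext _ _ _ _ _ _ _ _ (_) (_) _ _ _ (fun x => ?_))
    have h := exteriorMap_id n (res M (𝟙 U.unop))
      (fun r => congr($(X.presheaf.map_id U) r)) (fun x => congr($(M.presheaf.map_id U) x)) x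
    exact h
  map_comp {U V W} i i' := by
    refine ModuleCat.hom_ext (@LinearMap.ext _ _ _ _ _ _ _ _ (_) (_) _ _ _ (fun x => ?_))
    have h := exteriorMap_comp n (φ := (X.presheaf.map i.unop.op).hom)
      (ψ := (X.presheaf.map i'.unop.op).hom) (χ := (X.presheaf.map (i ≫ i').unop.op).hom)
      (fun r => congr($(X.presheaf.map_comp i i') r))
      (res M i.unop) (res M i'.unop) (res M (i ≫ i').unop)
      (fun x => congr($(M.presheaf.map_comp i i') x)) x
    exact h

/-- The sheaf associated with a presheaf of `𝒪_X`-modules. -/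
def sheafify (P : X.PresheafOfModules) : X.Modules :=
  (PresheafOfModules.sheafification (𝟙 X.ringCatSheaf.obj)).obj P

/-- The tensor product `⨂ i, M i` over `𝒪_X`. -/
def tensor {ι : Type} (M : ι → X.Modules) : X.Modules := sheafify (tensorPresheaf M)

/-- The exterior power `⋀^n M` over `𝒪_X`. -/
def exterior (n : ℕ) (M : X.Modules) : X.Modules := sheafify (exteriorPresheaf n M)

/-- The semilinear map `M(U) → N(f⁻¹ U)` underlying a homomorphism `M ⟶ f_* N`. -/
def appₛₗ (f : X ⟶ Y) {M : Y.Modules} {N : X.Modules} (φ : M ⟶ (pushforward f).obj N)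
    (U : Y.Opens) : Γ(M, U) →ₛₗ[(f.app U).hom] Γ(N, f ⁻¹ᵁ U) where
  toFun := φ.app U
  map_add' := map_add _
  map_smul' r x := φ.app_smul r x

/-- For a bijection `e : ι' → ι` and homomorphisms `φ j : M (e j) ⟶ f_* (N j)`, the induced
homomorphism of presheaves `⨂ i, M i ⟶ f_* (⨂ j, N j)`. -/
def tensorPresheafHom (f : X ⟶ Y) {ι ι' : Type} {e : ι' → ι} (he : e.Bijective)
    {M : ι → Y.Modules} {N : ι' → X.Modules} (φ : ∀ j, M (e j) ⟶ (pushforward f).obj (N j)) :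
    tensorPresheaf M ⟶
      (PresheafOfModules.pushforward f.toRingCatSheafHom.hom).obj (tensorPresheaf N) where
  app U := ModuleCat.semilinearMapAddEquiv (f.app U.unop).hom
    (ModuleCat.of Γ(Y, U.unop) (⨂[Γ(Y, U.unop)] i, Γ(M i, U.unop)))
    (ModuleCat.of Γ(X, f ⁻¹ᵁ U.unop) (⨂[Γ(X, f ⁻¹ᵁ U.unop)] j, Γ(N j, f ⁻¹ᵁ U.unop)))
    (piTensorMap (f.app U.unop).hom he fun j => appₛₗ f (φ j) U.unop)
  naturality {U V} i := by
    refine ModuleCat.hom_ext (@LinearMap.ext _ _ _ _ _ _ _ _ (_) (_) _ _ _ (fun x => ?_))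
    have : RingHomCompTriple (Y.presheaf.map i.unop.op).hom (f.app V.unop).hom
      ((f.app V.unop).hom.comp (Y.presheaf.map i.unop.op).hom) := ⟨rfl⟩
    have hnat : ∀ (j : ι') (y : Γ(M (e j), U.unop)),
        appₛₗ f (φ j) V.unop (res (M (e j)) i.unop y) =
          res (N j) ((TopologicalSpace.Opens.map f.base).map i.unop) (appₛₗ f (φ j) U.unop y) :=
      fun j y => congr($((φ j).mapPresheaf.naturality i) y)
    have h₁ := piTensorMap_comp (φ := (Y.presheaf.map i.unop.op).hom) (ψ := (f.app V.unop).hom)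
      (χ := (f.app V.unop).hom.comp (Y.presheaf.map i.unop.op).hom) (fun r => rfl)
      (e := fun i => i) Function.bijective_id he he (fun j => res (M j) i.unop)
      (fun j => appₛₗ f (φ j) V.unop) (fun j => (appₛₗ f (φ j) V.unop).comp (res (M (e j)) i.unop))
      (fun x j => rfl) x
    have h₂ := piTensorMap_comp (φ := (f.app U.unop).hom)
      (ψ := (X.presheaf.map ((TopologicalSpace.Opens.map f.base).map i.unop).op).hom)
      (χ := (f.app V.unop).hom.comp (Y.presheaf.map i.unop.op).hom)
      (fun r => congr($(f.naturality i) r))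
      he (e' := fun i => i) Function.bijective_id he (fun j => appₛₗ f (φ j) U.unop)
      (fun j => res (N j) ((TopologicalSpace.Opens.map f.base).map i.unop))
      (fun j => (appₛₗ f (φ j) V.unop).comp (res (M (e j)) i.unop))
      (fun x j => hnat j (x (e j))) x
    exact h₁.symm.trans h₂

/-- For a bijection `e : ι' → ι` and homomorphisms `φ j : M (e j) ⟶ f_* (N j)`, the induced
homomorphism `⨂ i, M i ⟶ f_* (⨂ j, N j)`, sending a local section `⨂ s i` to
`⨂ φ j (s (e j))`. -/
def tensorHom (f : X ⟶ Y) {ι ι' : Type} {e : ι' → ι} (he : e.Bijective)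
    {M : ι → Y.Modules} {N : ι' → X.Modules} (φ : ∀ j, M (e j) ⟶ (pushforward f).obj (N j)) :
    tensor M ⟶ (pushforward f).obj (tensor N) :=
  ((PresheafOfModules.sheafificationAdjunction (𝟙 Y.ringCatSheaf.obj)).homEquiv
    (tensorPresheaf M) ((pushforward f).obj (tensor N))).symm
  (tensorPresheafHom f he φ ≫ (PresheafOfModules.pushforward f.toRingCatSheafHom.hom).map
    ((PresheafOfModules.sheafificationAdjunction (𝟙 X.ringCatSheaf.obj)).unit.app
      (tensorPresheaf N)))

/-- Pullback of local sections: for `h : f ≫ p = q`, the homomorphism `p^* L ⟶ f_* q^* L` adjoint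
to the canonical isomorphism `f^* p^* L ≅ q^* L`. -/
def pullSections (f : X ⟶ Y) (p : Y ⟶ Z) (q : X ⟶ Z) (h : f ≫ p = q) (L : Z.Modules) :
    (Scheme.Modules.pullback p).obj L ⟶ (pushforward f).obj ((Scheme.Modules.pullback q).obj L) :=
  (pullbackPushforwardAdjunction f).unit.app ((Scheme.Modules.pullback p).obj L) ≫
    (pushforward f).map ((pullbackComp f p).hom.app L ≫ (pullbackCongr h).hom.app L)

/-- Let `ρ g` (`g : G`) be endomorphisms of `X` with `ρ g ≫ π = π`, and let
`a g : F ⟶ (ρ g)_* F` be given. This is the endomorphism of `π_* F` induced by `a g`. -/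
def pushforwardAct {G : Type} (ρ : G → (X ⟶ X)) (π : X ⟶ Y) (hπ : ∀ g, ρ g ≫ π = π)
    {F : X.Modules} (a : ∀ g, F ⟶ (pushforward (ρ g)).obj F) (g : G) :
    (pushforward π).obj F ⟶ (pushforward π).obj F :=
  (pushforward π).map (a g) ≫ (pushforwardComp (ρ g) π).hom.app F ≫
    (pushforwardCongr (hπ g)).hom.app F

/-- The equivariant pushforward `π_*^G F = (π_* F)^G`: the largest submodule of `π_* F` on which
all `g : G` act as the identity. Its sections over `U` are the `G`-invariant sections of `F`
over `π⁻¹ U`. -/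
def equivariantPushforward {G : Type} (ρ : G → (X ⟶ X)) (π : X ⟶ Y) (hπ : ∀ g, ρ g ≫ π = π)
    {F : X.Modules} (a : ∀ g, F ⟶ (pushforward (ρ g)).obj F) : Y.Modules :=
  kernel (Pi.lift fun g => pushforwardAct ρ π hπ a g - 𝟙 ((pushforward π).obj F))

/-- A line bundle: an `𝒪_X`-module that is locally isomorphic to `𝒪_X`. -/
def IsLineBundle (L : X.Modules) : Prop :=
  ∀ x : X, ∃ U : X.Opens, x ∈ U ∧
    Nonempty (L.restrict U.ι ≅ SheafOfModules.unit (U : Scheme.{0}).ringCatSheaf)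

end Sheaves

section Curve

/-- The category of schemes over `ℂ`, with its cartesian product `⊗`. -/
abbrev SchC := Over (Spec (.of ℂ))

attribute [local instance] MvPolynomial.gradedAlgebra in
/-- The structure morphism of projective space `ℙⁿ = Proj ℂ[x₀, …, xₙ]`. -/
def projStr (n : ℕ) : Proj (MvPolynomial.homogeneousSubmodule (Fin (n + 1)) ℂ) ⟶ Spec (.of ℂ) :=
  Proj.toSpecZero _ ≫ Spec.map (CommRingCat.ofHom
    (algebraMap ℂ (MvPolynomial.homogeneousSubmodule (Fin (n + 1)) ℂ 0)))

/-- A smooth projective curve over `ℂ`. -/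
structure IsSmoothProjectiveCurve (C : SchC) : Prop where
  integral : IsIntegral C.left
  smooth : SmoothOfRelativeDimension 1 C.hom
  projective : ∃ (n : ℕ) (i : C ⟶ Over.mk (projStr n)), IsClosedImmersion i.left

/-- A normal variety over `ℂ`. -/
structure IsNormalVariety (S : SchC) : Prop where
  integral : IsIntegral S.left
  separated : IsSeparated S.hom
  locallyOfFiniteType : LocallyOfFiniteType S.hom
  quasiCompact : QuasiCompact S.hom
  normal : ∀ x : S.left, IsIntegrallyClosed (S.left.presheaf.stalk x)

/-- The `k`-fold product `C^k`. -/
abbrev power (C : SchC) (k : ℕ) : SchC := ∏ᶜ fun _ : Fin k => C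

/-- The automorphism `(x₁, …, x_k) ↦ (x_{σ 1}, …, x_{σ k})` of `C^k`. -/
def permute (C : SchC) {k : ℕ} (σ : Equiv.Perm (Fin k)) : power C k ⟶ power C k :=
  Pi.lift fun i => Pi.π (fun _ : Fin k => C) (σ i)

/-- `π : X ⟶ Y` is the quotient of `X` by a finite group `G` acting through automorphisms `ρ g`:
`π` is affine and invariant, and `𝒪_Y` is the sheaf of invariants of `π_* 𝒪_X`. (This determines
`π` up to unique isomorphism; `Y` then carries the quotient topology and the fibres of `π` are the
orbits.) -/
structure IsQuotient {X Y : Scheme.{0}} {G : Type} (ρ : G → (X ⟶ X)) (π : X ⟶ Y) : Prop where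
  affine : IsAffineHom π
  invariant : ∀ g, ρ g ≫ π = π
  injective : ∀ U : Y.Opens, Function.Injective (π.app U)
  surjective : ∀ (U : Y.Opens) (s : Γ(X, π ⁻¹ᵁ U)),
    (∀ (g : G) (h : π ⁻¹ᵁ U ≤ ρ g ⁻¹ᵁ π ⁻¹ᵁ U), (ρ g).appLE (π ⁻¹ᵁ U) (π ⁻¹ᵁ U) h s = s) →
    ∃ t, π.app U t = s

/-- `π : C^k ⟶ C_k` exhibits `C_k` as the `k`-th symmetric product of `C`. -/
def IsSymmetricProduct (C : SchC) {k : ℕ} {Ck : SchC} (π : power C k ⟶ Ck) : Prop :=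
  IsQuotient (fun σ : Equiv.Perm (Fin k) => (permute C σ).left) π.left

variable (C S : SchC) {k : ℕ} {Ck : SchC} (π : power C k ⟶ Ck)

/-- The automorphism of `C^k × S` permuting the first `k` factors. -/
def permuteS (σ : Equiv.Perm (Fin k)) : power C k ⊗ S ⟶ power C k ⊗ S := permute C σ ▷ S

/-- The projection `p_i × id : C^k × S ⟶ C × S`. -/
def projS (i : Fin k) : power C k ⊗ S ⟶ C ⊗ S := Pi.π (fun _ : Fin k => C) i ▷ S

/-- The external power `ℒ^{⊠k} = ⨂ (p_i × id)^* ℒ` on `C^k × S`. -/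
def boxPower (k : ℕ) (L : (C ⊗ S).left.Modules) : (power C k ⊗ S).left.Modules :=
  tensor fun i : Fin k => (Scheme.Modules.pullback (projS C S i).left).obj L

theorem permuteS_projS (σ : Equiv.Perm (Fin k)) (j : Fin k) :
    (permuteS C S σ).left ≫ (projS C S (σ.symm j)).left = (projS C S j).left := by
  have h : permuteS C S σ ≫ projS C S (σ.symm j) = projS C S j := by
    rw [permuteS, projS, ← comp_whiskerRight]
    simp [permute, projS]
  rw [← Over.comp_left, h]

/-- The natural permutation action on `ℒ^{⊠k}`: `σ` pulls a local section `⨂ s_i` back along the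
permutation automorphism of `C^k × S`, which carries the factor `i` to the factor `σ i`. -/
def permAction (L : (C ⊗ S).left.Modules) (σ : Equiv.Perm (Fin k)) :
    boxPower C S k L ⟶ (Scheme.Modules.pushforward (permuteS C S σ).left).obj (boxPower C S k L) :=
  tensorHom (permuteS C S σ).left σ.symm.bijective fun j =>
    pullSections (permuteS C S σ).left _ _ (permuteS_projS C S σ j) L

/-- `(-1)^μ` times the natural permutation action: `σ` acts by `sgn(σ)^μ` times `permAction`. -/
def twistedAction (μ : ℕ) (L : (C ⊗ S).left.Modules) (σ : Equiv.Perm (Fin k)) :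
    boxPower C S k L ⟶ (Scheme.Modules.pushforward (permuteS C S σ).left).obj (boxPower C S k L) :=
  ((Equiv.Perm.sign σ : ℤ) ^ μ) • permAction C S L σ

variable {C} {π}

theorem permuteS_quotient (hπ : IsSymmetricProduct C π) (σ : Equiv.Perm (Fin k)) :
    (permuteS C S σ).left ≫ (π ▷ S).left = (π ▷ S).left := by
  have h : permute C σ ≫ π = π := Over.OverMorphism.ext (hπ.invariant σ)
  rw [← Over.comp_left, permuteS, ← comp_whiskerRight, h]

/-- The equivariant pushforward of `ℒ^{⊠k}` along `π × id : C^k × S ⟶ C_k × S`, for the symmetric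
group acting by `(-1)^μ` times the natural permutation action. -/
def symmetrization (hπ : IsSymmetricProduct C π) (μ : ℕ) (L : (C ⊗ S).left.Modules) :
    (Ck ⊗ S).left.Modules :=
  equivariantPushforward (fun σ : Equiv.Perm (Fin k) => (permuteS C S σ).left) (π ▷ S).left
    (permuteS_quotient S hπ) (twistedAction C S μ L)

/-- `T_ℒ`: the symmetrization of `ℒ^{⊠k}` for the natural permutation action. -/
def bundleT (hπ : IsSymmetricProduct C π) (L : (C ⊗ S).left.Modules) : (Ck ⊗ S).left.Modules :=
  equivariantPushforward (fun σ : Equiv.Perm (Fin k) => (permuteS C S σ).left) (π ▷ S).left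
    (permuteS_quotient S hπ) (permAction C S L)

variable (π) [NeZero k]

/-- The morphism `C^k ⟶ C × C_k`, `(x₁, …, x_k) ↦ (x₁, x₁ + ⋯ + x_k)`. -/
def incidence : power C k ⟶ C ⊗ Ck := lift (Pi.π (fun _ : Fin k => C) 0) π

/-- The universal degree `k` divisor `𝒟 = {(x, ξ) : x ∈ ξ} ⊆ C × C_k`, as the scheme-theoretic
image of `C^k ⟶ C × C_k`, `(x₁, …, x_k) ↦ (x₁, x₁ + ⋯ + x_k)`. (By symmetry
any other coordinate gives the same image.) -/
def universalDivisor : SchC := Over.mk ((incidence π).left.imageι ≫ (C ⊗ Ck).hom)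

/-- The inclusion `𝒟 ⟶ C × C_k`. -/
def universalDivisorι : universalDivisor π ⟶ C ⊗ Ck := Over.homMk (incidence π).left.imageι

/-- `E_ℒ = ℒ^{[k]} = q_* p^* ℒ`, for the projections `p : 𝒟 × S ⟶ C × S` and
`q : 𝒟 × S ⟶ C_k × S`. -/
def tautologicalBundle (L : (C ⊗ S).left.Modules) : (Ck ⊗ S).left.Modules :=
  (Scheme.Modules.pushforward ((universalDivisorι π ≫ snd C Ck) ▷ S).left).obj
    ((Scheme.Modules.pullback ((universalDivisorι π ≫ fst C Ck) ▷ S).left).obj L)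

/-- `N_ℒ = det E_ℒ = ⋀^k E_ℒ`, the bundle `E_ℒ` having rank `k`. -/
def bundleN (L : (C ⊗ S).left.Modules) : (Ck ⊗ S).left.Modules :=
  exterior k (tautologicalBundle S π L)

end Curve

end SymmetricProduct

end

open SymmetricProduct

noncomputable section

namespace SymmetricProduct

/-! ### Frames of modules and their pullbacks. -/

section Frames

open Scheme.Modules

variable {X Y Z : Scheme.{0}}

/-! For μ = 0 the twist is trivial and the two sheaves coincide. For μ = 1 there is an explicit
comparison map, `Incidence.detHom` : ⋀^k E_L → π_* L^{⊠k}. It sends e_1 ∧ ⋯ ∧ e_k to the alternating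
sum over σ of d_1^* e_{σ 1} ⊗ ⋯ ⊗ d_k^* e_{σ k}, where d_i : C^k × S → 𝒟 × S marks the i-th point. A
permutation multiplies this sum by its sign, so the map lands in the sign-twisted invariants
(`Incidence.detLift`). It remains to check bijectivity on sections over a basis of opens of C_k × S.

Over a small affine open, a frame of L turns sections into functions. What is left is a diagram of
rings R → E → P, the functions on C_k × S, 𝒟 × S and C^k × S, with k maps δ_i : E → P, and the map
becomes a_1 ∧ ⋯ ∧ a_k ↦ det (δ_i a_j). If E is spanned over R by 1, t, …, t^{k-1}, then ⋀^k E has a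
single generator, whose image is a Vandermonde determinant; it is regular when all δ_i t − δ_j t
are, which gives injectivity (`IsSplit.injective_lift`). If P is spanned by the products φ(r) ∏
δ_i(a_i), then antisymmetrizing such a product gives a multiple of a determinant, while
antisymmetrizing an anti-invariant multiplies it by the invertible number k!, which gives
surjectivity (`IsSplit.exists_lift_eq`). Local freeness of E_L is never needed.

The element t is found on C_k, near the image of a closed point of C^k. Since ℂ is infinite,
avoiding finitely many proper subspaces gives a function t on an affine open V of C that is a local
parameter at all the coordinates and separates distinct ones (`exists_parameter`). Newton
interpolation writes each function on V as a polynomial of degree < k in t modulo ∏ (t − c_i). That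
product vanishes on the fibre of 𝒟 over the point, because the monic polynomial of the conjugates of
t reduces to ∏ (X − c_i) there. Nakayama then yields the spanning statement after inverting one
function (`exists_isSplitAway`). Regularity of t_i − t_j on V^k comes from flatness of 𝒪(V) over
ℂ[t] (`tmul_sub_tmul_mem_nonZeroDivisors`), and the spanning of P from 𝒪(V^k) = 𝒪(V)^{⊗k}.

Closed points suffice because C^k is a Jacobson space. The splitting passes from C_k to C_k × S by
flat base change (`IsSplitAway.isSplit_of_flat`), and `exists_isFrame_of_finite` gives one frame of
L near all the points of C × S lying under a given finite fibre. -/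

theorem res_res (M : X.Modules) {U V W : X.Opens} (i : U ⟶ V) (j : V ⟶ W) (m : Γ(M, W)) :
    res M i (res M j m) = res M (i ≫ j) m :=
  congr($(M.presheaf.map_comp j.op i.op) m).symm

@[simp]
theorem res_id (M : X.Modules) {U : X.Opens} (i : U ⟶ U) (m : Γ(M, U)) : res M i m = m :=
  congr($(M.presheaf.map_id (.op U)) m)

theorem app_res {M N : X.Modules} (φ : M ⟶ N) {U V : X.Opens} (i : U ⟶ V) (m : Γ(M, V)) :
    φ.app U (res M i m) = res N i (φ.app V m) :=
  congr($(φ.mapPresheaf.naturality i.op) m)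

theorem res_smul (M : X.Modules) {U V : X.Opens} (i : U ⟶ V) (r : Γ(X, V)) (m : Γ(M, V)) :
    res M i (r • m) = X.presheaf.map i.op r • res M i m :=
  M.map_smul i r m

theorem comp_app_apply {M N K : X.Modules} (φ : M ⟶ N) (ψ : N ⟶ K) (U : X.Opens) (m : Γ(M, U)) :
    (φ ≫ ψ).app U m = ψ.app U (φ.app U m) := rfl

theorem hom_inv_app_apply {M N : X.Modules} (φ : M ⟶ N) [IsIso φ] (U : X.Opens) (m : Γ(M, U)) :
    (inv φ).app U (φ.app U m) = m := by
  rw [← comp_app_apply, IsIso.hom_inv_id]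
  rfl

variable (X) in
/-- The structure sheaf as a module over itself. -/
def unitModule : X.Modules := SheafOfModules.unit X.ringCatSheaf

/-- A function as a section of the structure sheaf regarded as a module. -/
def toUnit {U : X.Opens} (r : Γ(X, U)) : Γ(unitModule X, U) := r

theorem res_toUnit {U V : X.Opens} (i : U ⟶ V) (r : Γ(X, V)) :
    res (unitModule X) i (toUnit r) = toUnit (X.presheaf.map i.op r) := rfl

theorem toUnit_one_surjective {U : X.Opens} (r : Γ(unitModule X, U)) :
    ∃ r' : Γ(X, U), r = r' • toUnit 1 := ⟨r, (mul_one (M := Γ(X, U)) r).symm⟩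

/-- The morphism `𝒪_X ⟶ M` given by a global section of `M`. -/
def unitHom (M : X.Modules) (m : Γ(M, (⊤ : X.Opens))) : unitModule X ⟶ M :=
  (SheafOfModules.unitHomEquiv M).symm
    (PresheafOfModules.sectionsMk (fun U => res M (homOfLE le_top : U.unop ⟶ ⊤) m)
      (fun _ _ i => res_res M i.unop (homOfLE le_top) m))

theorem unitHom_app (M : X.Modules) (m : Γ(M, (⊤ : X.Opens))) (U : X.Opens) (r : Γ(X, U)) :
    (unitHom M m).app U (toUnit r) = r • res M (homOfLE le_top) m := by
  rfl

theorem unitHom_app_one (M : X.Modules) (m : Γ(M, (⊤ : X.Opens))) :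
    (unitHom M m).app ⊤ (toUnit 1) = m := by
  rw [unitHom_app, one_smul, res_id]

theorem unit_app_one {M : X.Modules} (φ : unitModule X ⟶ M) (U : X.Opens) :
    φ.app U (toUnit 1) = res M (homOfLE le_top) (φ.app ⊤ (toUnit 1)) := by
  rw [← app_res, res_toUnit, map_one]

theorem unit_hom_ext {M : X.Modules} {φ ψ : unitModule X ⟶ M}
    (h : φ.app ⊤ (toUnit 1) = ψ.app ⊤ (toUnit 1)) : φ = ψ := by
  ext U r
  obtain ⟨r, rfl⟩ := toUnit_one_surjective r
  rw [Hom.app_smul, Hom.app_smul, unit_app_one φ, unit_app_one ψ, h]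

/-- A frame of `M` over `U`: a section which freely generates `M` over every open subset of `U`. -/
def IsFrame (M : X.Modules) {U : X.Opens} (m : Γ(M, U)) : Prop :=
  ∀ (W : X.Opens) (h : W ≤ U), Function.Bijective fun r : Γ(X, W) => r • res M (homOfLE h) m

theorem IsFrame.restrict {M : X.Modules} {U V : X.Opens} {m : Γ(M, V)} (hm : IsFrame M m)
    (h : U ≤ V) : IsFrame M (res M (homOfLE h) m) := fun W hW => by
  simp only [res_res]
  exact hm W (hW.trans h)

theorem IsFrame.isIso_unitHom {M : X.Modules} {m : Γ(M, (⊤ : X.Opens))} (hm : IsFrame M m) :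
    IsIso (unitHom M m) := by
  rw [Hom.isIso_iff_isIso_app]
  intro U
  rw [ConcreteCategory.isIso_iff_bijective]
  exact hm U le_top

theorem isFrame_of_isIso_unitHom {M : X.Modules} {m : Γ(M, (⊤ : X.Opens))} [IsIso (unitHom M m)] :
    IsFrame M m := fun W _ =>
  ConcreteCategory.bijective_of_isIso ((unitHom M m).app W)

/-- A global section `m` of `M` is a frame if and only if evaluation at `m` identifies
the homomorphisms from `M` to any module `G` with the global sections of `G`. -/
theorem isFrame_top_iff {M : X.Modules} {m : Γ(M, (⊤ : X.Opens))} :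
    IsFrame M m ↔ ∀ G : X.Modules, Function.Bijective fun φ : M ⟶ G => φ.app ⊤ m := by
  constructor
  · intro hm G
    have := hm.isIso_unitHom
    refine ⟨fun φ ψ h => ?_, fun g => ⟨inv (unitHom M m) ≫ unitHom G g, ?_⟩⟩
    · rw [← cancel_epi (unitHom M m)]
      apply unit_hom_ext
      rw [comp_app_apply, comp_app_apply, unitHom_app_one]
      exact h
    · have h1 := hom_inv_app_apply (unitHom M m) ⊤ (toUnit 1)
      rw [unitHom_app_one] at h1
      simp only [comp_app_apply]
      rw [h1, unitHom_app_one]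
  · intro h
    -- Testing against the structure sheaf produces a candidate inverse of `unitHom M m`; testing
    -- against `M` itself shows that it is one.
    obtain ⟨ψ, hψ⟩ := (h (unitModule X)).2 (toUnit 1)
    replace hψ : ψ.app ⊤ m = toUnit 1 := hψ
    have : IsIso (unitHom M m) := by
      refine ⟨ψ, unit_hom_ext ?_, (h M).1 ?_⟩
      · rw [comp_app_apply, unitHom_app_one, hψ]
        rfl
      · simp only [comp_app_apply]
        rw [hψ, unitHom_app_one]
        rfl
    exact isFrame_of_isIso_unitHom

theorem ι_image_le (U : X.Opens) (W : (U : Scheme.{0}).Opens) : U.ι ''ᵁ W ≤ U := by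
  rintro _ ⟨x, -, rfl⟩
  exact x.2

theorem exists_eq_ι_image {U W : X.Opens} (h : W ≤ U) :
    ∃ W' : (U : Scheme.{0}).Opens, W = U.ι ''ᵁ W' :=
  ⟨U.ι ⁻¹ᵁ W, by
    rw [Scheme.Hom.image_preimage_eq_opensRange_inf]
    simpa using h⟩

/-- A section of `M` over `U` as a global section of the restriction of `M` to `U`. -/
def restrictSection {M : X.Modules} {U : X.Opens} (m : Γ(M, U)) : Γ(M.restrict U.ι, ⊤) :=
  res M (homOfLE (ι_image_le U ⊤)) m

theorem restrictSection_surjective {M : X.Modules} {U : X.Opens} (m' : Γ(M.restrict U.ι, ⊤)) :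
    ∃ m : Γ(M, U), restrictSection m = m' := by
  have h : U.ι ''ᵁ ⊤ = U := by simp
  exact ⟨res M (eqToHom h.symm) (show Γ(M, U.ι ''ᵁ ⊤) from m'),
    (res_res M _ _ _).trans (res_id M _ _)⟩

/-- Opens of the scheme `U` correspond to opens of `X` contained in `U`, and sections of the
restriction are sections of `M` over the image, so both conditions concern the same maps. -/
theorem isFrame_restrictSection_iff (M : X.Modules) {U : X.Opens} (m : Γ(M, U)) :
    IsFrame (M.restrict U.ι) (restrictSection m) ↔ IsFrame M m := by
  have h0 : ∀ (W : (U : Scheme.{0}).Opens) (hW : U.ι ''ᵁ W ≤ U),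
      (M.restrictAppIso U.ι W).hom ∘
        (fun r : Γ(U, W) => r • res (M.restrict U.ι) (homOfLE le_top) (restrictSection m)) =
        (fun r : Γ(X, U.ι ''ᵁ W) => r • res M (homOfLE hW) m) ∘ (U.ι.appIso W).inv := by
    intro W hW
    funext r
    have h1 := res_res M (homOfLE (U.ι.image_mono (le_top : W ≤ ⊤))) (homOfLE (ι_image_le U ⊤)) m
    simp only [Function.comp_apply]
    have h2 : ∀ x : Γ(M.restrict U.ι, W), (M.restrictAppIso U.ι W).hom (r • x) =
      (U.ι.appIso W).inv r • (M.restrictAppIso U.ι W).hom x := fun x => rfl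
    rw [h2]
    exact congrArg _ h1
  have h1 : ∀ W : (U : Scheme.{0}).Opens, Function.Bijective (U.ι.appIso W).inv := fun W =>
    ConcreteCategory.bijective_of_isIso (U.ι.appIso W).inv
  have h2 : ∀ W : (U : Scheme.{0}).Opens, Function.Bijective (M.restrictAppIso U.ι W).hom := fun W =>
    ConcreteCategory.bijective_of_isIso (M.restrictAppIso U.ι W).hom
  constructor
  · intro hm W hW
    obtain ⟨W, rfl⟩ := exists_eq_ι_image hW
    have := (h2 W).comp (hm W le_top)
    rw [h0 W hW] at this
    exact (Function.Bijective.of_comp_iff _ (h1 W)).1 this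
  · intro hm W hW
    have h3 := (hm (U.ι ''ᵁ W) (ι_image_le U W)).comp (h1 W)
    rw [← h0 W (ι_image_le U W)] at h3
    exact (Function.Bijective.of_comp_iff' (h2 W) _).1 h3

theorem exists_isFrame {L : X.Modules} (hL : IsLineBundle L) (x : X) :
    ∃ (U : X.Opens) (_ : x ∈ U) (m : Γ(L, U)), IsFrame L m := by
  obtain ⟨U, hx, ⟨e⟩⟩ := hL x
  let e' : unitModule (U : Scheme.{0}) ≅ L.restrict U.ι := e.symm
  obtain ⟨m, hm⟩ := restrictSection_surjective (e'.hom.app ⊤ (toUnit 1))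
  refine ⟨U, hx, m, (isFrame_restrictSection_iff L m).1 ?_⟩
  have h2 : unitHom (L.restrict U.ι) (restrictSection m) = e'.hom :=
    unit_hom_ext ((unitHom_app_one _ _).trans hm)
  have : IsIso (unitHom (L.restrict U.ι) (restrictSection m)) := h2 ▸ inferInstance
  exact isFrame_of_isIso_unitHom

/-- A section `m` of `M` over `U` is a frame if and only if evaluation at `m` identifies
the homomorphisms from `M` to `j_* G`, for the inclusion `j` of `U`, with the sections of `G`. -/
theorem isFrame_iff {M : X.Modules} {U : X.Opens} {m : Γ(M, U)} :
    IsFrame M m ↔ ∀ G : (U : Scheme.{0}).Modules,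
      Function.Bijective fun φ : M ⟶ (pushforward U.ι).obj G => φ.app U m := by
  rw [← isFrame_restrictSection_iff M m, isFrame_top_iff]
  refine forall_congr' fun G => ?_
  -- Restriction to `U` is left adjoint to the direct image along `U.ι`; after transposing, only the
  -- equality `U.ι ⁻¹ᵁ U = ⊤` has to be accounted for.
  rw [← Function.Bijective.of_comp_iff _ ((restrictAdjunction U.ι).homEquiv M G).symm.bijective]
  have h : U.ι ⁻¹ᵁ U = ⊤ := by simp
  have h2 : Function.Bijective (res G (eqToHom h.symm : ⊤ ⟶ U.ι ⁻¹ᵁ U)) :=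
    ConcreteCategory.bijective_of_isIso (G.presheaf.map (eqToHom h.symm : ⊤ ⟶ U.ι ⁻¹ᵁ U).op)
  refine Iff.trans ?_ (Function.Bijective.of_comp_iff' h2 _)
  refine iff_of_eq (congrArg _ ?_)
  funext φ
  have h3 := app_res φ (homOfLE (ι_image_le U ⊤)) m
  have h4 : (((restrictAdjunction U.ι).homEquiv M G).symm φ) =
      (restrictFunctor U.ι).map φ ≫ (restrictAdjunction U.ι).counit.app G :=
    Adjunction.homEquiv_counit _ _ _ _
  simp only [Function.comp_apply, h4, comp_app_apply]
  refine (congrArg (((restrictAdjunction U.ι).counit.app G).app ⊤) h3).trans ?_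
  exact res_res G _ _ _

/-- The pullback of a section along `f`. -/
def pullSection (f : X ⟶ Y) {M : Y.Modules} {U : Y.Opens} (m : Γ(M, U)) :
    Γ((Scheme.Modules.pullback f).obj M, f ⁻¹ᵁ U) :=
  ((pullbackPushforwardAdjunction f).unit.app M).app U m

/-- By adjunction, maps from f^* M to a direct image from f⁻¹ U are maps from M to a direct image
from U. The characterization `isFrame_iff` therefore transfers, and the sections of a pullback never
have to be described. -/
theorem IsFrame.pullSection (f : X ⟶ Y) {M : Y.Modules} {U : Y.Opens} {m : Γ(M, U)}
    (hm : IsFrame M m) : IsFrame _ (pullSection f m) := by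
  rw [isFrame_iff] at hm ⊢
  intro G
  have e : (pushforward U.ι).obj ((pushforward (f ∣_ U)).obj G) ≅
      (pushforward f).obj ((pushforward (f ⁻¹ᵁ U).ι).obj G) :=
    (pushforwardComp _ _).app G ≪≫ (pushforwardCongr (morphismRestrict_ι f U)).app G ≪≫
      ((pushforwardComp _ _).app G).symm
  have h1 := hm ((pushforward (f ∣_ U)).obj G)
  have h2 : Function.Bijective
      fun φ : M ⟶ (pushforward f).obj ((pushforward (f ⁻¹ᵁ U).ι).obj G) => φ.app U m := by
    refine ⟨fun φ ψ h => ?_, fun g => ?_⟩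
    · rw [← cancel_mono e.inv]
      exact h1.1 (congrArg (e.inv.app U) h)
    · obtain ⟨φ, hφ⟩ := h1.2 (e.inv.app U g)
      refine ⟨φ ≫ e.hom, ?_⟩
      have h3 := congrArg (e.hom.app U) hφ
      refine Eq.trans h3 ?_
      rw [← comp_app_apply, e.inv_hom_id]
      rfl
  exact h2.comp ((pullbackPushforwardAdjunction f).homEquiv M
    ((pushforward (f ⁻¹ᵁ U).ι).obj G)).bijective

end Frames

/-! ### Sections of pullbacks, associated sheaves and limits. -/

section Sheafification

open Scheme.Modules

variable {X Y Z : Scheme.{0}}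

/-- The units of the composite adjunction and of the adjunction for `f ≫ p` correspond under
`pullbackComp`, by conjugation of adjoints. Every later computation with `pullSections` rests on
this rule. -/
theorem pullSections_pullSection (f : X ⟶ Y) (p : Y ⟶ Z) (q : X ⟶ Z) (h : f ≫ p = q)
    (L : Z.Modules) {U : Z.Opens} (m : Γ(L, U)) :
    (pullSections f p q h L).app (p ⁻¹ᵁ U) (pullSection p m) =
      res _ (eqToHom (by rw [← h]; rfl)) (pullSection q m) := by
  subst h
  refine Eq.trans ?_ (res_id _ _ (pullSection (f ≫ p) m)).symm
  have h1 := unit_conjugateEquiv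
    ((pullbackPushforwardAdjunction p).comp (pullbackPushforwardAdjunction f))
      (pullbackPushforwardAdjunction (f ≫ p)) (pullbackComp f p).inv L
  rw [conjugateEquiv_pullbackComp_inv] at h1
  have h2 : ((pullbackPushforwardAdjunction f).unit.app _).app (p ⁻¹ᵁ U) (pullSection p m) =
    ((pullbackComp f p).inv.app L).app _ (pullSection (f ≫ p) m) :=
    congr(($h1).app U m)
  have h3 : (pullSections f p (f ≫ p) rfl L).app (p ⁻¹ᵁ U) (pullSection p m) =
    ((pullbackComp f p).hom.app L).app _
      (((pullbackPushforwardAdjunction f).unit.app _).app (p ⁻¹ᵁ U) (pullSection p m)) := rfl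
  rw [h3, h2]
  exact congr(($((pullbackComp f p).inv_hom_id_app L)).app ((f ≫ p) ⁻¹ᵁ U) (pullSection (f ≫ p) m))

instance (P : X.PresheafOfModules) (U : X.Opens) : Module Γ(X, U) (P.obj (.op U)) :=
  (P.obj (.op U)).isModule

/-- The restriction maps of a presheaf of modules, as semilinear maps. -/
def presheafRes (P : X.PresheafOfModules) {U V : X.Opens} (i : U ⟶ V) :
    P.obj (.op V) →ₛₗ[(X.presheaf.map i.op).hom] P.obj (.op U) :=
  (ModuleCat.semilinearMapAddEquiv (X.presheaf.map i.op).hom _ _).symm (P.map i.op)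

/-- The canonical map from the sections of a presheaf to those of the associated sheaf. -/
def toSheafify (P : X.PresheafOfModules) (U : X.Opens) :
    P.obj (.op U) →ₗ[Γ(X, U)] Γ(sheafify P, U) :=
  (((PresheafOfModules.sheafificationAdjunction (𝟙 X.ringCatSheaf.obj)).unit.app P).app (.op U)).hom

theorem toSheafify_res (P : X.PresheafOfModules) {U V : X.Opens} (i : U ⟶ V) (x : P.obj (.op V)) :
    toSheafify P U (presheafRes P i x) = res (sheafify P) i (toSheafify P V x) :=
  PresheafOfModules.naturality_apply
    ((PresheafOfModules.sheafificationAdjunction (𝟙 X.ringCatSheaf.obj)).unit.app P) i.op x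

theorem toSheafify_locallyInjective (P : X.PresheafOfModules) {U : X.Opens}
    {a b : P.obj (.op U)} (h : toSheafify P U a = toSheafify P U b) (x : X) (hx : x ∈ U) :
    ∃ (V : X.Opens) (i : V ⟶ U), x ∈ V ∧ presheafRes P i a = presheafRes P i b := by
  have := Presheaf.equalizerSieve_mem (Opens.grothendieckTopology X)
    (CategoryTheory.toSheafify (Opens.grothendieckTopology X) P.presheaf) a b h
  obtain ⟨V, i, hi, hV⟩ := this x hx
  exact ⟨V, i, hV, hi⟩

theorem toSheafify_locallySurjective (P : X.PresheafOfModules) {U : X.Opens}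
    (s : Γ(sheafify P, U)) (x : X) (hx : x ∈ U) :
    ∃ (V : X.Opens) (i : V ⟶ U) (a : P.obj (.op V)), x ∈ V ∧ toSheafify P V a = res (sheafify P) i s := by
  have := Presheaf.imageSieve_mem (Opens.grothendieckTopology X)
    (CategoryTheory.toSheafify (Opens.grothendieckTopology X) P.presheaf) (U := .op U) s
  obtain ⟨V, i, ⟨a, ha⟩, hV⟩ := this x hx
  exact ⟨V, i, a, hV, ha⟩

/-- The homomorphism from the associated sheaf induced by a homomorphism of presheaves. -/
def sheafifyDesc {P : X.PresheafOfModules} {K : X.Modules}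
    (φ : P ⟶ (toPresheafOfModules X).obj K) : sheafify P ⟶ K :=
  ((PresheafOfModules.sheafificationAdjunction (𝟙 X.ringCatSheaf.obj)).homEquiv P K).symm φ

theorem sheafifyDesc_toSheafify {P : X.PresheafOfModules} {K : X.Modules}
    (φ : P ⟶ (toPresheafOfModules X).obj K) (U : X.Opens) (x : P.obj (.op U)) :
    (sheafifyDesc φ).app U (toSheafify P U x) = φ.app (.op U) x := by
  have h := ((PresheafOfModules.sheafificationAdjunction (𝟙 X.ringCatSheaf.obj)).homEquiv
    P K).apply_symm_apply φ
  exact congr(($h).app (.op U) x)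

theorem sheafify_hom_ext {P : X.PresheafOfModules} {K : X.Modules} {φ ψ : sheafify P ⟶ K}
    (h : ∀ (U : X.Opens) (x : P.obj (.op U)), φ.app U (toSheafify P U x) = ψ.app U (toSheafify P U x)) : φ = ψ := by
  apply ((PresheafOfModules.sheafificationAdjunction (𝟙 X.ringCatSheaf.obj)).homEquiv P K).injective
  ext U x
  exact h U.unop x

theorem eq_of_locally_eq (M : X.Modules) {U : X.Opens} {a b : Γ(M, U)}
    (h : ∀ x ∈ U, ∃ (V : X.Opens) (i : V ⟶ U), x ∈ V ∧ res M i a = res M i b) : a = b := by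
  choose V i hV hi using h
  refine TopCat.Sheaf.eq_of_locally_eq' ⟨M.presheaf, M.isSheaf⟩ (fun x : U => V x x.2) U
    (fun x => i x x.2) ?_ a b (fun x => hi x x.2)
  intro x hx
  exact TopologicalSpace.Opens.mem_iSup.2 ⟨⟨x, hx⟩, hV x hx⟩

theorem exists_glue (M : X.Modules) {U : X.Opens} {ι : Type} (V : ι → X.Opens) (i : ∀ a, V a ⟶ U)
    (hV : U ≤ iSup V) (s : ∀ a, Γ(M, V a))
    (hs : ∀ a b, res M (homOfLE inf_le_left : V a ⊓ V b ⟶ V a) (s a) =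
      res M (homOfLE inf_le_right : V a ⊓ V b ⟶ V b) (s b)) :
    ∃ t : Γ(M, U), ∀ a, res M (i a) t = s a := by
  obtain ⟨t, ht, -⟩ := TopCat.Sheaf.existsUnique_gluing' ⟨M.presheaf, M.isSheaf⟩ V U i hV s
    (fun a b => hs a b)
  exact ⟨t, ht⟩

/-- A homomorphism from a presheaf to a sheaf which is bijective on a basis of open sets
induces an isomorphism on the associated sheaf. -/
theorem isIso_sheafifyDesc {P : X.PresheafOfModules} {K : X.Modules}
    (φ : P ⟶ (toPresheafOfModules X).obj K)
    (h : ∀ (x : X) (U : X.Opens), x ∈ U → ∃ V : X.Opens, x ∈ V ∧ V ≤ U ∧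
      Function.Bijective (φ.app (.op V))) : IsIso (sheafifyDesc φ) := by
  rw [Hom.isIso_iff_isIso_app]
  have hφ : ∀ {U V : X.Opens} (i : V ⟶ U) (a : P.obj (.op U)),
      φ.app (.op V) (presheafRes P i a) = res K i (φ.app (.op U) a) := fun i a =>
    PresheafOfModules.naturality_apply φ i.op a
  have hinj : ∀ U, Function.Injective ((sheafifyDesc φ).app U) := by
    intro U
    refine (injective_iff_map_eq_zero ((sheafifyDesc φ).app U).hom).2 fun d hd => ?_
    refine eq_of_locally_eq _ fun x hx => ?_
    obtain ⟨V, i, a, hxV, ha⟩ := toSheafify_locallySurjective P d x hx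
    obtain ⟨W, hxW, hWV, hW⟩ := h x V hxV
    refine ⟨W, homOfLE hWV ≫ i, hxW, ?_⟩
    have h1 : φ.app (.op V) a = 0 := by
      rw [← sheafifyDesc_toSheafify, ha, app_res]
      refine (congrArg _ hd).trans (map_zero _)
    have h2 : presheafRes P (homOfLE hWV) a = 0 := by
      apply hW.1
      exact (hφ _ _).trans ((congrArg _ h1).trans ((map_zero (res K _)).trans
        (map_zero (φ.app (.op W)).hom).symm))
    rw [map_zero, ← res_res, ← ha, ← toSheafify_res, h2, map_zero]
  intro U
  rw [ConcreteCategory.isIso_iff_bijective]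
  refine ⟨hinj U, fun k => ?_⟩
  choose V hxV hVU hV using fun x : U => h x U x.2
  -- Injectivity is already known over every open set, so the local preimages agree on overlaps and
  -- glue.
  choose a ha using fun x : U => (hV x).2 (res K (homOfLE (hVU x)) k)
  obtain ⟨t, ht⟩ := exists_glue (sheafify P) V (fun x => homOfLE (hVU x))
    (fun x hx => TopologicalSpace.Opens.mem_iSup.2 ⟨⟨x, hx⟩, hxV ⟨x, hx⟩⟩)
    (fun x => toSheafify P (V x) (a x)) (fun x y => by
      apply hinj
      simp only [app_res, sheafifyDesc_toSheafify, ha, res_res]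
      rfl)
  refine ⟨t, eq_of_locally_eq K fun x hx => ⟨V ⟨x, hx⟩, homOfLE (hVU ⟨x, hx⟩), hxV ⟨x, hx⟩, ?_⟩⟩
  rw [← app_res, ht, sheafifyDesc_toSheafify, ha]

/-- Local coefficients are unique by `hinj`, hence agree on overlaps and glue to a global
coefficient. -/
theorem isFrame_of_locally {M : X.Modules} {U : X.Opens} {m : Γ(M, U)}
    (hinj : ∀ (W : X.Opens) (h : W ≤ U) (r : Γ(X, W)), r • res M (homOfLE h) m = 0 → r = 0)
    (hsurj : ∀ (W : X.Opens) (h : W ≤ U) (s : Γ(M, W)), ∀ x ∈ W, ∃ (V : X.Opens) (hV : V ≤ W)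
      (r : Γ(X, V)), x ∈ V ∧ r • res M (homOfLE (hV.trans h)) m = res M (homOfLE hV) s) :
    IsFrame M m := by
  have hinj' : ∀ (W : X.Opens) (h : W ≤ U),
      Function.Injective fun r : Γ(X, W) => r • res M (homOfLE h) m := by
    intro W h r r' hr
    refine sub_eq_zero.1 (hinj W h _ ?_)
    rw [sub_smul]
    exact sub_eq_zero.2 hr
  refine fun W h => ⟨hinj' W h, fun s => ?_⟩
  choose V hVW r hxV hr using fun x : W => hsurj W h s x x.2
  obtain ⟨t, ht⟩ := exists_glue (unitModule X) V (fun x => homOfLE (hVW x))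
    (fun x hx => TopologicalSpace.Opens.mem_iSup.2 ⟨⟨x, hx⟩, hxV ⟨x, hx⟩⟩)
    (fun x => toUnit (r x)) (fun x y => by
      rw [res_toUnit, res_toUnit]
      congr 1
      apply hinj' (V x ⊓ V y) ((inf_le_left.trans (hVW x)).trans h)
      have h1 := congrArg (res M (homOfLE inf_le_left : V x ⊓ V y ⟶ V x)) (hr x)
      have h2 := congrArg (res M (homOfLE inf_le_right : V x ⊓ V y ⟶ V y)) (hr y)
      rw [res_smul, res_res, res_res] at h1 h2
      exact h1.trans h2.symm)
  let t' : Γ(X, W) := t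
  refine ⟨t', eq_of_locally_eq M fun x hx => ⟨V ⟨x, hx⟩, homOfLE (hVW _), hxV _, ?_⟩⟩
  rw [← hr, res_smul, res_res]
  have h3 : X.presheaf.map (homOfLE (hVW ⟨x, hx⟩)).op t' = r ⟨x, hx⟩ := ht ⟨x, hx⟩
  rw [h3]
  rfl

theorem presheafRes_presheafRes (P : X.PresheafOfModules) {U V W : X.Opens} (i : U ⟶ V) (j : V ⟶ W)
    (m : P.obj (.op W)) : presheafRes P i (presheafRes P j m) = presheafRes P (i ≫ j) m :=
  congr($(P.presheaf.map_comp j.op i.op) m).symm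

/-- A free generator of the presheaf stays one after sheafification: elements of the sheaf come
locally from the presheaf, and vanishing can be checked locally there. -/
theorem isFrame_toSheafify (P : X.PresheafOfModules) {U : X.Opens} (p : P.obj (.op U))
    (hp : ∀ (W : X.Opens) (h : W ≤ U),
      Function.Bijective fun r : Γ(X, W) => r • presheafRes P (homOfLE h) p) :
    IsFrame (sheafify P) (toSheafify P U p) := by
  have key : ∀ (W : X.Opens) (h : W ≤ U) (r : Γ(X, W)),
      r • res (sheafify P) (homOfLE h) (toSheafify P U p) =
        toSheafify P W (r • presheafRes P (homOfLE h) p) := by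
    intro W h r
    rw [_root_.map_smul, toSheafify_res]
  refine isFrame_of_locally (fun W h r hr => ?_) (fun W h s x hx => ?_)
  · rw [key, ← map_zero (toSheafify P W)] at hr
    refine eq_of_locally_eq (unitModule X) (a := toUnit r) (b := 0) fun x hx => ?_
    obtain ⟨V, i, hxV, hV⟩ := toSheafify_locallyInjective P hr x hx
    refine ⟨V, i, hxV, ?_⟩
    rw [res_toUnit, map_zero]
    apply (hp V (i.le.trans h)).1
    rw [map_smulₛₗ, presheafRes_presheafRes, map_zero] at hV
    exact hV.trans (zero_smul _ _).symm
  · obtain ⟨V, i, a, hxV, ha⟩ := toSheafify_locallySurjective P s x hx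
    obtain ⟨r, hr⟩ := (hp V (i.le.trans h)).2 a
    refine ⟨V, i.le, r, hxV, ?_⟩
    rw [key]
    exact (congrArg _ hr).trans ha

/-- The sections over `U`, as a functor to abelian groups. -/
def sectionsFunctor (U : X.Opens) : X.Modules ⥤ Ab :=
  toPresheaf X ⋙ (evaluation _ _).obj (.op U)

instance (U : X.Opens) : PreservesLimits (sectionsFunctor U) :=
  have : PreservesLimits ((evaluation _ Ab).obj (.op U : X.Opensᵒᵖ)) := inferInstance
  comp_preservesLimits (toPresheaf X) ((evaluation _ Ab).obj (.op U : X.Opensᵒᵖ))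

/-- Taking sections preserves limits, hence monomorphisms. This is how sections of an equivariant
pushforward are compared with sections of the direct image. -/
theorem kernel_ι_app_injective {M N : X.Modules} (φ : M ⟶ N) (U : X.Opens) :
    Function.Injective ((kernel.ι φ).app U) := by
  have : Mono ((sectionsFunctor U).map (kernel.ι φ)) := inferInstance
  exact (AddCommGrpCat.mono_iff_injective _).1 this

theorem pi_lift_app_eq_zero {ι : Type} {M : X.Modules} {N : ι → X.Modules} (φ : ∀ i, M ⟶ N i)
    (U : X.Opens) (m : Γ(M, U)) (hm : ∀ i, (φ i).app U m = 0) : (Pi.lift φ).app U m = 0 := by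
  refine Concrete.isLimit_ext _ (isLimitOfPreserves (sectionsFunctor U)
    (limit.isLimit (Discrete.functor N))) _ _ ?_
  rintro ⟨j⟩
  have h : (Pi.lift φ ≫ Pi.π N j).app U m = 0 := by
    rw [Pi.lift_π]
    exact hm j
  exact h.trans (map_zero _).symm

theorem app_eq_zero_of_pi_lift {ι : Type} {M : X.Modules} {N : ι → X.Modules} (φ : ∀ i, M ⟶ N i)
    (U : X.Opens) (m : Γ(M, U)) (hm : (Pi.lift φ).app U m = 0) (i : ι) : (φ i).app U m = 0 := by
  rw [← Pi.lift_π φ i, comp_app_apply, hm, map_zero]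

end Sheafification

/-! ### Sections of tensor products. -/

section TensorSections

open Scheme.Modules

variable {X Y Z : Scheme.{0}}

/-- The values on pulled-back sections are the values of the adjoint homomorphism. -/
theorem pullback_hom_ext (p : X ⟶ Y) {L : Y.Modules} {N : X.Modules}
    {φ ψ : (Scheme.Modules.pullback p).obj L ⟶ N}
    (h : ∀ (U : Y.Opens) (m : Γ(L, U)), φ.app _ (pullSection p m) = ψ.app _ (pullSection p m)) :
    φ = ψ := by
  apply ((pullbackPushforwardAdjunction p).homEquiv L N).injective
  ext U m
  exact h U m

theorem isIso_of_bijective_toSheafify {P : X.PresheafOfModules} {K : X.Modules}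
    (ψ : sheafify P ⟶ K)
    (h : ∀ (x : X) (U : X.Opens), x ∈ U → ∃ V : X.Opens, x ∈ V ∧ V ≤ U ∧
      Function.Bijective fun s : P.obj (.op V) => ψ.app V (toSheafify P V s)) : IsIso ψ := by
  let e := (PresheafOfModules.sheafificationAdjunction (𝟙 X.ringCatSheaf.obj)).homEquiv P K
  have h1 : sheafifyDesc (e ψ) = ψ := e.symm_apply_apply ψ
  rw [← h1]
  exact isIso_sheafifyDesc _ h

/-- The local section `⨂ x i` of a tensor product. -/
def tensorSection {ι : Type} (M : ι → X.Modules) (U : X.Opens) :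
    MultilinearMap Γ(X, U) (fun i => Γ(M i, U)) Γ(tensor M, U) :=
  LinearMap.compMultilinearMap
    (M₂ := ⨂[Γ(X, U)] i, Γ(M i, U)) (toSheafify (tensorPresheaf M) U)
    (PiTensorProduct.tprod Γ(X, U))

theorem tensorSection_apply {ι : Type} (M : ι → X.Modules) (U : X.Opens) (x : ∀ i, Γ(M i, U)) :
    tensorSection M U x = toSheafify (tensorPresheaf M) U (PiTensorProduct.tprod Γ(X, U) x) := rfl

theorem presheafRes_tprod {ι : Type} (M : ι → X.Modules) {U V : X.Opens} (i : U ⟶ V)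
    (x : ∀ i, Γ(M i, V)) :
    presheafRes (tensorPresheaf M) i (PiTensorProduct.tprod Γ(X, V) x) =
      PiTensorProduct.tprod Γ(X, U) fun j => res (M j) i (x j) :=
  piTensorMap_tprod (X.presheaf.map i.op).hom (e := fun i => i) Function.bijective_id
      (fun j => res (M j) i) x

theorem res_tensorSection {ι : Type} (M : ι → X.Modules) {U V : X.Opens} (i : U ⟶ V)
    (x : ∀ i, Γ(M i, V)) :
    res _ i (tensorSection M V x) = tensorSection M U fun j => res (M j) i (x j) := by
  rw [tensorSection_apply, tensorSection_apply, ← presheafRes_tprod]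
  exact (toSheafify_res _ _ _).symm

theorem tensorHom_app_tensorSection (f : X ⟶ Y) {ι ι' : Type} {e : ι' → ι} (he : e.Bijective)
    {M : ι → Y.Modules} {N : ι' → X.Modules} (φ : ∀ j, M (e j) ⟶ (pushforward f).obj (N j))
    (U : Y.Opens) (x : ∀ i, Γ(M i, U)) :
    (tensorHom f he φ).app U (tensorSection M U x) =
      tensorSection N (f ⁻¹ᵁ U) fun j => (φ j).app U (x (e j)) := by
  let ψ : tensorPresheaf M ⟶ (toPresheafOfModules Y).obj ((pushforward f).obj (tensor N)) :=
    tensorPresheafHom f he φ ≫ (PresheafOfModules.pushforward f.toRingCatSheafHom.hom).map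
    ((PresheafOfModules.sheafificationAdjunction (𝟙 X.ringCatSheaf.obj)).unit.app
      (tensorPresheaf N))
  have h1 : (tensorHom f he φ).app U (tensorSection M U x) =
      ψ.app (.op U) (PiTensorProduct.tprod Γ(Y, U) x) := sheafifyDesc_toSheafify ψ U _
  have h2 : ψ.app (.op U) (PiTensorProduct.tprod Γ(Y, U) x) =
      toSheafify (tensorPresheaf N) (f ⁻¹ᵁ U)
        (piTensorMap (f.app U).hom he (fun j => appₛₗ f (φ j) U)
          (PiTensorProduct.tprod Γ(Y, U) x)) := rfl
  rw [h1, h2, piTensorMap_tprod]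
  rfl

/-- Multiplying the coordinates with respect to the `x i` gives a linear form equal to 1 on `⨂ x i`,
whence injectivity. Surjectivity is multilinearity: the coordinates of a pure tensor come out as a
product. -/
theorem bijective_smul_tprod {R ι : Type} [CommRing R] [Fintype ι] {M : ι → Type}
    [∀ i, AddCommGroup (M i)] [∀ i, Module R (M i)] (x : ∀ i, M i)
    (hx : ∀ i, Function.Bijective fun r : R => r • x i) :
    Function.Bijective fun r : R => r • PiTensorProduct.tprod R x := by
  let e : ∀ i, R ≃ₗ[R] M i := fun i =>
    LinearEquiv.ofBijective (LinearMap.toSpanSingleton R (M i) (x i)) (hx i)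
  have he : ∀ i r, e i r = r • x i := fun i r => rfl
  have he' : ∀ i, (e i).symm (x i) = 1 := fun i => by
    rw [LinearEquiv.symm_apply_eq, he, one_smul]
  let m : MultilinearMap R M R :=
    (MultilinearMap.mkPiAlgebra R ι R).compLinearMap fun i => (e i).symm.toLinearMap
  constructor
  · intro r r' h
    have := congrArg (PiTensorProduct.lift m) h
    simpa [m, he'] using this
  · intro t
    induction t using PiTensorProduct.induction_on with
    | smul_tprod r y =>
      refine ⟨r * ∏ i, (e i).symm (y i), ?_⟩
      simp only [mul_smul]
      rw [← MultilinearMap.map_smul_univ]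
      congr 2
      funext i
      rw [← he, LinearEquiv.apply_symm_apply]
    | add a b ha hb =>
      obtain ⟨r, rfl⟩ := ha
      obtain ⟨r', rfl⟩ := hb
      exact ⟨r + r', add_smul _ _ _⟩

theorem IsFrame.tensorSection {ι : Type} [Fintype ι] {M : ι → X.Modules} {U : X.Opens}
    {x : ∀ i, Γ(M i, U)} (hx : ∀ i, IsFrame (M i) (x i)) :
    IsFrame (tensor M) (tensorSection M U x) := by
  refine isFrame_toSheafify (tensorPresheaf M) _ fun W h => ?_
  have h1 := bijective_smul_tprod (R := Γ(X, W)) (fun i => res (M i) (homOfLE h) (x i))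
    (fun i => hx i W h)
  have h2 := presheafRes_tprod M (homOfLE h) x
  refine Eq.mpr ?_ h1
  exact congrArg (fun t => Function.Bijective fun r : Γ(X, W) => r • t) h2

end TensorSections

/-! ### Direct images and multilinear maps of sections. -/

section

open Scheme.Modules

/-- A homomorphism from a presheaf of modules to a sheaf of modules, given on sections. -/
def presheafHomMk {X : Scheme.{0}} {P : X.PresheafOfModules} {K : X.Modules}
    (φ : ∀ U : X.Opens, P.obj (.op U) →ₗ[Γ(X, U)] Γ(K, U))
    (h : ∀ (U V : X.Opens) (i : U ⟶ V) (x : P.obj (.op V)),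
      φ U (presheafRes P i x) = res K i (φ V x)) :
    P ⟶ (toPresheafOfModules X).obj K where
  app U := ModuleCat.ofHom (φ U.unop)
  naturality {U V} i := by
    refine ModuleCat.hom_ext (@LinearMap.ext _ _ _ _ _ _ _ _ (_) (_) _ _ _ (fun x => ?_))
    exact h V.unop U.unop i.unop x

/-- Precomposition of a multilinear map with semilinear maps, and postcomposition with a map
which is semilinear in the opposite direction. -/
def multilinearComp {R S ι : Type} [CommRing R] [CommRing S] (φ : R →+* S) {M N : ι → Type} {P P' : Type}
    [∀ i, AddCommGroup (M i)] [∀ i, Module R (M i)] [∀ i, AddCommGroup (N i)] [∀ i, Module S (N i)]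
    [AddCommGroup P] [Module S P] [AddCommGroup P'] [Module R P'] (T : MultilinearMap S N P)
    (g : ∀ i, M i →ₛₗ[φ] N i) (h : P →+ P') (hh : ∀ r x, h (φ r • x) = r • h x) :
    MultilinearMap R M P' where
  toFun e := h (T fun i => g i (e i))
  map_update_add' := by
    intro _ e i a b
    have key : ∀ c, (fun j => g j (Function.update e i c j)) =
        Function.update (fun j => g j (e j)) i (g i c) := by
      intro c
      funext j
      by_cases h : j = i
      · subst h; simp
      · simp [Function.update_of_ne h]
    rw [key, key, key, map_add, T.map_update_add, map_add]
  map_update_smul' := by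
    intro _ e i r a
    have key : ∀ c, (fun j => g j (Function.update e i c j)) =
        Function.update (fun j => g j (e j)) i (g i c) := by
      intro c
      funext j
      by_cases h : j = i
      · subst h; simp
      · simp [Function.update_of_ne h]
    rw [key, key, map_smulₛₗ, T.map_update_smul, hh]

section PushforwardSections

variable {X Y : Scheme.{0}}

/-- The sections of a direct image. -/
def toPush (f : X ⟶ Y) (M : X.Modules) (V : Y.Opens) :
    Γ(M, f ⁻¹ᵁ V) ≃+ Γ((pushforward f).obj M, V) := AddEquiv.refl _

theorem toPush_smul (f : X ⟶ Y) (M : X.Modules) (V : Y.Opens) (r : Γ(Y, V)) (m : Γ(M, f ⁻¹ᵁ V)) :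
    toPush f M V ((f.app V).hom r • m) = r • toPush f M V m := rfl

theorem res_toPush (f : X ⟶ Y) (M : X.Modules) {U V : Y.Opens} (i : U ⟶ V) (m : Γ(M, f ⁻¹ᵁ V)) :
    res _ i (toPush f M V m) = toPush f M U (res M ((TopologicalSpace.Opens.map f.base).map i) m) :=
  rfl

theorem appₛₗ_res (f : X ⟶ Y) {M : Y.Modules} {N : X.Modules} (φ : M ⟶ (pushforward f).obj N)
    {U V : Y.Opens} (i : U ⟶ V) (m : Γ(M, V)) :
    appₛₗ f φ U (res M i m) =
      res N ((TopologicalSpace.Opens.map f.base).map i) (appₛₗ f φ V m) :=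
  app_res φ i m

/-- The homomorphism `q_* M ⟶ f_* N` induced by a homomorphism `M ⟶ d_* N` if `d ≫ q = f`. -/
def pushHom {D : Scheme.{0}} {d : X ⟶ D} {q : D ⟶ Y} {f : X ⟶ Y} (h : d ≫ q = f)
    {M : D.Modules} {N : X.Modules} (φ : M ⟶ (pushforward d).obj N) :
    (pushforward q).obj M ⟶ (pushforward f).obj N :=
  (pushforward q).map φ ≫ (pushforwardComp d q).hom.app N ≫ (pushforwardCongr h).hom.app N

theorem preimage_comp_eq {D : Scheme.{0}} {d : X ⟶ D} {q : D ⟶ Y} {f : X ⟶ Y} (h : d ≫ q = f)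
    (V : Y.Opens) : f ⁻¹ᵁ V = d ⁻¹ᵁ q ⁻¹ᵁ V := by
  rw [← h]; rfl

theorem pushHom_app {D : Scheme.{0}} {d : X ⟶ D} {q : D ⟶ Y} {f : X ⟶ Y} (h : d ≫ q = f)
    {M : D.Modules} {N : X.Modules} (φ : M ⟶ (pushforward d).obj N) (V : Y.Opens)
    (m : Γ(M, q ⁻¹ᵁ V)) :
    (pushHom h φ).app V (toPush q M V m) = toPush f N V
      (res N (eqToHom (preimage_comp_eq h V)) (appₛₗ d φ (q ⁻¹ᵁ V) m)) := rfl

/-- The multilinear map `e ↦ T (φ_i e_i)` on sections over `V`. -/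
def pushMultilinear {ι : Type} (f : X ⟶ Y) {E : Y.Modules} {N : ι → X.Modules} {B : X.Modules}
    (T : ∀ U : X.Opens, MultilinearMap Γ(X, U) (fun i => Γ(N i, U)) Γ(B, U))
    (φ : ∀ i, E ⟶ (pushforward f).obj (N i)) (V : Y.Opens) :
    MultilinearMap Γ(Y, V) (fun _ : ι => Γ(E, V)) Γ((pushforward f).obj B, V) :=
  multilinearComp (f.app V).hom (T (f ⁻¹ᵁ V)) (fun i => appₛₗ f (φ i) V)
    (toPush f B V) (toPush_smul f B V)

theorem pushMultilinear_apply {ι : Type} (f : X ⟶ Y) {E : Y.Modules} {N : ι → X.Modules}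
    {B : X.Modules} (T : ∀ U : X.Opens, MultilinearMap Γ(X, U) (fun i => Γ(N i, U)) Γ(B, U))
    (φ : ∀ i, E ⟶ (pushforward f).obj (N i)) (V : Y.Opens) (e : ι → Γ(E, V)) :
    pushMultilinear f T φ V e = toPush f B V (T (f ⁻¹ᵁ V) fun i => appₛₗ f (φ i) V (e i)) := rfl

theorem res_pushMultilinear {ι : Type} (f : X ⟶ Y) {E : Y.Modules} {N : ι → X.Modules}
    {B : X.Modules} (T : ∀ U : X.Opens, MultilinearMap Γ(X, U) (fun i => Γ(N i, U)) Γ(B, U))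
    (hT : ∀ (U V : X.Opens) (i : U ⟶ V) (x : ∀ i, Γ(N i, V)),
      res B i (T V x) = T U fun j => res (N j) i (x j))
    (φ : ∀ i, E ⟶ (pushforward f).obj (N i)) (U V : Y.Opens) (i : U ⟶ V) (e : ι → Γ(E, V)) :
    res _ i (pushMultilinear f T φ V e) = pushMultilinear f T φ U fun j => res E i (e j) := by
  rw [pushMultilinear_apply, pushMultilinear_apply, res_toPush, hT]
  simp only [appₛₗ_res]

end PushforwardSections

theorem exteriorPower_induction {R M : Type} [CommRing R] [AddCommGroup M] [Module R M] {n : ℕ}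
    {motive : (⋀[R]^n M) → Prop} (ιMulti : ∀ x, motive (exteriorPower.ιMulti R n x))
    (zero : motive 0) (add : ∀ a b, motive a → motive b → motive (a + b))
    (smul : ∀ (r : R) a, motive a → motive (r • a)) (t : ⋀[R]^n M) : motive t := by
  have ht : t ∈ Submodule.span R (Set.range (exteriorPower.ιMulti R n (M := M))) := by
    rw [exteriorPower.ιMulti_span]; trivial
  induction ht using Submodule.span_induction with
  | mem x hx => obtain ⟨y, rfl⟩ := hx; exact ιMulti y
  | zero => exact zero
  | add a b _ _ ha hb => exact add a b ha hb
  | smul r a _ ha => exact smul r a ha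

/-! ### Homomorphisms out of an exterior power. -/

section ExteriorDesc

variable {Y : Scheme.{0}} {k : ℕ} {E K : Y.Modules}

theorem res_alternatingMapLinearEquiv
    (A : ∀ V : Y.Opens, Γ(E, V) [⋀^Fin k]→ₗ[Γ(Y, V)] Γ(K, V))
    (hA : ∀ (U V : Y.Opens) (i : U ⟶ V) (e : Fin k → Γ(E, V)),
      res K i (A V e) = A U fun j => res E i (e j))
    {U V : Y.Opens} (i : U ⟶ V) (t : ⋀[Γ(Y, V)]^k Γ(E, V)) :
    exteriorPower.alternatingMapLinearEquiv (A U)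
      (exteriorMap (Y.presheaf.map i.op).hom k (res E i) t) =
      res K i (exteriorPower.alternatingMapLinearEquiv (A V) t) := by
  induction t using exteriorPower_induction with
  | ιMulti e =>
    rw [exteriorMap_ιMulti, exteriorPower.alternatingMapLinearEquiv_apply_ιMulti,
      exteriorPower.alternatingMapLinearEquiv_apply_ιMulti, hA]
    rfl
  | zero => simp only [map_zero]
  | add a b ha hb => simp only [map_add, ha, hb]
  | smul r a ha =>
    rw [map_smulₛₗ, _root_.map_smul, ha, _root_.map_smul, map_smulₛₗ]

theorem res_alternatization
    (T : ∀ V : Y.Opens, MultilinearMap Γ(Y, V) (fun _ : Fin k => Γ(E, V)) Γ(K, V))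
    (hT : ∀ (U V : Y.Opens) (i : U ⟶ V) (e : Fin k → Γ(E, V)),
      res K i (T V e) = T U fun j => res E i (e j))
    (U V : Y.Opens) (i : U ⟶ V) (e : Fin k → Γ(E, V)) :
    res K i (MultilinearMap.alternatization (T V) e) =
      MultilinearMap.alternatization (T U) (fun j => res E i (e j)) := by
  rw [MultilinearMap.alternatization_apply, MultilinearMap.alternatization_apply, map_sum]
  refine Finset.sum_congr rfl fun σ _ => ?_
  rw [Units.smul_def, Units.smul_def, map_zsmul, MultilinearMap.domDomCongr_apply,
    MultilinearMap.domDomCongr_apply, hT]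

/-- The homomorphism from an exterior power induced by natural alternating maps. -/
def exteriorDesc (A : ∀ V : Y.Opens, Γ(E, V) [⋀^Fin k]→ₗ[Γ(Y, V)] Γ(K, V))
    (hA : ∀ (U V : Y.Opens) (i : U ⟶ V) (e : Fin k → Γ(E, V)),
      res K i (A V e) = A U fun j => res E i (e j)) : exterior k E ⟶ K :=
  sheafifyDesc (presheafHomMk (P := exteriorPresheaf k E)
    (fun V => exteriorPower.alternatingMapLinearEquiv (A V))
    fun _ _ i x => res_alternatingMapLinearEquiv A hA i x)

/-- The local section of an exterior power of sheaves given by an element of the exterior power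
of the sections. -/
def exteriorSection (V : Y.Opens) : (⋀[Γ(Y, V)]^k Γ(E, V)) →ₗ[Γ(Y, V)] Γ(exterior k E, V) :=
  toSheafify (exteriorPresheaf k E) V

theorem exteriorDesc_app (A : ∀ V : Y.Opens, Γ(E, V) [⋀^Fin k]→ₗ[Γ(Y, V)] Γ(K, V))
    (hA : ∀ (U V : Y.Opens) (i : U ⟶ V) (e : Fin k → Γ(E, V)),
      res K i (A V e) = A U fun j => res E i (e j)) (V : Y.Opens) (t : ⋀[Γ(Y, V)]^k Γ(E, V)) :
    (exteriorDesc A hA).app V (exteriorSection V t) =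
      exteriorPower.alternatingMapLinearEquiv (A V) t :=
  sheafifyDesc_toSheafify (presheafHomMk (P := exteriorPresheaf k E)
    (fun V => exteriorPower.alternatingMapLinearEquiv (A V))
    fun _ _ i x => res_alternatingMapLinearEquiv A hA i x) V t

theorem exterior_hom_ext {φ ψ : exterior k E ⟶ K}
    (h : ∀ (V : Y.Opens) (e : Fin k → Γ(E, V)),
      φ.app V (exteriorSection V (exteriorPower.ιMulti Γ(Y, V) k e)) =
        ψ.app V (exteriorSection V (exteriorPower.ιMulti Γ(Y, V) k e))) : φ = ψ := by
  refine sheafify_hom_ext fun V t => ?_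
  change φ.app V (exteriorSection V t) = ψ.app V (exteriorSection V t)
  let t' : ⋀[Γ(Y, V)]^k Γ(E, V) := t
  change φ.app V (exteriorSection V t') = ψ.app V (exteriorSection V t')
  induction t' using exteriorPower_induction with
  | ιMulti e => exact h V e
  | zero => simp only [map_zero]
  | add a b ha hb => simp only [map_add, ha, hb]
  | smul r a ha => rw [_root_.map_smul, Hom.app_smul, Hom.app_smul, ha]

/-- A homomorphism from an exterior power of a sheaf which is bijective on a basis of open sets
is an isomorphism. -/
theorem isIso_of_bijective_exteriorSection (ψ : exterior k E ⟶ K)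
    (h : ∀ (x : Y) (U : Y.Opens), x ∈ U → ∃ V : Y.Opens, x ∈ V ∧ V ≤ U ∧
      Function.Bijective fun t : (⋀[Γ(Y, V)]^k Γ(E, V)) => ψ.app V (exteriorSection V t)) :
    IsIso ψ :=
  isIso_of_bijective_toSheafify ψ h

end ExteriorDesc

/-- The formal properties of the diagram of schemes
`C^k × S ⟶ 𝒟 × S ⟶ C_k × S`, `𝒟 × S ⟶ C × S` with the action of the symmetric group on `C^k × S`.
-/
structure Incidence (X D Y Z : Scheme.{0}) (k : ℕ) where
  /-- the quotient map -/
  π : X ⟶ Y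
  /-- the projection from the incidence scheme to the quotient -/
  q : D ⟶ Y
  /-- the projection from the incidence scheme to the curve -/
  p : D ⟶ Z
  /-- the `i`-th map to the incidence scheme -/
  d : Fin k → (X ⟶ D)
  /-- the `i`-th projection -/
  pr : Fin k → (X ⟶ Z)
  /-- the action of the symmetric group -/
  ρ : Equiv.Perm (Fin k) → (X ⟶ X)
  d_q : ∀ i, d i ≫ q = π
  d_p : ∀ i, d i ≫ p = pr i
  ρ_d : ∀ σ i, ρ σ ≫ d (σ.symm i) = d i
  ρ_pr : ∀ σ i, ρ σ ≫ pr (σ.symm i) = pr i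
  ρ_π : ∀ σ, ρ σ ≫ π = π

/-! ### The determinant map of an incidence diagram. -/

namespace Incidence

variable {X D Y Z : Scheme.{0}} {k : ℕ} (I : Incidence X D Y Z k) (L : Z.Modules)

/-- The tautological bundle `q_* p^* L`. -/
def taut : Y.Modules := (pushforward I.q).obj ((Scheme.Modules.pullback I.p).obj L)

/-- The external power of `L`. -/
def box : X.Modules := tensor fun i => (Scheme.Modules.pullback (I.pr i)).obj L

/-- The local section `⨂ x i` of the external power. -/
def boxSection (U : X.Opens) : MultilinearMap Γ(X, U)
    (fun i => Γ((Scheme.Modules.pullback (I.pr i)).obj L, U)) Γ(I.box L, U) :=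
  tensorSection (fun i => (Scheme.Modules.pullback (I.pr i)).obj L) U

theorem res_boxSection {U V : X.Opens} (i : U ⟶ V)
    (x : ∀ i, Γ((Scheme.Modules.pullback (I.pr i)).obj L, V)) :
    res _ i (I.boxSection L V x) = I.boxSection L U fun j => res _ i (x j) :=
  res_tensorSection _ i x

/-- The permutation action on the external power. -/
def act (σ : Equiv.Perm (Fin k)) : I.box L ⟶ (pushforward (I.ρ σ)).obj (I.box L) :=
  tensorHom (I.ρ σ) σ.symm.bijective fun j => pullSections (I.ρ σ) _ _ (I.ρ_pr σ j) L

/-- The invariants of `π_* L^{⊠k}` for the permutation action twisted by the sign. -/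
def antiInvariants : Y.Modules :=
  equivariantPushforward I.ρ I.π I.ρ_π fun σ => ((Equiv.Perm.sign σ : ℤ) ^ 1) • I.act L σ

theorem preimage_π (V : Y.Opens) (i : Fin k) : I.π ⁻¹ᵁ V = I.d i ⁻¹ᵁ I.q ⁻¹ᵁ V := by
  rw [← I.d_q i]; rfl

/-- Pullback of sections of the tautological bundle along the `i`-th map to the incidence
scheme. -/
def tautPull (i : Fin k) :
    I.taut L ⟶ (pushforward I.π).obj ((Scheme.Modules.pullback (I.pr i)).obj L) :=
  pushHom (I.d_q i) (pullSections (I.d i) I.p (I.pr i) (I.d_p i) L)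

/-- The multilinear map `(e_1, …, e_k) ↦ ⨂ d_i^* e_i`. -/
def tautMultilinear (V : Y.Opens) : MultilinearMap Γ(Y, V) (fun _ : Fin k => Γ(I.taut L, V))
    Γ((pushforward I.π).obj (I.box L), V) :=
  pushMultilinear I.π (I.boxSection L) (I.tautPull L) V

/-- The determinant map `⋀^k E_L ⟶ π_* L^{⊠k}`, `e_1 ∧ ⋯ ∧ e_k ↦ ∑ sgn σ ⨂ d_i^* e_{σ i}`. -/
def detHom : exterior k (I.taut L) ⟶ (pushforward I.π).obj (I.box L) :=
  exteriorDesc (fun V => MultilinearMap.alternatization (I.tautMultilinear L V))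
    (res_alternatization (I.tautMultilinear L) (res_pushMultilinear I.π (I.boxSection L)
      (fun _ _ i x => I.res_boxSection L i x) (I.tautPull L)))

end Incidence

end

/-! ### Equivariance of the determinant map and reduction to sections. -/

section

open Scheme.Modules

section Equivariance

variable {X X' D Y Z : Scheme.{0}} {k : ℕ}

theorem appₛₗ_pushHom {d : X ⟶ D} {q : D ⟶ Y} {f : X ⟶ Y} (h : d ≫ q = f)
    {M : D.Modules} {N : X.Modules} (φ : M ⟶ (pushforward d).obj N) {E : Y.Modules}
    (ψ : E ⟶ (pushforward q).obj M) (V : Y.Opens) (m : Γ(E, V)) :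
    res N (eqToHom (preimage_comp_eq h V)) (appₛₗ d φ (q ⁻¹ᵁ V) (appₛₗ q ψ V m)) =
      appₛₗ f (ψ ≫ pushHom h φ) V m := rfl

theorem pushHom_comp_pushHom {f : X ⟶ X'} {d : X' ⟶ D} {d' : X ⟶ D} (hd : f ≫ d = d')
    {q : D ⟶ Y} {π : X' ⟶ Y} (hπ : d ≫ q = π) {π' : X ⟶ Y} (hfπ : f ≫ π = π') (hπ' : d' ≫ q = π')
    {M : D.Modules} {N : X'.Modules} {N' : X.Modules} (φ : M ⟶ (pushforward d).obj N)
    (ψ : N ⟶ (pushforward f).obj N') :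
    pushHom hπ φ ≫ pushHom hfπ ψ = pushHom hπ' (φ ≫ pushHom hd ψ) := by
  ext V m
  obtain ⟨m, rfl⟩ := (toPush q M V).surjective m
  have h1 := pushHom_app hπ φ V m
  have h2 := pushHom_app hfπ ψ V (res N (eqToHom (preimage_comp_eq hπ V)) (appₛₗ d φ (q ⁻¹ᵁ V) m))
  have h3 := pushHom_app hπ' (φ ≫ pushHom hd ψ) V m
  rw [appₛₗ_res, res_res] at h2
  rw [← appₛₗ_pushHom, res_res] at h3
  exact (congrArg _ h1).trans (h2.trans h3.symm)

/-- It suffices to compare values on pulled-back sections, and both sides send the pullback of `m`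
along `p` to its pullback along `r'`. -/
theorem pullSections_comp {f : X ⟶ X'} {d : X' ⟶ D} {d' : X ⟶ D} (hd : f ≫ d = d')
    {p : D ⟶ Z} {r : X' ⟶ Z} (hr : d ≫ p = r) {r' : X ⟶ Z} (hfr : f ≫ r = r')
    (hr' : d' ≫ p = r') (L : Z.Modules) :
    pullSections d p r hr L ≫ pushHom hd (pullSections f r r' hfr L) =
      pullSections d' p r' hr' L := by
  refine pullback_hom_ext p fun U m => ?_
  have h1 : appₛₗ d (pullSections d p r hr L) (p ⁻¹ᵁ U) (pullSection p m) =
    res _ (eqToHom _) (pullSection r m) := pullSections_pullSection d p r hr L m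
  have h2 : appₛₗ f (pullSections f r r' hfr L) (r ⁻¹ᵁ U) (pullSection r m) =
    res _ (eqToHom _) (pullSection r' m) := pullSections_pullSection f r r' hfr L m
  have h3 := pullSections_pullSection d' p r' hr' L m
  rw [h3]
  refine (appₛₗ_pushHom hd (pullSections f r r' hfr L) (pullSections d p r hr L) (p ⁻¹ᵁ U)
    (pullSection p m)).symm.trans ?_
  rw [h1, appₛₗ_res, h2, res_res, res_res]
  rfl

theorem pushforwardAct_eq {G : Type} (ρ : G → (X ⟶ X)) (π : X ⟶ Y) (hπ : ∀ g, ρ g ≫ π = π)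
    {F : X.Modules} (a : ∀ g, F ⟶ (pushforward (ρ g)).obj F) (g : G) :
    pushforwardAct ρ π hπ a g = pushHom (hπ g) (a g) := rfl

theorem zsmul_app {M N : X.Modules} (n : ℤ) (φ : M ⟶ N) (U : X.Opens) (m : Γ(M, U)) :
    (n • φ).app U m = n • φ.app U m := by
  let F : (M ⟶ N) →+ Γ(N, U) :=
    { toFun := fun φ => φ.app U m
      map_zero' := rfl
      map_add' := fun _ _ => rfl }
  exact map_zsmul F n φ

theorem pushHom_zsmul_app {d : X ⟶ D} {q : D ⟶ Y} {f : X ⟶ Y} (h : d ≫ q = f)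
    {M : D.Modules} {N : X.Modules} (n : ℤ) (φ : M ⟶ (pushforward d).obj N) (V : Y.Opens)
    (m : Γ((pushforward q).obj M, V)) :
    (pushHom h (n • φ)).app V m = n • (pushHom h φ).app V m := by
  obtain ⟨m, rfl⟩ := (toPush q M V).surjective m
  rw [pushHom_app, pushHom_app, ← map_zsmul, ← map_zsmul]
  congr 2
  exact zsmul_app n φ _ m

end Equivariance

namespace Incidence

variable {X D Y Z : Scheme.{0}} {k : ℕ} (I : Incidence X D Y Z k) (L : Z.Modules)

theorem act_boxSection (σ : Equiv.Perm (Fin k)) (U : X.Opens)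
    (x : ∀ i, Γ((Scheme.Modules.pullback (I.pr i)).obj L, U)) :
    appₛₗ (I.ρ σ) (I.act L σ) U (I.boxSection L U x) = I.boxSection L (I.ρ σ ⁻¹ᵁ U)
      fun j => appₛₗ (I.ρ σ) (pullSections (I.ρ σ) _ _ (I.ρ_pr σ j) L) U (x (σ.symm j)) :=
  tensorHom_app_tensorSection (I.ρ σ) σ.symm.bijective
    (M := fun i => (Scheme.Modules.pullback (I.pr i)).obj L)
    (N := fun i => (Scheme.Modules.pullback (I.pr i)).obj L)
    (fun j => pullSections (I.ρ σ) _ _ (I.ρ_pr σ j) L) U x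

/-- Permuting by `σ` and then marking the point `σ.symm j` is the same as marking the point `j`, by
`ρ_d`. -/
theorem tautPull_comp (σ : Equiv.Perm (Fin k)) (j : Fin k) :
    I.tautPull L (σ.symm j) ≫ pushHom (I.ρ_π σ) (pullSections (I.ρ σ) _ _ (I.ρ_pr σ j) L) =
      I.tautPull L j :=
  (pushHom_comp_pushHom (I.ρ_d σ j) (I.d_q (σ.symm j)) (I.ρ_π σ) (I.d_q j) _ _).trans
    (congrArg (pushHom (I.d_q j)) (pullSections_comp _ _ _ (I.d_p j) L))

/-- The permutation action on the direct image of the external power. -/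
def pushAct (σ : Equiv.Perm (Fin k)) :
    (pushforward I.π).obj (I.box L) ⟶ (pushforward I.π).obj (I.box L) :=
  pushHom (I.ρ_π σ) (I.act L σ)

theorem pushAct_tautMultilinear (σ : Equiv.Perm (Fin k)) (V : Y.Opens)
    (e : Fin k → Γ(I.taut L, V)) :
    (I.pushAct L σ).app V (I.tautMultilinear L V e) =
      I.tautMultilinear L V fun i => e (σ.symm i) := by
  rw [tautMultilinear, pushMultilinear_apply, pushMultilinear_apply, pushAct, pushHom_app,
    act_boxSection, res_boxSection]
  refine congrArg (fun x => toPush I.π (I.box L) V (I.boxSection L (I.π ⁻¹ᵁ V) x)) ?_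
  funext j
  rw [← I.tautPull_comp L σ j]
  exact appₛₗ_pushHom _ _ _ V _

theorem pushAct_alternatization (σ : Equiv.Perm (Fin k)) (V : Y.Opens)
    (e : Fin k → Γ(I.taut L, V)) :
    (I.pushAct L σ).app V (MultilinearMap.alternatization (I.tautMultilinear L V) e) =
      (Equiv.Perm.sign σ : ℤ) • MultilinearMap.alternatization (I.tautMultilinear L V) e := by
  rw [MultilinearMap.alternatization_apply, map_sum, Finset.smul_sum]
  -- Acting by `σ` turns the term of `τ` into the tensor of `τ * σ⁻¹`, whose sign differs from that
  -- of `τ` by `sign σ`.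
  refine Fintype.sum_equiv (Equiv.mulRight σ⁻¹) _ _ fun τ => ?_
  rw [Units.smul_def, map_zsmul, MultilinearMap.domDomCongr_apply, pushAct_tautMultilinear,
    Units.smul_def, MultilinearMap.domDomCongr_apply, smul_smul]
  congr 1
  simp only [Equiv.coe_mulRight, Equiv.Perm.sign_mul, Equiv.Perm.sign_inv]
  rw [Units.val_mul, mul_comm, mul_assoc, Int.units_coe_mul_self, mul_one]

/-- The defining homomorphism of the anti-invariants. -/
def antiHom : (pushforward I.π).obj (I.box L) ⟶
    ∏ᶜ fun _ : Equiv.Perm (Fin k) => (pushforward I.π).obj (I.box L) :=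
  Pi.lift fun σ => pushforwardAct I.ρ I.π I.ρ_π
    (fun σ => ((Equiv.Perm.sign σ : ℤ) ^ 1) • I.act L σ) σ - 𝟙 ((pushforward I.π).obj (I.box L))

/-- Since a sign squares to one, invariance for the twisted action means that `σ` multiplies by its
sign under the untwisted one. -/
theorem antiHom_app_eq_zero_iff (V : Y.Opens) (t : Γ((pushforward I.π).obj (I.box L), V)) :
    (I.antiHom L).app V t = 0 ↔
      ∀ σ, (I.pushAct L σ).app V t = (Equiv.Perm.sign σ : ℤ) • t := by
  have key : ∀ σ, (pushforwardAct I.ρ I.π I.ρ_π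
      (fun σ => ((Equiv.Perm.sign σ : ℤ) ^ 1) • I.act L σ) σ -
        𝟙 ((pushforward I.π).obj (I.box L))).app V t =
        (Equiv.Perm.sign σ : ℤ) • (I.pushAct L σ).app V t - t := by
    intro σ
    have h1 := pushHom_zsmul_app (I.ρ_π σ) ((Equiv.Perm.sign σ : ℤ) ^ 1) (I.act L σ) V t
    rw [pow_one] at h1
    rw [Hom.sub_app, pushforwardAct_eq, pow_one]
    exact congrArg (· - t) h1
  have h2 : ∀ σ, (I.pushAct L σ).app V t = (Equiv.Perm.sign σ : ℤ) • t ↔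
      (Equiv.Perm.sign σ : ℤ) • (I.pushAct L σ).app V t - t = 0 := by
    intro σ
    rw [sub_eq_zero]
    constructor
    · intro h
      rw [h, smul_smul, Int.units_coe_mul_self, one_smul]
    · intro h
      nth_rw 2 [← h]
      rw [smul_smul, Int.units_coe_mul_self, one_smul]
  constructor
  · intro h σ
    rw [h2, ← key]
    exact app_eq_zero_of_pi_lift _ V t h σ
  · intro h
    refine pi_lift_app_eq_zero _ V t fun σ => ?_
    rw [key, ← h2]
    exact h σ

theorem detHom_comp_antiHom : I.detHom L ≫ I.antiHom L = 0 := by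
  refine exterior_hom_ext fun V e => ?_
  rw [comp_app_apply, detHom, exteriorDesc_app,
    exteriorPower.alternatingMapLinearEquiv_apply_ιMulti]
  exact (I.antiHom_app_eq_zero_iff L V _).2 fun σ => I.pushAct_alternatization L σ V e

/-- The determinant map, as a homomorphism to the anti-invariants. -/
def detLift : exterior k (I.taut L) ⟶ I.antiInvariants L :=
  kernel.lift (I.antiHom L) (I.detHom L) (I.detHom_comp_antiHom L)

/-- This is the passage from sheaves to algebra: bijectivity is tested on exterior powers of section
modules over a basis, before sheafification, and the target is read off inside the direct image. -/
theorem isIso_detLift (h : ∀ (x : Y) (U : Y.Opens), x ∈ U → ∃ V : Y.Opens, x ∈ V ∧ V ≤ U ∧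
      Function.Injective (exteriorPower.alternatingMapLinearEquiv
        (MultilinearMap.alternatization (I.tautMultilinear L V))) ∧
      ∀ t : Γ((pushforward I.π).obj (I.box L), V),
        (∀ σ, (I.pushAct L σ).app V t = (Equiv.Perm.sign σ : ℤ) • t) →
        ∃ s, exteriorPower.alternatingMapLinearEquiv
          (MultilinearMap.alternatization (I.tautMultilinear L V)) s = t) :
    IsIso (I.detLift L) := by
  refine isIso_of_bijective_exteriorSection _ fun x U hx => ?_
  obtain ⟨V, hxV, hVU, hinj, hsurj⟩ := h x U hx
  have key : ∀ s : (⋀[Γ(Y, V)]^k Γ(I.taut L, V)), (kernel.ι (I.antiHom L)).app V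
      ((I.detLift L).app V (exteriorSection V s)) = exteriorPower.alternatingMapLinearEquiv
        (MultilinearMap.alternatization (I.tautMultilinear L V)) s := by
    intro s
    have h1 : I.detLift L ≫ kernel.ι (I.antiHom L) = I.detHom L := kernel.lift_ι _ _ _
    have h2 := congr(($h1).app V (exteriorSection V s))
    exact h2.trans (exteriorDesc_app _ _ V s)
  refine ⟨V, hxV, hVU, fun s s' hs => hinj ?_, fun t => ?_⟩
  · rw [← key, ← key]
    exact congrArg _ hs
  · have h0 : kernel.ι (I.antiHom L) ≫ I.antiHom L = 0 := kernel.condition _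
    have h1 : (I.antiHom L).app V ((kernel.ι (I.antiHom L)).app V t) = 0 := congr(($h0).app V t)
    obtain ⟨s, hs⟩ := hsurj _ ((I.antiHom_app_eq_zero_iff L V _).1 h1)
    refine ⟨s, kernel_ι_app_injective (I.antiHom L) V ?_⟩
    rw [← hs]
    exact key s

end Incidence

end

/-! ### The determinant map for split ring data. -/

section DeterminantAlgebra

variable {R E P : Type} [CommRing R] [CommRing E] [CommRing P] {k : ℕ}

/-- The algebraic properties of the diagram `𝒪(U) ⟶ 𝒪(q⁻¹ U) ⟶ 𝒪(π⁻¹ U)` of functions over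
sufficiently small affine open subsets of the quotient: `E` is generated by the first `k` powers of
an element whose `k` conjugates in `P` are pairwise distinct in a strong sense, and `P` is generated
by products of conjugates of elements of `E`. -/
structure IsSplit (φ : R →+* P) (ψ : R →+* E) (δ : Fin k → (E →+* P)) : Prop where
  injective : Function.Injective φ
  comp : ∀ i r, δ i (ψ r) = φ r
  exists_generator : ∃ t : E, (∀ e : E, ∃ c : Fin k → R, e = ∑ j, ψ (c j) * t ^ (j : ℕ)) ∧
    ∀ i j, i ≠ j → δ i t - δ j t ∈ nonZeroDivisors P
  closure_eq_top : AddSubgroup.closure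
    {x : P | ∃ (r : R) (a : Fin k → E), x = φ r * ∏ i, δ i (a i)} = ⊤

/-- The powers 1, t, …, t^{k-1} span, so the top exterior power is generated by their wedge `ω`. Its
image is a Vandermonde determinant, a product of regular differences of conjugates, so a multiple `r
• ω` in the kernel has `φ r = 0` and thus `r = 0`. -/
theorem IsSplit.injective_lift {φ : R →+* P} {ψ : R →+* E} {δ : Fin k → (E →+* P)}
    (h : IsSplit φ ψ δ) {M B : Type} [AddCommGroup M] [Module R M] [AddCommGroup B] [Module R B]
    (f : E →+ M) (hf : Function.Surjective f) (hfψ : ∀ r e, f (ψ r * e) = r • f e)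
    (g : P →+ B) (hg : Function.Injective g) (hgφ : ∀ r x, g (φ r * x) = r • g x)
    (A : M [⋀^Fin k]→ₗ[R] B)
    (hA : ∀ a : Fin k → E, A (fun i => f (a i)) = g (Matrix.det (Matrix.of fun i j => δ i (a j)))) :
    Function.Injective (exteriorPower.alternatingMapLinearEquiv A) := by
  obtain ⟨t, ht, hnzd⟩ := h.exists_generator
  let ω : ⋀[R]^k M := exteriorPower.ιMulti R k fun j => f (t ^ (j : ℕ))
  have hω : ∀ s : ⋀[R]^k M, ∃ r : R, s = r • ω := by
    intro s
    have hs : s ∈ Submodule.span R (Set.range (exteriorPower.ιMulti R k (M := M))) := by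
      rw [exteriorPower.ιMulti_span]; trivial
    induction hs using Submodule.span_induction with
    | mem x hx =>
      obtain ⟨y, rfl⟩ := hx
      choose a ha using fun i => hf (y i)
      choose c hc using fun i => ht (a i)
      have hy : y = fun i => ∑ j, c i j • f (t ^ (j : ℕ)) := by
        funext i
        rw [← ha i, hc i, map_sum]
        simp only [hfψ]
      have h1 : ∀ v : Fin k → Fin k, ∃ r : R,
          exteriorPower.ιMulti R k (fun i => c i (v i) • f (t ^ (v i : ℕ))) = r • ω := by
        intro v
        have h2 := (exteriorPower.ιMulti R k (M := M)).toMultilinearMap.map_smul_univ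
          (fun i => c i (v i)) (fun i => f (t ^ (v i : ℕ)))
        simp only [AlternatingMap.coe_multilinearMap] at h2
        rw [h2]
        -- A wedge of powers of t vanishes if an exponent repeats; otherwise `v` is a permutation
        -- and the wedge is `ω` up to sign.
        by_cases hv : Function.Injective v
        · let σ : Equiv.Perm (Fin k) := Equiv.ofBijective v (Finite.injective_iff_bijective.1 hv)
          have h3 : exteriorPower.ιMulti R k (fun i => f (t ^ (v i : ℕ))) =
              Equiv.Perm.sign σ • ω :=
            (exteriorPower.ιMulti R k (M := M)).map_perm (fun j => f (t ^ (j : ℕ))) σ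
          rw [h3]
          refine ⟨(∏ i, c i (v i)) * ((Equiv.Perm.sign σ : ℤ) : R), ?_⟩
          rw [mul_smul, Units.smul_def, Int.cast_smul_eq_zsmul]
        · obtain ⟨i, j, hij, hne⟩ := Function.not_injective_iff.1 hv
          rw [(exteriorPower.ιMulti R k (M := M)).map_eq_zero_of_eq _ (by rw [hij]) hne]
          exact ⟨0, by simp⟩
      choose r hr using h1
      refine ⟨∑ v, r v, ?_⟩
      have h4 := (exteriorPower.ιMulti R k (M := M)).toMultilinearMap.map_sum
        (fun i j => c i j • f (t ^ (j : ℕ)))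
      simp only [AlternatingMap.coe_multilinearMap] at h4
      rw [hy, h4, Finset.sum_smul]
      exact Finset.sum_congr rfl fun v _ => hr v
    | zero => exact ⟨0, (zero_smul _ _).symm⟩
    | add a b _ _ ha hb =>
      obtain ⟨r, rfl⟩ := ha
      obtain ⟨r', rfl⟩ := hb
      exact ⟨r + r', (add_smul _ _ _).symm⟩
    | smul r a _ ha =>
      obtain ⟨r', rfl⟩ := ha
      exact ⟨r * r', (mul_smul _ _ _).symm⟩
  refine (injective_iff_map_eq_zero _).2 fun s hs => ?_
  obtain ⟨r, rfl⟩ := hω s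
  rw [map_smul, exteriorPower.alternatingMapLinearEquiv_apply_ιMulti, hA, ← hgφ] at hs
  have h1 := (injective_iff_map_eq_zero g).1 hg _ hs
  have h2 : Matrix.det (Matrix.of fun i (j : Fin k) => δ i (t ^ (j : ℕ))) ∈ nonZeroDivisors P := by
    have h3 : Matrix.of (fun i (j : Fin k) => δ i (t ^ (j : ℕ))) =
        Matrix.vandermonde fun i => δ i t := by
      ext i j
      simp [Matrix.vandermonde_apply]
    rw [h3, Matrix.det_vandermonde]
    refine prod_mem fun i _ => prod_mem fun j hj => hnzd j i ?_
    exact (Finset.mem_Ioi.1 hj).ne'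
  -- The Vandermonde factor is cancelled here; no freeness of `M` enters.
  have h4 : φ r = 0 := (mul_right_mem_nonZeroDivisors_eq_zero_iff h2).1 h1
  have h5 : r = 0 := h.injective (h4.trans (map_zero φ).symm)
  rw [h5, zero_smul]

/-- Antisymmetrization maps a spanning product φ(r) ∏ δ_i(a_i) to φ(r) det (δ_i a_j), the image of a
wedge. On an anti-invariant it is multiplication by k!, which is invertible in R. -/
theorem IsSplit.exists_lift_eq {φ : R →+* P} {ψ : R →+* E} {δ : Fin k → (E →+* P)}
    (h : IsSplit φ ψ δ) {M B : Type} [AddCommGroup M] [Module R M] [AddCommGroup B] [Module R B]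
    (hk : IsUnit (k.factorial : R)) (f : E →+ M)
    (g : P →+ B) (hgφ : ∀ r x, g (φ r * x) = r • g x)
    (A : M [⋀^Fin k]→ₗ[R] B)
    (hA : ∀ a : Fin k → E, A (fun i => f (a i)) = g (Matrix.det (Matrix.of fun i j => δ i (a j))))
    (ρ : Equiv.Perm (Fin k) → (P →+* P)) (hρφ : ∀ σ r, ρ σ (φ r) = φ r)
    (hρδ : ∀ σ i e, ρ σ (δ (σ.symm i) e) = δ i e) (x : P)
    (hx : ∀ σ, ρ σ x = (Equiv.Perm.sign σ : ℤ) • x) :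
    ∃ s, exteriorPower.alternatingMapLinearEquiv A s = g x := by
  let Alt : P →+ P := ∑ σ, (Equiv.Perm.sign σ : ℤ) • (ρ σ : P →+ P)
  have hAlt : ∀ x, Alt x = ∑ σ, (Equiv.Perm.sign σ : ℤ) • ρ σ x := by
    intro x
    simp [Alt]
  have h1 : ∀ x : P, ∃ s, exteriorPower.alternatingMapLinearEquiv A s = g (Alt x) := by
    intro x
    have hx : x ∈ AddSubgroup.closure
        {x : P | ∃ (r : R) (a : Fin k → E), x = φ r * ∏ i, δ i (a i)} := by
      rw [h.closure_eq_top]; trivial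
    induction hx using AddSubgroup.closure_induction with
    | mem x hx =>
      obtain ⟨r, a, rfl⟩ := hx
      refine ⟨r • exteriorPower.ιMulti R k fun i => f (a i), ?_⟩
      rw [map_smul, exteriorPower.alternatingMapLinearEquiv_apply_ιMulti, hA, ← hgφ]
      congr 1
      rw [Matrix.det_apply, Finset.mul_sum, hAlt]
      refine Finset.sum_congr rfl fun σ _ => ?_
      simp only [map_mul, map_prod, hρφ, Units.smul_def, Matrix.of_apply]
      rw [mul_smul_comm]
      congr 2
      refine Finset.prod_congr rfl fun i _ => ?_
      -- `Matrix.det_apply` permutes rows, and `ρ σ` sends the conjugate of index `i` to that of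
      -- index `σ i`, so the terms match one by one.
      simpa using (hρδ σ (σ i) (a i)).symm
    | zero => exact ⟨0, by simp⟩
    | add x y _ _ hx hy =>
      obtain ⟨s, hs⟩ := hx
      obtain ⟨s', hs'⟩ := hy
      exact ⟨s + s', by simp [hs, hs']⟩
    | neg x _ hx =>
      obtain ⟨s, hs⟩ := hx
      exact ⟨-s, by simp [hs]⟩
  have h2 : Alt x = (k.factorial : P) * x := by
    simp only [hAlt, hx, smul_smul, Int.units_coe_mul_self, one_smul]
    simp [Fintype.card_perm]
  obtain ⟨s, hs⟩ := h1 x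
  obtain ⟨u, hu⟩ := hk
  refine ⟨(↑u⁻¹ : R) • s, ?_⟩
  rw [map_smul, hs, h2, ← map_natCast φ, ← hu, hgφ, smul_smul, Units.inv_mul, one_smul]

end DeterminantAlgebra

/-! ### Local computation in frames. -/

section

open Scheme.Modules

section

variable {X D Y Z : Scheme.{0}}

theorem res_appₛₗ_smul {d : X ⟶ D} {q : D ⟶ Y} {f : X ⟶ Y} (h : d ≫ q = f)
    {M : D.Modules} {N : X.Modules} (φ : M ⟶ (pushforward d).obj N) (V : Y.Opens)
    (a : Γ(D, q ⁻¹ᵁ V)) (m : Γ(M, q ⁻¹ᵁ V)) :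
    res N (eqToHom (preimage_comp_eq h V)) (appₛₗ d φ (q ⁻¹ᵁ V) (a • m)) =
      d.appLE (q ⁻¹ᵁ V) (f ⁻¹ᵁ V) (preimage_comp_eq h V).le a •
        res N (eqToHom (preimage_comp_eq h V)) (appₛₗ d φ (q ⁻¹ᵁ V) m) := by
  rw [map_smulₛₗ, res_smul]
  rfl

theorem preimage_le_of_le {d : X ⟶ D} {q : D ⟶ Y} {f : X ⟶ Y} (h : d ≫ q = f) {p : D ⟶ Z}
    {r : X ⟶ Z} (hr : d ≫ p = r) {V : Y.Opens} {Q : Z.Opens} (hQ : q ⁻¹ᵁ V ≤ p ⁻¹ᵁ Q) :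
    f ⁻¹ᵁ V ≤ r ⁻¹ᵁ Q := by
  subst h hr
  exact fun x hx => hQ hx

theorem res_appₛₗ_pullSection {d : X ⟶ D} {q : D ⟶ Y} {f : X ⟶ Y} (h : d ≫ q = f) {p : D ⟶ Z}
    {r : X ⟶ Z} (hr : d ≫ p = r) (L : Z.Modules) {V : Y.Opens} {Q : Z.Opens}
    (hQ : q ⁻¹ᵁ V ≤ p ⁻¹ᵁ Q) (l : Γ(L, Q)) :
    res _ (eqToHom (preimage_comp_eq h V)) (appₛₗ d (pullSections d p r hr L) (q ⁻¹ᵁ V)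
      (res _ (homOfLE hQ) (pullSection p l))) =
      res _ (homOfLE (preimage_le_of_le h hr hQ)) (pullSection r l) := by
  have h1 : appₛₗ d (pullSections d p r hr L) (p ⁻¹ᵁ Q) (pullSection p l) =
    res _ (eqToHom _) (pullSection r l) := pullSections_pullSection d p r hr L l
  rw [appₛₗ_res, h1, res_res, res_res]
  rfl

/-- The bijection between functions and sections given by a frame. -/
def smulHom (f : X ⟶ Y) {M : X.Modules} {V : Y.Opens} (m : Γ(M, f ⁻¹ᵁ V)) :
    Γ(X, f ⁻¹ᵁ V) →+ Γ((pushforward f).obj M, V) :=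
  (toPush f M V : Γ(M, f ⁻¹ᵁ V) →+ Γ((pushforward f).obj M, V)).comp
    ((LinearMap.toSpanSingleton Γ(X, f ⁻¹ᵁ V) Γ(M, f ⁻¹ᵁ V) m).toAddMonoidHom)

theorem smulHom_apply (f : X ⟶ Y) {M : X.Modules} {V : Y.Opens} (m : Γ(M, f ⁻¹ᵁ V))
    (r : Γ(X, f ⁻¹ᵁ V)) : smulHom f m r = toPush f M V (r • m) := rfl

theorem smulHom_mul (f : X ⟶ Y) {M : X.Modules} {V : Y.Opens} (m : Γ(M, f ⁻¹ᵁ V))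
    (s : Γ(Y, V)) (r : Γ(X, f ⁻¹ᵁ V)) :
    smulHom f m ((f.app V).hom s * r) = s • smulHom f m r := by
  rw [smulHom_apply, smulHom_apply, mul_smul, toPush_smul]

theorem bijective_smulHom (f : X ⟶ Y) {M : X.Modules} {V : Y.Opens} {m : Γ(M, f ⁻¹ᵁ V)}
    (hm : IsFrame M m) : Function.Bijective (smulHom f m) := by
  have h := hm _ le_rfl
  simp only [res_id] at h
  exact (toPush f M V).bijective.comp h

end

namespace Incidence

variable {X D Y Z : Scheme.{0}} {k : ℕ} (I : Incidence X D Y Z k) (L : Z.Modules)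

/-- Pullback of functions along the `i`-th map to the incidence scheme. -/
def dHom (V : Y.Opens) (i : Fin k) : Γ(D, I.q ⁻¹ᵁ V) →+* Γ(X, I.π ⁻¹ᵁ V) :=
  ((I.d i).appLE (I.q ⁻¹ᵁ V) (I.π ⁻¹ᵁ V) (preimage_comp_eq (I.d_q i) V).le).hom

/-- The action of a permutation on functions. -/
def ρHom (V : Y.Opens) (σ : Equiv.Perm (Fin k)) : Γ(X, I.π ⁻¹ᵁ V) →+* Γ(X, I.π ⁻¹ᵁ V) :=
  ((I.ρ σ).appLE (I.π ⁻¹ᵁ V) (I.π ⁻¹ᵁ V) (preimage_comp_eq (I.ρ_π σ) V).le).hom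

theorem ρHom_π (V : Y.Opens) (σ : Equiv.Perm (Fin k)) (r : Γ(Y, V)) :
    I.ρHom V σ ((I.π.app V).hom r) = (I.π.app V).hom r := by
  have h : I.π.appLE V (I.π ⁻¹ᵁ V) le_rfl ≫ (I.ρ σ).appLE (I.π ⁻¹ᵁ V) (I.π ⁻¹ᵁ V)
      (preimage_comp_eq (I.ρ_π σ) V).le = I.π.appLE V (I.π ⁻¹ᵁ V) le_rfl := by
    rw [Scheme.Hom.appLE_comp_appLE]
    congr 1
    exact I.ρ_π σ
  rw [Scheme.Hom.appLE_eq_app] at h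
  exact congr($h r)

theorem ρHom_dHom (V : Y.Opens) (σ : Equiv.Perm (Fin k)) (i : Fin k) (e : Γ(D, I.q ⁻¹ᵁ V)) :
    I.ρHom V σ (I.dHom V (σ.symm i) e) = I.dHom V i e := by
  have h : (I.d (σ.symm i)).appLE (I.q ⁻¹ᵁ V) (I.π ⁻¹ᵁ V) (preimage_comp_eq (I.d_q _) V).le ≫
      (I.ρ σ).appLE (I.π ⁻¹ᵁ V) (I.π ⁻¹ᵁ V) (preimage_comp_eq (I.ρ_π σ) V).le =
      (I.d i).appLE (I.q ⁻¹ᵁ V) (I.π ⁻¹ᵁ V) (preimage_comp_eq (I.d_q i) V).le := by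
    rw [Scheme.Hom.appLE_comp_appLE]
    congr 1
    exact I.ρ_d σ i
  exact congr($h e)

section

variable {V : Y.Opens} {Q : Z.Opens} (hQ : I.q ⁻¹ᵁ V ≤ I.p ⁻¹ᵁ Q) (l : Γ(L, Q))

/-- The frame of `p^* L` induced by a frame of `L`. -/
def tautFrame : Γ((Scheme.Modules.pullback I.p).obj L, I.q ⁻¹ᵁ V) :=
  res _ (homOfLE hQ) (pullSection I.p l)

/-- The frame of `pr_i^* L` induced by a frame of `L`. -/
def prFrame (i : Fin k) : Γ((Scheme.Modules.pullback (I.pr i)).obj L, I.π ⁻¹ᵁ V) :=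
  res _ (homOfLE (preimage_le_of_le (I.d_q i) (I.d_p i) hQ)) (pullSection (I.pr i) l)

/-- The frame of `L^{⊠k}` induced by a frame of `L`. -/
def boxFrame : Γ(I.box L, I.π ⁻¹ᵁ V) :=
  I.boxSection L (I.π ⁻¹ᵁ V) (I.prFrame L hQ l)

/-- The identification of functions with sections of the tautological bundle. -/
def tautHom : Γ(D, I.q ⁻¹ᵁ V) →+ Γ(I.taut L, V) :=
  smulHom I.q (I.tautFrame L hQ l)

/-- Frames pulled back from `L` are carried to one another, so in these frames the i-th pullback of
sections is the i-th pullback of functions. -/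
theorem tautPull_tautFrame (i : Fin k) (a : Γ(D, I.q ⁻¹ᵁ V)) :
    appₛₗ I.π (I.tautPull L i) V (I.tautHom L hQ l a) =
      I.dHom V i a • I.prFrame L hQ l i := by
  refine (pushHom_app (I.d_q i) (pullSections (I.d i) I.p (I.pr i) (I.d_p i) L) V
    (a • I.tautFrame L hQ l)).trans ?_
  refine (res_appₛₗ_smul (I.d_q i) (pullSections (I.d i) I.p (I.pr i) (I.d_p i) L) V a _).trans ?_
  exact congrArg (fun x => I.dHom V i a • x)
    (res_appₛₗ_pullSection (I.d_q i) (I.d_p i) L hQ l)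

theorem tautMultilinear_tautFrame (a : Fin k → Γ(D, I.q ⁻¹ᵁ V)) :
    I.tautMultilinear L V (fun i => I.tautHom L hQ l (a i)) =
      smulHom I.π (I.boxFrame L hQ l) (∏ i, I.dHom V i (a i)) := by
  rw [tautMultilinear, pushMultilinear_apply, smulHom_apply, boxFrame,
    ← (I.boxSection L (I.π ⁻¹ᵁ V)).map_smul_univ]
  simp only [tautPull_tautFrame]

theorem alternatization_tautFrame (a : Fin k → Γ(D, I.q ⁻¹ᵁ V)) :
    MultilinearMap.alternatization (I.tautMultilinear L V)
      (fun i => I.tautHom L hQ l (a i)) =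
      smulHom I.π (I.boxFrame L hQ l) (Matrix.det (Matrix.of fun i j => I.dHom V i (a j))) := by
  -- The alternatization permutes the sections, i.e. the columns, whereas `Matrix.det_apply`
  -- permutes the rows; hence the transpose.
  rw [MultilinearMap.alternatization_apply, ← Matrix.det_transpose, Matrix.det_apply, map_sum]
  refine Finset.sum_congr rfl fun σ _ => ?_
  rw [Units.smul_def, Units.smul_def, map_zsmul, MultilinearMap.domDomCongr_apply]
  exact congrArg _ (I.tautMultilinear_tautFrame L hQ l fun i => a (σ i))

/-- All tensor factors of the box frame come from the same section of `L`, so a permutation fixes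
the frame and acts on the coefficient only. -/
theorem pushAct_boxFrame (σ : Equiv.Perm (Fin k)) (x : Γ(X, I.π ⁻¹ᵁ V)) :
    (I.pushAct L σ).app V (smulHom I.π (I.boxFrame L hQ l) x) =
      smulHom I.π (I.boxFrame L hQ l) (I.ρHom V σ x) := by
  rw [smulHom_apply, smulHom_apply, pushAct, pushHom_app,
    res_appₛₗ_smul (I.ρ_π σ)]
  refine congrArg (fun y => toPush I.π (I.box L) V (I.ρHom V σ x • y)) ?_
  rw [boxFrame, act_boxSection, res_boxSection]
  refine congrArg (I.boxSection L (I.π ⁻¹ᵁ V)) (funext fun j => ?_)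
  exact res_appₛₗ_pullSection (I.ρ_π σ) (I.ρ_pr σ j) L
    (preimage_le_of_le (I.d_q (σ.symm j)) (I.d_p (σ.symm j)) hQ) l

variable {l}

theorem isFrame_boxFrame (hl : IsFrame L l) : IsFrame (I.box L) (I.boxFrame L hQ l) :=
  IsFrame.tensorSection fun i =>
    (hl.pullSection (I.pr i)).restrict (preimage_le_of_le (I.d_q i) (I.d_p i) hQ)

end

/-- If the incidence diagram is split over a basis of open sets over which `L` is trivial, then
the determinant map is an isomorphism onto the anti-invariants. -/
theorem isIso_detLift_of_isSplit
    (h : ∀ (y : Y) (U : Y.Opens), y ∈ U → ∃ V : Y.Opens, y ∈ V ∧ V ≤ U ∧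
      IsUnit (k.factorial : Γ(Y, V)) ∧
      IsSplit (I.π.app V).hom (I.q.app V).hom (I.dHom V) ∧
      ∃ (Q : Z.Opens) (l : Γ(L, Q)), IsFrame L l ∧ I.q ⁻¹ᵁ V ≤ I.p ⁻¹ᵁ Q) :
    IsIso (I.detLift L) := by
  refine I.isIso_detLift L fun y U hy => ?_
  obtain ⟨V, hyV, hVU, hk, hsplit, Q, l, hl, hQ⟩ := h y U hy
  have hf := bijective_smulHom I.q ((hl.pullSection I.p).restrict hQ)
  have hg := bijective_smulHom I.π (I.isFrame_boxFrame L hQ hl)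
  refine ⟨V, hyV, hVU, ?_, fun t ht => ?_⟩
  · exact hsplit.injective_lift (I.tautHom L hQ l) hf.2
      (smulHom_mul I.q _) (smulHom I.π (I.boxFrame L hQ l)) hg.1 (smulHom_mul I.π _) _
      (I.alternatization_tautFrame L hQ l)
  · obtain ⟨x, rfl⟩ := hg.2 t
    refine hsplit.exists_lift_eq hk (I.tautHom L hQ l)
      (smulHom I.π (I.boxFrame L hQ l)) (smulHom_mul I.π _) _
      (I.alternatization_tautFrame L hQ l) (I.ρHom V) (I.ρHom_π V) (I.ρHom_dHom V) x fun σ => ?_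
    apply hg.1
    rw [map_zsmul, ← pushAct_boxFrame]
    exact ht σ

end Incidence

end

/-! ### Regularity of differences of conjugates. -/

section Regular

open Polynomial

/-- Let `t` be an element of a domain that is transcendental over the base field. For every
commutative algebra `Q` and every `s` in `Q`, the element `t ⊗ 1 - 1 ⊗ s` is regular. -/
theorem tmul_sub_tmul_mem_nonZeroDivisors {K A Q : Type} [Field K] [CommRing A] [IsDomain A]
    [Algebra K A] [CommRing Q] [Algebra K Q] {t : A} (ht : Transcendental K t) (s : Q) :
    (t ⊗ₜ[K] (1 : Q) - (1 : A) ⊗ₜ[K] s) ∈ nonZeroDivisors (A ⊗[K] Q) := by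
  let _ : Algebra K[X] A := (aeval t).toAlgebra
  have : IsScalarTower K K[X] A := IsScalarTower.of_algebraMap_eq fun r => by
    rw [RingHom.algebraMap_toAlgebra]
    simp
  have hX : algebraMap K[X] A X = t := by
    rw [RingHom.algebraMap_toAlgebra]
    exact aeval_X t
  have hinj : Function.Injective (algebraMap K[X] A) := transcendental_iff_injective.1 ht
  have : Module.IsTorsionFree K[X] A := by
    have := (faithfulSMul_iff_algebraMap_injective K[X] A).2 hinj
    infer_instance
  -- As `t` is transcendental, the domain `A` is torsion-free over the principal ideal domain K[t],
  -- hence flat.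
  have : Module.Flat K[X] A := IsDedekindDomain.flat_iff_torsion_eq_bot.2
    (Submodule.isTorsionFree_iff_torsion_eq_bot.1 this)
  -- Over K[X] itself the statement is that the monic polynomial X − s is regular in Q[X].
  have hreg : ∀ x : K[X] ⊗[K] Q, (X ⊗ₜ 1 - 1 ⊗ₜ s) * x = 0 → x = 0 := by
    intro x hx
    let e : K[X] ⊗[K] Q ≃ₐ[K] Q[X] :=
      (Algebra.TensorProduct.comm K K[X] Q).trans ((polyEquivTensor K Q).symm.restrictScalars K)
    have he : e (X ⊗ₜ 1 - 1 ⊗ₜ s) = X - C s := by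
      simp [e, smul_eq_C_mul]
    have h1 : (X - C s) * e x = 0 := by rw [← he, ← map_mul, hx, map_zero]
    have h2 := ((monic_X_sub_C s).mul_right_eq_zero_iff).1 h1
    exact e.injective (by rw [h2, map_zero])
  let f : K[X] ⊗[K] Q →ₗ[K[X]] K[X] ⊗[K] Q := LinearMap.mulLeft K[X] (X ⊗ₜ 1 - 1 ⊗ₜ s)
  have hf : Function.Injective f := (injective_iff_map_eq_zero _).2 hreg
  -- Tensoring with the flat module `A` over K[X] keeps this injectivity, and cancelling K[X]
  -- identifies the result with multiplication on `A ⊗ Q`.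
  have hf' := Module.Flat.lTensor_preserves_injective_linearMap (M := A) f hf
  let c := TensorProduct.AlgebraTensorModule.cancelBaseChange K K[X] K[X] A Q
  have hc : ∀ x, c (f.lTensor A x) = (t ⊗ₜ[K] (1 : Q) - (1 : A) ⊗ₜ[K] s) * c x := by
    intro x
    induction x with
    | zero => simp
    | add a b ha hb => rw [map_add, map_add, map_add, ha, hb, mul_add]
    | tmul a y =>
      induction y with
      | zero => simp
      | add a b ha hb => rw [TensorProduct.tmul_add, map_add, map_add, map_add, ha, hb, mul_add]
      | tmul p q =>
        simp only [LinearMap.lTensor_tmul, f, LinearMap.mulLeft_apply, sub_mul,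
          Algebra.TensorProduct.tmul_mul_tmul, one_mul, TensorProduct.tmul_sub, map_sub, c,
          TensorProduct.AlgebraTensorModule.cancelBaseChange_tmul, mul_smul]
        rw [Algebra.smul_def X, hX]
  rw [mem_nonZeroDivisors_iff_right]
  intro y hy
  obtain ⟨x, rfl⟩ := c.surjective y
  have h3 : f.lTensor A x = 0 := c.injective (by rw [hc, mul_comm, hy, map_zero])
  rw [hf' (h3.trans (map_zero _).symm), map_zero]

/-- Splitting off the i-th factor writes the tensor power as `A ⊗ Q`, with `Q` the product of the
other factors. The i-th copy of t becomes t ⊗ 1 and the j-th copy 1 ⊗ s. -/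
theorem singleAlgHom_sub_mem_nonZeroDivisors {K A : Type} [Field K] [CommRing A] [IsDomain A]
    [Algebra K A] {k : ℕ} {t : A} (ht : Transcendental K t) {i j : Fin k} (hij : i ≠ j) :
    (PiTensorProduct.singleAlgHom (R := K) (A := fun _ : Fin k => A) i t -
      PiTensorProduct.singleAlgHom (R := K) (A := fun _ : Fin k => A) j t) ∈
      nonZeroDivisors (⨂[K] _ : Fin k, A) := by
  let e := (PiTensorProduct.equivPiTensorComplSingletonTensor K (fun _ : Fin k => A) i).trans
    (TensorProduct.comm K _ _)
  let s : ⨂[K] _ : ({i}ᶜ : Set (Fin k)), A :=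
    PiTensorProduct.singleAlgHom (R := K) (A := fun _ : ({i}ᶜ : Set (Fin k)) => A)
      ⟨j, fun h => hij h.symm⟩ t
  have he : ∀ x, e ((PiTensorProduct.singleAlgHom (R := K) (A := fun _ : Fin k => A) i t -
      PiTensorProduct.singleAlgHom (R := K) (A := fun _ : Fin k => A) j t) * x) =
      (t ⊗ₜ 1 - 1 ⊗ₜ s) * e x := by
    intro x
    induction x using PiTensorProduct.induction_on with
    | add a b ha hb => rw [mul_add, map_add, map_add, ha, hb, mul_add]
    | smul_tprod r x =>
      rw [mul_smul_comm, map_smul, map_smul, mul_smul_comm]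
      congr 1
      rw [sub_mul, map_sub, sub_mul]
      have h0 : ∀ y : Fin k → A, e (PiTensorProduct.tprod K y) =
          y i ⊗ₜ PiTensorProduct.tprod K (fun l : ({i}ᶜ : Set (Fin k)) => y l) := by
        intro y
        exact congrArg (TensorProduct.comm K _ _)
          (PiTensorProduct.equivPiTensorComplSingletonTensor_tprod K (fun _ : Fin k => A) i y)
      congr 1
      · rw [PiTensorProduct.singleAlgHom_apply, PiTensorProduct.tprod_mul_tprod, h0, h0,
          Algebra.TensorProduct.tmul_mul_tmul, one_mul]
        congr 1
        · simp
        · congr 1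
          funext l
          have : (l : Fin k) ≠ i := l.2
          simp [this]
      · rw [PiTensorProduct.singleAlgHom_apply, PiTensorProduct.tprod_mul_tprod, h0, h0,
          Algebra.TensorProduct.tmul_mul_tmul]
        congr 1
        · simp [hij]
        · rw [show s = PiTensorProduct.tprod K _ from PiTensorProduct.singleAlgHom_apply _ _,
            PiTensorProduct.tprod_mul_tprod]
          congr 1
          funext l
          by_cases hl : (l : Fin k) = j
          · obtain rfl : l = ⟨j, fun h => hij h.symm⟩ := Subtype.ext hl
            simp
          · have : l ≠ ⟨j, fun h => hij h.symm⟩ := fun h => hl (congrArg Subtype.val h)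
            simp [hl, this]
  rw [mem_nonZeroDivisors_iff_right]
  intro x hx
  apply e.injective
  rw [map_zero]
  refine (mem_nonZeroDivisors_iff_right.1 (tmul_sub_tmul_mem_nonZeroDivisors ht s)) _ ?_
  rw [mul_comm, ← he, mul_comm, hx, map_zero]

end Regular

/-! ### Flat base change of split data. -/

section BaseChange

variable {R E P : Type} [CommRing R] [CommRing E] [CommRing P] {k : ℕ}

/-- A variant of `IsSplit` in which `E` is generated by powers of `t` after inverting `r`. -/
structure IsSplitAway (r : R) (φ : R →+* P) (ψ : R →+* E) (δ : Fin k → (E →+* P)) : Prop where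
  injective : Function.Injective φ
  comp : ∀ i r, δ i (ψ r) = φ r
  exists_generator : ∃ t : E, (∀ e : E, ∃ c : Fin k → R, ψ r * e = ∑ j, ψ (c j) * t ^ (j : ℕ)) ∧
    ∀ i j, i ≠ j → δ i t - δ j t ∈ nonZeroDivisors P
  closure_eq_top : AddSubgroup.closure
    {x : P | ∃ (r : R) (a : Fin k → E), x = φ r * ∏ i, δ i (a i)} = ⊤

variable {R' E' P' : Type} [CommRing R'] [CommRing E'] [CommRing P']

/-- A pushout of commutative rings is a tensor product, hence additively spanned by pure tensors. -/
theorem IsPushout.exists_sum_mul {f : R →+* R'} {ψ : R →+* E} {g : E →+* E'} {ψ' : R' →+* E'}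
    (h : IsPushout (CommRingCat.ofHom ψ) (CommRingCat.ofHom f) (CommRingCat.ofHom g)
      (CommRingCat.ofHom ψ')) :
    AddSubgroup.closure {x : E' | ∃ (r : R') (e : E), x = ψ' r * g e} = ⊤ := by
  algebraize [f, ψ, g, ψ', ψ'.comp f]
  have : IsScalarTower R E E' := IsScalarTower.of_algebraMap_eq fun r => congr($(h.w) r).symm
  have h' : Algebra.IsPushout R E R' E' := CommRingCat.isPushout_iff_isPushout.1 h
  rw [eq_top_iff]
  rintro x -
  refine h'.symm.out.inductionOn x (· ∈ AddSubgroup.closure _) (zero_mem _) ?_ ?_ ?_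
  · intro e
    exact AddSubgroup.subset_closure ⟨1, e, by rw [map_one, one_mul]; rfl⟩
  · intro r y hy
    induction hy using AddSubgroup.closure_induction with
    | mem y hy =>
      obtain ⟨r', e, rfl⟩ := hy
      exact AddSubgroup.subset_closure ⟨r * r', e, by
        rw [map_mul, mul_assoc, Algebra.smul_def]; rfl⟩
    | zero => rw [smul_zero]; exact zero_mem _
    | add a b _ _ ha hb => rw [smul_add]; exact add_mem ha hb
    | neg a _ ha => rw [smul_neg]; exact neg_mem ha
  · intro a b ha hb
    exact add_mem ha hb

/-- The map `φ'` is `φ` tensored with the flat algebra `R'`. -/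
theorem IsPushout.injective_of_flat {f : R →+* R'} {φ : R →+* P} {g : P →+* P'} {φ' : R' →+* P'}
    (h : IsPushout (CommRingCat.ofHom φ) (CommRingCat.ofHom f) (CommRingCat.ofHom g)
      (CommRingCat.ofHom φ')) (hf : f.Flat) (hφ : Function.Injective φ) :
    Function.Injective φ' := by
  algebraize [f, φ, g, φ', φ'.comp f]
  have : IsScalarTower R P P' := IsScalarTower.of_algebraMap_eq fun r => congr($(h.w) r).symm
  have h' : Algebra.IsPushout R R' P P' := (CommRingCat.isPushout_iff_isPushout.1 h).symm
  have h1 := Module.Flat.lTensor_preserves_injective_linearMap (M := R')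
    (Algebra.linearMap R P) hφ
  have h2 : ⇑φ' = ((h'.out.equiv.toLinearMap.restrictScalars R) ∘ₗ
      ((Algebra.linearMap R P).lTensor R') ∘ₗ (TensorProduct.rid R R').symm.toLinearMap) := by
    ext x
    simp [IsBaseChange.equiv_tmul, Algebra.smul_def]
    rfl
  rw [h2]
  exact h'.out.equiv.injective.comp (h1.comp (TensorProduct.rid R R').symm.injective)

/-- Flatness of R → R' passes to P → P', and flat maps preserve regular elements. -/
theorem IsPushout.mem_nonZeroDivisors_of_flat {f : R →+* R'} {φ : R →+* P} {g : P →+* P'}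
    {φ' : R' →+* P'}
    (h : IsPushout (CommRingCat.ofHom φ) (CommRingCat.ofHom f) (CommRingCat.ofHom g)
      (CommRingCat.ofHom φ')) (hf : f.Flat) {x : P} (hx : x ∈ nonZeroDivisors P) :
    g x ∈ nonZeroDivisors P' := by
  algebraize [f, φ, g, φ', φ'.comp f]
  have : IsScalarTower R P P' := IsScalarTower.of_algebraMap_eq fun r => congr($(h.w) r).symm
  have h' : Algebra.IsPushout R P R' P' := CommRingCat.isPushout_iff_isPushout.1 h
  have : Module.Flat P P' := Module.Flat.isBaseChange R P R' P' h'.out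
  have h1 : IsSMulRegular P x := fun a b hab => by
    have hab' : x * a = x * b := hab
    exact (mul_cancel_left_mem_nonZeroDivisors hx).1 hab'
  have h2 : IsSMulRegular P' x := h1.of_flat
  rw [mem_nonZeroDivisors_iff_right]
  intro y hy
  refine h2 ?_
  change x • y = x • 0
  rw [smul_zero, Algebra.smul_def, mul_comm]
  exact hy

/-- Being split is stable under flat base change. -/
theorem IsSplitAway.isSplit_of_flat {r : R} {φ : R →+* P} {ψ : R →+* E} {δ : Fin k → (E →+* P)}
    (h : IsSplitAway r φ ψ δ) {φ' : R' →+* P'} {ψ' : R' →+* E'} {δ' : Fin k → (E' →+* P')}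
    {f : R →+* R'} (hf : f.Flat) {g : E →+* E'} {l : P →+* P'}
    (hg : IsPushout (CommRingCat.ofHom ψ) (CommRingCat.ofHom f) (CommRingCat.ofHom g)
      (CommRingCat.ofHom ψ'))
    (hl : IsPushout (CommRingCat.ofHom φ) (CommRingCat.ofHom f) (CommRingCat.ofHom l)
      (CommRingCat.ofHom φ'))
    (hδ : ∀ i e, δ' i (g e) = l (δ i e)) (hδ' : ∀ i x, δ' i (ψ' x) = φ' x)
    (hr : IsUnit (f r)) : IsSplit φ' ψ' δ' := by
  have hlf : ∀ x, l (φ x) = φ' (f x) := fun x => congr($(hl.w) x)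
  have hgf : ∀ x, g (ψ x) = ψ' (f x) := fun x => congr($(hg.w) x)
  obtain ⟨t, ht, hnzd⟩ := h.exists_generator
  obtain ⟨u, hu⟩ := hr.exists_left_inv
  refine ⟨IsPushout.injective_of_flat hl hf h.injective, hδ', ⟨g t, fun e => ?_, ?_⟩, ?_⟩
  · have he : e ∈ AddSubgroup.closure {x : E' | ∃ (r : R') (e : E), x = ψ' r * g e} := by
      rw [IsPushout.exists_sum_mul hg]
      trivial
    induction he using AddSubgroup.closure_induction with
    | mem y hy =>
      obtain ⟨s, e, rfl⟩ := hy
      obtain ⟨c, hc⟩ := ht e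
      refine ⟨fun j => s * u * f (c j), ?_⟩
      -- The inverse `u` of the image of `r` absorbs the factor that `IsSplitAway` demands in front
      -- of `e`.
      have h1 : ψ' s * g e = ψ' (s * u) * g (ψ r * e) := by
        rw [map_mul g, hgf, ← mul_assoc, ← map_mul, mul_assoc, hu, mul_one]
      rw [h1, hc, map_sum, Finset.mul_sum]
      refine Finset.sum_congr rfl fun j _ => ?_
      rw [map_mul g, hgf, map_pow, map_mul ψ' (s * u), mul_assoc]
    | zero => exact ⟨0, by simp⟩
    | add a b _ _ ha hb =>
      obtain ⟨c, rfl⟩ := ha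
      obtain ⟨c', rfl⟩ := hb
      exact ⟨c + c', by simp [add_mul, Finset.sum_add_distrib]⟩
    | neg a _ ha =>
      obtain ⟨c, rfl⟩ := ha
      exact ⟨-c, by simp⟩
  · intro i j hij
    rw [hδ, hδ, ← map_sub]
    exact IsPushout.mem_nonZeroDivisors_of_flat hl hf (hnzd i j hij)
  · rw [eq_top_iff, ← IsPushout.exists_sum_mul hl, AddSubgroup.closure_le]
    rintro _ ⟨s, x, rfl⟩
    have hx : x ∈ AddSubgroup.closure {x : P | ∃ (r : R) (a : Fin k → E),
        x = φ r * ∏ i, δ i (a i)} := by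
      rw [h.closure_eq_top]
      trivial
    change φ' s * l x ∈ AddSubgroup.closure _
    induction hx using AddSubgroup.closure_induction with
    | mem y hy =>
      obtain ⟨r, a, rfl⟩ := hy
      refine AddSubgroup.subset_closure ⟨s * f r, fun i => g (a i), ?_⟩
      rw [map_mul l, hlf, map_prod, map_mul φ', mul_assoc]
      simp only [hδ]
    | zero => rw [map_zero, mul_zero]; exact zero_mem _
    | add a b _ _ ha hb => rw [map_add, mul_add]; exact add_mem ha hb
    | neg a _ ha => rw [map_neg, mul_neg]; exact neg_mem ha

end BaseChange

/-! ### Generation by powers of a local parameter. -/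

section Generator

open Polynomial

variable {R E P : Type} [CommRing R] [CommRing E] [CommRing P] {k : ℕ}

/-- Every element of `E` is a root of the monic polynomial over the invariants whose roots are its
conjugates. -/
theorem exists_monic_conjugates [NeZero k] [Nontrivial P] {φ : R →+* P} {ψ : R →+* E} {δ : Fin k → (E →+* P)}
    (comp : ∀ i r, δ i (ψ r) = φ r) (hδ : Function.Injective (δ 0))
    {ρ : Equiv.Perm (Fin k) → (P →+* P)} (hρ : ∀ σ i e, ρ σ (δ (σ.symm i) e) = δ i e)
    (hinv : ∀ x, (∀ σ, ρ σ x = x) → ∃ r, φ r = x) (e : E) :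
    ∃ F : R[X], F.Monic ∧ F.map φ = ∏ i, (X - C (δ i e)) ∧ F.eval₂ ψ e = 0 := by
  let G : P[X] := ∏ i, (X - C (δ i e))
  have hG : ∀ σ, G.map (ρ σ) = G := by
    intro σ
    simp only [G, Polynomial.map_prod, Polynomial.map_sub, map_X, map_C]
    refine Fintype.prod_equiv σ _ _ fun i => ?_
    rw [← hρ σ (σ i) e, Equiv.symm_apply_apply]
  -- A permutation only reorders the factors of `G`, so its coefficients are invariant and come from
  -- `R`.
  have hc : ∀ n, ∃ r, φ r = G.coeff n := fun n => hinv _ fun σ => by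
    rw [← coeff_map, hG]
  have hl : G ∈ lifts φ := (lifts_iff_coeff_lifts G).2 hc
  have hmonic : G.Monic := monic_prod_X_sub_C (fun i => δ i e) _
  obtain ⟨F, hF, -, hFm⟩ := lifts_and_degree_eq_and_monic hl hmonic
  refine ⟨F, hFm, hF, hδ ?_⟩
  -- Vanishing may be tested after the injective map `δ 0`, and `δ 0 e` is one of the roots of `G`.
  have h1 : (δ 0).comp ψ = φ := RingHom.ext (comp 0)
  rw [map_zero, hom_eval₂, h1, ← Polynomial.eval_map, hF, eval_prod]
  exact Finset.prod_eq_zero (Finset.mem_univ 0) (by simp)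

/-- Newton interpolation. -/
theorem exists_newton {A : Type} [CommRing A] [Algebra ℂ A] (t : A) {ι : Type} (c : ι → ℂ)
    (s : Finset ι)
    (h : ∀ i ∈ s, ∀ a : A, ∃ (b : ℂ) (a' : A), a = algebraMap ℂ A b + (t - algebraMap ℂ A (c i)) * a')
    (a : A) : ∃ (p : ℂ[X]) (a' : A), p.degree < s.card ∧
      a = aeval t p + aeval t (∏ i ∈ s, (X - C (c i))) * a' := by
  classical
  induction s using Finset.induction_on generalizing a with
  | empty => exact ⟨0, a, by simp, by simp⟩
  | insert i s hi ih =>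
    obtain ⟨b, a', ha⟩ := h i (Finset.mem_insert_self _ _) a
    obtain ⟨p, a'', hp, ha'⟩ := ih (fun j hj => h j (Finset.mem_insert_of_mem hj)) a'
    refine ⟨C b + (X - C (c i)) * p, a'', ?_, ?_⟩
    · rw [Finset.card_insert_of_notMem hi]
      -- The zero polynomial has degree ⊥ and needs separate treatment.
      have h1 : ((X - C (c i)) * p).degree < ((s.card + 1 : ℕ) : WithBot ℕ) := by
        by_cases hp0 : p = 0
        · rw [hp0, mul_zero, degree_zero]; exact WithBot.bot_lt_coe _
        rw [degree_mul, degree_X_sub_C, degree_eq_natDegree hp0] at *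
        norm_cast at *
        omega
      refine (degree_add_le _ _).trans_lt (max_lt (degree_C_le.trans_lt ?_) h1)
      exact_mod_cast Nat.succ_pos _
    · rw [Finset.prod_insert hi, ha, ha']
      simp only [map_add, map_mul, map_sub, aeval_X, aeval_C]
      ring

/-- If `t` is a local parameter at the points underlying a given point of the `k`-fold product then,
locally around that point, `E` is generated by the powers of `t`. -/
theorem exists_isSplitAway [NeZero k] {A : Type} [CommRing A] [Algebra ℂ A]
    [Algebra.FiniteType ℂ A] {φ : R →+* P} {ψ : R →+* E} {δ : Fin k → (E →+* P)}
    (hφ : Function.Injective φ) (comp : ∀ i r, δ i (ψ r) = φ r) (hδ : Function.Injective (δ 0))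
    {ρ : Equiv.Perm (Fin k) → (P →+* P)} (hρ : ∀ σ i e, ρ σ (δ (σ.symm i) e) = δ i e)
    (hinv : ∀ x, (∀ σ, ρ σ x = x) → ∃ r, φ r = x) (α : A →+* E) (κ : ℂ →+* R)
    (hκ : ∀ c, ψ (κ c) = α (algebraMap ℂ A c))
    (hE : AddSubgroup.closure {x : E | ∃ (r : R) (a : A), x = ψ r * α a} = ⊤)
    (hP : AddSubgroup.closure {x : P | ∃ (r : R) (a : Fin k → A), x = φ r * ∏ i, δ i (α (a i))} = ⊤)
    (ev : P →+* ℂ) (hev : ∀ c, ev (φ (κ c)) = c) (t : A)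
    (ht : ∀ i a, ev (δ i (α a)) = 0 → ∃ a', a = (t - algebraMap ℂ A (ev (δ i (α t)))) * a')
    (hnzd : ∀ i j, i ≠ j → δ i (α t) - δ j (α t) ∈ nonZeroDivisors P) :
    ∃ r, ev (φ r) ≠ 0 ∧ IsSplitAway r φ ψ δ := by
  let m : Ideal R := RingHom.ker (ev.comp φ)
  let c : Fin k → ℂ := fun i => ev (δ i (α t))
  have : Nontrivial P := ev.domain_nontrivial
  algebraize [ψ]
  have halg : ∀ r, algebraMap R E r = ψ r := fun _ => rfl
  let N : Submodule R E := Submodule.span R (Set.range fun j : Fin k => α t ^ (j : ℕ))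
  have hN : ∀ p : ℂ[X], p.degree < k → α (aeval t p) ∈ N := by
    intro p hp
    have hp' : p.natDegree < k := by
      rcases eq_or_ne p 0 with rfl | h0
      · simpa using NeZero.pos k
      · exact (natDegree_lt_iff_degree_lt h0).2 hp
    rw [aeval_eq_sum_range' hp', map_sum]
    refine sum_mem fun j hj => ?_
    rw [Algebra.smul_def, map_mul, ← hκ, map_pow, ← halg, ← Algebra.smul_def]
    exact Submodule.smul_mem _ _ (Submodule.subset_span ⟨⟨j, Finset.mem_range.1 hj⟩, rfl⟩)
  have hintegral : Algebra.IsIntegral R E := ⟨fun e => by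
    obtain ⟨F, hF, -, h0⟩ := exists_monic_conjugates comp hδ hρ hinv e
    exact ⟨F, hF, h0⟩⟩
  -- The monic polynomial of the conjugates of t kills α(t), and modulo `m` it becomes ∏ (X − c_i);
  -- the difference of the two has coefficients in `m`.
  have hprod : α (aeval t (∏ i, (X - C (c i)))) ∈ m • (⊤ : Submodule R E) := by
    obtain ⟨F, hF, hF', h0⟩ := exists_monic_conjugates comp hδ hρ hinv (α t)
    have h1 : α (aeval t (∏ i, (X - C (c i)))) =
        ((∏ i, (X - C (c i))).map κ - F).eval₂ ψ (α t) := by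
      rw [eval₂_sub, h0, sub_zero, eval₂_map, aeval_def, hom_eval₂]
      congr 1
      exact RingHom.ext fun x => (hκ x).symm
    rw [h1, eval₂_eq_sum_range]
    refine sum_mem fun j _ => ?_
    rw [← halg, ← Algebra.smul_def]
    refine Submodule.smul_mem_smul ?_ trivial
    have h2 : (((∏ i, (X - C (c i))).map κ - F).map φ).map ev = 0 := by
      rw [Polynomial.map_sub, Polynomial.map_sub, hF', Polynomial.map_map, Polynomial.map_map]
      have h3 : (ev.comp φ).comp κ = RingHom.id ℂ := RingHom.ext hev
      rw [h3, Polynomial.map_id, Polynomial.map_prod, sub_eq_zero]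
      refine Finset.prod_congr rfl fun i _ => ?_
      simp [c]
    have h4 := congrArg (fun q => q.coeff j) h2
    simp only [coeff_map, coeff_zero] at h4
    exact h4
  have hA : ∀ a, α a ∈ N ⊔ m • (⊤ : Submodule R E) := by
    intro a
    -- The nodes are the `k` values c_i, repeated when coordinates coincide. Each interpolation step
    -- divides by t − c_i, which `ht` permits because t is a parameter at each point.
    obtain ⟨p, a', hp, ha⟩ := exists_newton t c Finset.univ (fun i _ a => by
      obtain ⟨a', ha'⟩ := ht i (a - algebraMap ℂ A (ev (δ i (α a)))) (by
        rw [map_sub, map_sub, map_sub, ← hκ, comp, hev, sub_self])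
      exact ⟨_, a', (sub_eq_iff_eq_add'.1 ha')⟩) a
    rw [ha, map_add, map_mul]
    refine add_mem (Submodule.mem_sup_left (hN p (by simpa using hp))) (Submodule.mem_sup_right ?_)
    rw [mul_comm]
    have : ∀ x ∈ m • (⊤ : Submodule R E), ∀ y, y * x ∈ m • (⊤ : Submodule R E) := by
      intro x hx y
      induction hx using Submodule.smul_induction_on' with
      | smul r hr x _ => rw [mul_smul_comm]; exact Submodule.smul_mem_smul hr trivial
      | add a _ b _ ha hb => rw [mul_add]; exact add_mem ha hb
    exact this _ hprod _
  have htop : (⊤ : Submodule R E) ≤ N ⊔ m • (⊤ : Submodule R E) := by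
    rintro x -
    have hx : x ∈ AddSubgroup.closure {x : E | ∃ (r : R) (a : A), x = ψ r * α a} := by
      rw [hE]; trivial
    induction hx using AddSubgroup.closure_induction with
    | mem y hy =>
      obtain ⟨r, a, rfl⟩ := hy
      rw [← halg, ← Algebra.smul_def]
      exact Submodule.smul_mem _ _ (hA a)
    | zero => exact zero_mem _
    | add a b _ _ ha hb => exact add_mem ha hb
    | neg a _ ha => exact neg_mem ha
  -- Integrality together with finite type makes `E` a finite `R`-module, as Nakayama requires.
  have hft : Algebra.FiniteType R E := by
    obtain ⟨s, hs⟩ := Algebra.FiniteType.out (R := ℂ) (A := A)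
    classical
    refine ⟨s.image α, ?_⟩
    have hmem : ∀ a, α a ∈ Algebra.adjoin R ((s.image α : Finset E) : Set E) := by
      intro a
      have ha : a ∈ Algebra.adjoin ℂ (s : Set A) := by rw [hs]; trivial
      induction ha using Algebra.adjoin_induction with
      | mem x hx => exact Algebra.subset_adjoin (by simpa using ⟨x, hx, rfl⟩)
      | algebraMap z => rw [← hκ, ← halg]; exact Subalgebra.algebraMap_mem _ _
      | add a b _ _ ha hb => rw [map_add]; exact add_mem ha hb
      | mul a b _ _ ha hb => rw [map_mul]; exact mul_mem ha hb
    rw [eq_top_iff]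
    rintro x -
    have hx : x ∈ AddSubgroup.closure {x : E | ∃ (r : R) (a : A), x = ψ r * α a} := by
      rw [hE]; trivial
    induction hx using AddSubgroup.closure_induction with
    | mem y hy =>
      obtain ⟨r, a, rfl⟩ := hy
      exact mul_mem (Subalgebra.algebraMap_mem _ r) (hmem a)
    | zero => exact zero_mem _
    | add a b _ _ ha hb => exact add_mem ha hb
    | neg a _ ha => exact neg_mem ha
  have hfin : Module.Finite R E := Algebra.IsIntegral.finite
  -- Nakayama for E / N: an element congruent to 1 modulo `m`, hence nonzero at the point, maps all
  -- of `E` into the span of the powers of t.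
  have hnak : ∃ r : R, r - 1 ∈ m ∧ ∀ e : E, r • e ∈ N := by
    have hq : (⊤ : Submodule R (E ⧸ N)) ≤ m • ⊤ := by
      rw [← Submodule.range_mkQ N, LinearMap.range_eq_map, ← Submodule.map_smul'']
      calc (⊤ : Submodule R E).map N.mkQ ≤ (N ⊔ m • (⊤ : Submodule R E)).map N.mkQ :=
            Submodule.map_mono htop
        _ = (m • (⊤ : Submodule R E)).map N.mkQ := by
            rw [Submodule.map_sup, Submodule.mkQ_map_self, bot_sup_eq]
    obtain ⟨r, hr, hr'⟩ := Submodule.exists_sub_one_mem_and_smul_eq_zero_of_fg_of_le_smul m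
      (⊤ : Submodule R (E ⧸ N)) Module.Finite.fg_top hq
    refine ⟨r, hr, fun e => ?_⟩
    have h1 := hr' (N.mkQ e) trivial
    rwa [← map_smul, Submodule.mkQ_apply, Submodule.Quotient.mk_eq_zero] at h1
  obtain ⟨r, hr, hrN⟩ := hnak
  refine ⟨r, ?_, hφ, comp, ⟨α t, fun e => ?_, hnzd⟩, ?_⟩
  · have h1 : ev (φ (r - 1)) = 0 := hr
    rw [map_sub, map_sub, map_one, map_one, sub_eq_zero] at h1
    rw [h1]
    exact one_ne_zero
  · obtain ⟨d, hd⟩ := (Submodule.mem_span_range_iff_exists_fun R).1 (hrN e)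
    refine ⟨d, ?_⟩
    rw [← halg, ← Algebra.smul_def, ← hd]
    exact Finset.sum_congr rfl fun j _ => Algebra.smul_def _ _
  · rw [eq_top_iff, ← hP, AddSubgroup.closure_le]
    rintro _ ⟨r, a, rfl⟩
    exact AddSubgroup.subset_closure ⟨r, fun i => α (a i), rfl⟩

end Generator

/-! ### Local parameters at points of a smooth curve. -/

section LocalParameter

/-- Let n be the kernel of `χ`. The class of b − χ(b) in n/n² is a derivation that hits every class,
so n/n² is generated by the image of a basis of the rank one module of differentials. If n were
zero, all differentials would vanish, against the rank. -/
theorem exists_le_span_sup_sq {R B : Type} [CommRing R] [CommRing B] [Nontrivial B] [Algebra R B]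
    [Algebra.IsStandardSmoothOfRelativeDimension 1 R B] (χ : B →ₐ[R] R) :
    RingHom.ker χ ≠ ⊥ ∧ ∃ u ∈ RingHom.ker χ, RingHom.ker χ ≤ Ideal.span {u} ⊔ RingHom.ker χ ^ 2 := by
  have := Algebra.IsStandardSmoothOfRelativeDimension.isStandardSmooth 1 (R := R) (S := B)
  have hrank := Algebra.IsStandardSmoothOfRelativeDimension.rank_kaehlerDifferential 1 (R := R)
    (S := B)
  have hmem : ∀ b, b - algebraMap R B (χ b) ∈ RingHom.ker χ := fun b => by
    rw [RingHom.mem_ker, map_sub, AlgHom.commutes, Algebra.algebraMap_self, RingHom.id_apply,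
      sub_self]
  constructor
  · intro hbot
    have hD : ∀ b, KaehlerDifferential.D R B b = 0 := fun b => by
      have h1 := hmem b
      rw [hbot, Ideal.mem_bot, sub_eq_zero] at h1
      rw [h1, Derivation.map_algebraMap]
    have h2 : Subsingleton (Ω[B⁄R]) := by
      rw [← Submodule.subsingleton_iff B, ← subsingleton_iff_bot_eq_top,
        ← KaehlerDifferential.span_range_derivation R B, eq_comm, Submodule.span_eq_bot]
      rintro _ ⟨b, rfl⟩
      exact hD b
    rw [rank_subsingleton'] at hrank
    simp at hrank
  · let n := RingHom.ker χ
    let d : Derivation R B n.Cotangent :=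
      { toFun := fun b => n.toCotangent ⟨b - algebraMap R B (χ b), hmem b⟩
        map_add' := fun a b => by
          rw [← map_add]
          congr 1
          ext
          simp only [map_add, AddMemClass.coe_add]
          ring
        map_smul' := fun r b => by
          rw [RingHom.id_apply, ← LinearMap.map_smul_of_tower]
          congr 1
          ext
          change r • b - algebraMap R B (χ (r • b)) = r • (b - algebraMap R B (χ b))
          rw [map_smul, smul_eq_mul, map_mul, smul_sub, Algebra.smul_def r (algebraMap R B (χ b))]
        map_one_eq_zero' := by
          have : (⟨1 - algebraMap R B (χ 1), hmem 1⟩ : n) = 0 := by ext; simp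
          exact (congrArg n.toCotangent this).trans (map_zero _)
        leibniz' := fun a b => by
          simp only [LinearMap.coe_mk, AddHom.coe_mk]
          rw [← map_smul, ← map_smul, ← map_add, Ideal.toCotangent_eq]
          simp only [SetLike.val_smul, AddMemClass.coe_add, smul_eq_mul, map_mul]
          have : a * b - algebraMap R B (χ a) * algebraMap R B (χ b) -
              (a * (b - algebraMap R B (χ b)) + b * (a - algebraMap R B (χ a))) =
              -((a - algebraMap R B (χ a)) * (b - algebraMap R B (χ b))) := by ring
          rw [this, neg_mem_iff, pow_two]
          exact Ideal.mul_mem_mul (hmem a) (hmem b) }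
    have hfin : Module.finrank B (Ω[B⁄R]) = 1 := by
      rw [Module.finrank, hrank]; simp
    let b := Module.basisUnique Unit hfin
    -- The parameter `u` lifts the image in n/n² of the basis element of the differentials.
    obtain ⟨⟨u, hu⟩, hu'⟩ := n.toCotangent_surjective (d.liftKaehlerDifferential (b ()))
    refine ⟨u, hu, fun a ha => ?_⟩
    have h1 : KaehlerDifferential.D R B a = b.repr (KaehlerDifferential.D R B a) () • b () := by
      conv_lhs => rw [← b.sum_repr (KaehlerDifferential.D R B a)]
      simp
    have h2 : n.toCotangent ⟨a, ha⟩ = b.repr (KaehlerDifferential.D R B a) () •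
        n.toCotangent ⟨u, hu⟩ := by
      rw [hu', ← map_smul, ← h1, Derivation.liftKaehlerDifferential_comp_D]
      change _ = n.toCotangent ⟨a - algebraMap R B (χ a), hmem a⟩
      congr 1
      ext
      have : χ a = 0 := ha
      simp [this]
    rw [← map_smul, Ideal.toCotangent_eq] at h2
    have h3 := Submodule.add_mem_sup (S := Ideal.span {u}) (T := n ^ 2)
      (Ideal.mul_mem_left _ (b.repr (KaehlerDifferential.D R B a) ()) (Ideal.mem_span_singleton_self u)) h2
    simpa using h3

/-- `A` and `B` are two affine charts at the same point, with common local ring `O`. Nakayama in `O`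
makes its maximal ideal principal, generated by `u`; up to a unit the generator comes from `A`, and
clearing denominators gives the statement there. -/
theorem exists_local_generator {A B O : Type} [CommRing A] [CommRing B] [CommRing O] [IsDomain B]
    [IsLocalRing O] [Algebra A O] [Algebra B O] (p : Ideal A) [p.IsPrime] (n : Ideal B) [n.IsPrime]
    [IsLocalization.AtPrime O p] [IsLocalization.AtPrime O n] (hn : n.FG) (hne : n ≠ ⊥) {u : B}
    (hun : u ∈ n) (hu : n ≤ Ideal.span {u} ⊔ n ^ 2) :
    p ≠ ⊥ ∧ ∃ v ∈ p, ∀ a ∈ p, ∃ g b, g ∉ p ∧ g * a = v * b := by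
  have hA : p.map (algebraMap A O) = IsLocalRing.maximalIdeal O :=
    IsLocalization.AtPrime.map_eq_maximalIdeal p O
  have hB : n.map (algebraMap B O) = IsLocalRing.maximalIdeal O :=
    IsLocalization.AtPrime.map_eq_maximalIdeal n O
  constructor
  · rintro rfl
    rw [Ideal.map_bot] at hA
    refine hne (eq_bot_iff.2 fun b hb => ?_)
    have h1 : algebraMap B O b ∈ IsLocalRing.maximalIdeal O := hB ▸ Ideal.mem_map_of_mem _ hb
    rw [← hA, Ideal.mem_bot] at h1
    exact IsLocalization.injective O n.primeCompl_le_nonZeroDivisors (h1.trans (map_zero _).symm)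
  · have hM : IsLocalRing.maximalIdeal O = Ideal.span {algebraMap B O u} := by
      refine le_antisymm ?_ ?_
      · refine Submodule.le_of_le_smul_of_le_jacobson_bot (I := IsLocalRing.maximalIdeal O)
          (hB ▸ hn.map _) (IsLocalRing.maximalIdeal_le_jacobson _) ?_
        have h1 := Ideal.map_mono (f := algebraMap B O) hu
        rw [Ideal.map_sup, Ideal.map_span, Set.image_singleton, Ideal.map_pow, hB, pow_two] at h1
        exact h1
      · rw [Ideal.span_singleton_le_iff_mem, ← hB]
        exact Ideal.mem_map_of_mem _ hun
    obtain ⟨⟨v, s⟩, hv⟩ := IsLocalization.surj p.primeCompl (algebraMap B O u)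
    have hs : IsUnit (algebraMap A O s) := IsLocalization.map_units O s
    have hM' : IsLocalRing.maximalIdeal O = Ideal.span {algebraMap A O v} := by
      rw [hM, ← hv, Ideal.span_singleton_mul_right_unit hs]
    have hvp : v ∈ p := by
      rw [← IsLocalization.AtPrime.to_map_mem_maximal_iff O p, hM']
      exact Ideal.mem_span_singleton_self _
    refine ⟨v, hvp, fun a ha => ?_⟩
    have h1 : algebraMap A O a ∈ IsLocalRing.maximalIdeal O := hA ▸ Ideal.mem_map_of_mem _ ha
    rw [hM', Ideal.mem_span_singleton] at h1
    obtain ⟨y, hy⟩ := h1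
    obtain ⟨⟨b, s'⟩, hb⟩ := IsLocalization.surj p.primeCompl y
    have h2 : algebraMap A O (a * s') = algebraMap A O (v * b) := by
      rw [map_mul, map_mul, hy, mul_assoc, hb]
    obtain ⟨c, hc⟩ := (IsLocalization.eq_iff_exists p.primeCompl O).1 h2
    refine ⟨c * s', c * b, fun h => ?_, ?_⟩
    · exact ((Ideal.IsPrime.mul_mem_iff_mem_or_mem ‹_›).1 h).elim c.2 s'.2
    · rw [mul_assoc, mul_comm (s' : A), hc]
      ring

/-- A function on an affine curve that is a local parameter at finitely many given points and
separates them. -/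
theorem exists_parameter {A : Type} [CommRing A] [IsDomain A] [Algebra ℂ A] [IsNoetherianRing A]
    {ι : Type} [Finite ι] [Nonempty ι] (χ : ι → (A →ₐ[ℂ] ℂ)) (hne : ∀ i, RingHom.ker (χ i) ≠ ⊥)
    (u : ι → A) (hu : ∀ i a, χ i a = 0 → ∃ g b, χ i g ≠ 0 ∧ g * a = u i * b)
    (hu0 : ∀ i, χ i (u i) = 0) :
    ∃ t g : A, Transcendental ℂ t ∧ (∀ i, χ i g ≠ 0) ∧
      ∀ i a, χ i a = 0 → ∃ b, g * a = (t - algebraMap ℂ A (χ i t)) * b := by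
  classical
  have := Fintype.ofFinite ι
  let n : ι → Ideal A := fun i => RingHom.ker (χ i)
  have hn : ∀ i, (n i).IsPrime := fun i => RingHom.ker_isPrime _
  have hsub : ∀ i a, a - algebraMap ℂ A (χ i a) ∈ n i := fun i a => by
    rw [RingHom.mem_ker, map_sub, AlgHom.commutes, Algebra.algebraMap_self, RingHom.id_apply,
      sub_self]
  -- The bad functions to be avoided: `p i` consists of those that fail to be parameters at the i-th
  -- point.
  let p : ι → Submodule ℂ A := fun i => ((n i ^ 2).restrictScalars ℂ).comap
    (LinearMap.id - (Algebra.linearMap ℂ A) ∘ₗ (χ i).toLinearMap)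
  have hp : ∀ i a, a ∈ p i ↔ a - algebraMap ℂ A (χ i a) ∈ n i ^ 2 := fun i a => Iff.rfl
  -- `q` consists of those that fail to separate two distinct points. For equal points ⊥ serves as a
  -- harmless proper subspace.
  let q : ι × ι → Submodule ℂ A := fun ij =>
    if χ ij.1 = χ ij.2 then ⊥ else LinearMap.ker ((χ ij.1).toLinearMap - (χ ij.2).toLinearMap)
  have hbot : (⊥ : Submodule ℂ A) ≠ ⊤ := bot_ne_top
  have hptop : ∀ i, p i ≠ ⊤ := by
    intro i htop
    have hidem : IsIdempotentElem (n i) := by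
      refine le_antisymm Ideal.mul_le_left fun a ha => ?_
      have h1 : a ∈ p i := htop ▸ trivial
      have h2 : χ i a = 0 := ha
      rw [hp, h2, map_zero, sub_zero, pow_two] at h1
      exact h1
    rcases (Ideal.isIdempotentElem_iff_eq_bot_or_top _ (IsNoetherian.noetherian _)).1 hidem
      with h | h
    · exact hne i h
    · exact (hn i).ne_top h
  have hqtop : ∀ ij, q ij ≠ ⊤ := by
    intro ij htop
    by_cases h : χ ij.1 = χ ij.2
    · simp only [q, if_pos h] at htop
      exact hbot htop
    · simp only [q, if_neg h, LinearMap.ker_eq_top, sub_eq_zero] at htop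
      exact h (AlgHom.toLinearMap_injective htop)
  obtain ⟨t, ht⟩ : ∃ t, ∀ l : ι ⊕ (ι × ι), t ∉ Sum.elim p q l := by
    by_contra hcon
    -- A vector space over the infinite field ℂ is not a finite union of proper subspaces.
    push Not at hcon
    have hcov : ⋃ l, ((Sum.elim p q l : Submodule ℂ A) : Set A) = Set.univ := by
      ext x
      simpa using hcon x
    obtain ⟨l, hl⟩ := Subspace.exists_eq_top_of_iUnion_eq_univ hcov
    rcases l with i | ij
    · exact hptop i hl
    · exact hqtop ij hl
  have htp : ∀ i, t - algebraMap ℂ A (χ i t) ∉ n i ^ 2 := fun i => ht (Sum.inl i)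
  have htq : ∀ i j, χ i ≠ χ j → χ i t ≠ χ j t := fun i j hij h => by
    refine ht (Sum.inr (i, j)) ?_
    simp only [Sum.elim_inr, q, if_neg hij, LinearMap.mem_ker, LinearMap.sub_apply,
      AlgHom.toLinearMap_apply, h, sub_self]
  have hloc : ∀ i a, χ i a = 0 → ∃ g b, χ i g ≠ 0 ∧ g * a = (t - algebraMap ℂ A (χ i t)) * b := by
    intro i a ha
    obtain ⟨g, b, hg, hb⟩ := hu i _ (hsub i t)
    obtain ⟨g', b', hg', hb'⟩ := hu i a ha
    -- If `b` vanished at the point, g (t − t(x_i)) would lie in the square of the maximal ideal,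
    -- and so would t − t(x_i), since `g` has a nonzero value there.
    have hb0 : χ i b ≠ 0 := by
      intro hb0
      have h1 : g * (t - algebraMap ℂ A (χ i t)) ∈ n i ^ 2 := by
        rw [hb, pow_two]
        exact Ideal.mul_mem_mul (hu0 i) hb0
      have h2 : (g - algebraMap ℂ A (χ i g)) * (t - algebraMap ℂ A (χ i t)) ∈ n i ^ 2 := by
        rw [pow_two]
        exact Ideal.mul_mem_mul (hsub i g) (hsub i t)
      have h3 : algebraMap ℂ A (χ i g) * (t - algebraMap ℂ A (χ i t)) ∈ n i ^ 2 := by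
        have := sub_mem h1 h2
        rwa [← sub_mul, sub_sub_cancel] at this
      have h4 := Ideal.mul_mem_left _ (algebraMap ℂ A (χ i g)⁻¹) h3
      rw [← mul_assoc, ← map_mul, inv_mul_cancel₀ hg, map_one, one_mul] at h4
      exact htp i h4
    refine ⟨b * g', g * b', ?_, ?_⟩
    · rw [map_mul]
      exact mul_ne_zero hb0 hg'
    · rw [mul_assoc, hb', mul_left_comm b, ← mul_assoc, ← hb]
      ring
  -- The colon ideal contains the functions `g` for which t − t(x_i) divides every g a with `a`
  -- vanishing at x_i.
  let I : ι → Ideal A := fun i =>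
    (Ideal.span {t - algebraMap ℂ A (χ i t)}).colon (n i : Set A)
  have hI : ∀ i j, ¬ I i ≤ n j := by
    intro i j hle
    -- At the i-th point itself a product of local denominators for finitely many generators lies in
    -- `I i` and does not vanish; at a different point t − t(x_i) does the job.
    by_cases hij : χ i = χ j
    · obtain ⟨s, hs⟩ := IsNoetherian.noetherian (n i)
      have hsn : ∀ a ∈ s, χ i a = 0 := fun a ha => by
        have : a ∈ n i := hs ▸ Submodule.subset_span ha
        exact this
      choose! g b hg hb using hloc i
      have h1 : ∏ a ∈ s, g a ∈ I i := by
        rw [Submodule.mem_colon]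
        intro x hx
        have hx' : x ∈ Submodule.span A (s : Set A) := by rw [hs]; exact hx
        induction hx' using Submodule.span_induction with
        | mem x hx' =>
          rw [smul_eq_mul, Ideal.mem_span_singleton, ← Finset.prod_erase_mul _ _ hx', mul_assoc,
            hb x (hsn x hx'), mul_left_comm]
          exact dvd_mul_right _ _
        | zero => rw [smul_zero]; exact zero_mem _
        | add a b ha' hb' ha hb =>
          rw [smul_add]
          exact add_mem (ha (hs ▸ ha')) (hb (hs ▸ hb'))
        | smul r a ha' ha =>
          rw [smul_comm]
          exact Ideal.mul_mem_left _ _ (ha (hs ▸ ha'))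
      have h2 : χ j (∏ a ∈ s, g a) = 0 := hle h1
      rw [← hij, map_prod, Finset.prod_eq_zero_iff] at h2
      obtain ⟨a, ha, ha'⟩ := h2
      exact hg a (hsn a ha) ha'
    · have h1 : t - algebraMap ℂ A (χ i t) ∈ I i := by
        rw [Submodule.mem_colon]
        intro x _
        rw [smul_eq_mul, Ideal.mem_span_singleton]
        exact dvd_mul_right _ _
      have h2 : χ j (t - algebraMap ℂ A (χ i t)) = 0 := hle h1
      rw [map_sub, AlgHom.commutes, Algebra.algebraMap_self, RingHom.id_apply, sub_eq_zero] at h2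
      exact htq i j hij h2.symm
  -- Prime avoidance yields one function in all the colon ideals that vanishes at none of the
  -- points.
  have hprod : ¬ ((∏ i, I i : Ideal A) : Set A) ⊆ 
      ⋃ j ∈ ((Finset.univ : Finset ι) : Set ι), n j := by
    rw [Ideal.subset_union_prime (Classical.arbitrary ι) (Classical.arbitrary ι)
      fun j _ _ _ => hn j]
    rintro ⟨j, -, hj⟩
    obtain ⟨i, -, hi⟩ := ((hn j).prod_le).1 hj
    exact hI i j hi
  obtain ⟨g, hg, hgn⟩ := Set.not_subset.1 hprod
  refine ⟨t, g, ?_, fun i hi => hgn ?_, fun i a ha => ?_⟩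
  -- An algebraic t would be constant, because ℂ is algebraically closed, and then t − t(x) = 0
  -- would lie in the square of the maximal ideal.
  · intro halg
    have hintegral : IsIntegral ℂ t := halg.isIntegral
    obtain ⟨c, hc⟩ : ∃ c, algebraMap ℂ A c = t := by
      refine ⟨-(minpoly ℂ t).coeff 0, ?_⟩
      have h := IsAlgClosed.degree_eq_one_of_irreducible ℂ (minpoly.irreducible hintegral)
      have h0 := minpoly.aeval ℂ t
      rw [Polynomial.eq_X_add_C_of_degree_eq_one h, (minpoly.monic hintegral).leadingCoeff,
        Polynomial.C_1, one_mul, map_add, Polynomial.aeval_X, Polynomial.aeval_C,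
        add_eq_zero_iff_eq_neg, ← map_neg] at h0
      exact h0.symm
    refine htp (Classical.arbitrary ι) ?_
    rw [← hc, AlgHom.commutes, Algebra.algebraMap_self, RingHom.id_apply, sub_self]
    exact zero_mem _
  · simp only [Finset.coe_univ, Set.mem_univ, Set.iUnion_true, Set.mem_iUnion]
    exact ⟨i, hi⟩
  · have h1 : g ∈ I i := Ideal.prod_le_inf.trans (Finset.inf_le (Finset.mem_univ i)) hg
    have h2 := Submodule.mem_colon.1 h1 a ha
    rw [smul_eq_mul, Ideal.mem_span_singleton] at h2
    exact h2

end LocalParameter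

/-! ### Values of functions at complex points. -/

section Points

variable {X Y : Scheme.{0}}

/-- The value of a function at a `ℂ`-valued point. -/
def evalAt (x : Spec (.of ℂ) ⟶ X) (V : X.Opens) (hx : ⊤ ≤ x ⁻¹ᵁ V) : Γ(X, V) →+* ℂ :=
  (x.appLE V ⊤ hx ≫ (Scheme.ΓSpecIso (.of ℂ)).hom).hom

theorem top_le_preimage (x : Spec (.of ℂ) ⟶ X) {V : X.Opens} {p : Spec (.of ℂ)} (h : x p ∈ V) :
    ⊤ ≤ x ⁻¹ᵁ V := by
  intro q _
  rw [Subsingleton.elim q p]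
  exact h

theorem evalAt_ne_zero_iff (x : Spec (.of ℂ) ⟶ X) (V : X.Opens) (hx : ⊤ ≤ x ⁻¹ᵁ V) (s : Γ(X, V))
    (p : Spec (.of ℂ)) : evalAt x V hx s ≠ 0 ↔ x p ∈ X.basicOpen s := by
  let e := (Scheme.ΓSpecIso (.of ℂ)).commRingCatIsoToRingEquiv
  have he : evalAt x V hx s = e (x.appLE V ⊤ hx s) := rfl
  constructor
  · intro h
    have h1 : IsUnit (x.appLE V ⊤ hx s) := by
      rw [he, ← isUnit_iff_ne_zero] at h
      simpa using h.map e.symm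
    have h2 := Scheme.basicOpen_of_isUnit _ h1
    rw [Scheme.basicOpen_appLE] at h2
    have : p ∈ (⊤ ⊓ x ⁻¹ᵁ X.basicOpen s : (Spec (.of ℂ)).Opens) := by rw [h2]; trivial
    exact this.2
  · intro h h0
    rw [he, map_eq_zero_iff e e.injective] at h0
    have h3 := Scheme.basicOpen_appLE x ⊤ V hx s
    rw [h0, Scheme.basicOpen_zero, top_inf_eq] at h3
    have h4 : p ∈ x ⁻¹ᵁ X.basicOpen s := h
    rw [← h3] at h4
    exact h4

theorem evalAt_appLE (x : Spec (.of ℂ) ⟶ X) (f : X ⟶ Y) {y : Spec (.of ℂ) ⟶ Y} (h : x ≫ f = y)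
    (V : X.Opens) (hx : ⊤ ≤ x ⁻¹ᵁ V) (W : Y.Opens) (e : V ≤ f ⁻¹ᵁ W) (hy : ⊤ ≤ y ⁻¹ᵁ W)
    (s : Γ(Y, W)) : evalAt x V hx (f.appLE W V e s) = evalAt y W hy s := by
  subst h
  have h1 := Scheme.Hom.appLE_comp_appLE x f W V ⊤ e hx
  exact congr((Scheme.ΓSpecIso (.of ℂ)).hom ($h1 s))

theorem evalAt_res (x : Spec (.of ℂ) ⟶ X) {V W : X.Opens} (h : W ≤ V) (hx : ⊤ ≤ x ⁻¹ᵁ W)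
    (hx' : ⊤ ≤ x ⁻¹ᵁ V) (s : Γ(X, V)) :
    evalAt x W hx (X.presheaf.map (homOfLE h).op s) = evalAt x V hx' s := by
  have h1 := Scheme.Hom.map_appLE x hx (homOfLE h).op
  exact congr((Scheme.ΓSpecIso (.of ℂ)).hom ($h1 s))

end Points

/-! ### The maximal ideal at a complex point of a smooth curve. -/

section Smooth

variable {X : Scheme.{0}} [IsIntegral X] (f : X ⟶ Spec (.of ℂ)) [SmoothOfRelativeDimension 1 f]

/-- Smoothness supplies a standard smooth chart at the point, unrelated to the given affine open
`V`. The parameter found on that chart is moved to `V` through the stalk. -/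
theorem exists_generator_at_point (x : Spec (.of ℂ) ⟶ X) (hx : x ≫ f = 𝟙 _) {V : X.Opens}
    (hV : IsAffineOpen V) (hxV : ⊤ ≤ x ⁻¹ᵁ V) :
    RingHom.ker (evalAt x V hxV) ≠ ⊥ ∧ ∃ v, evalAt x V hxV v = 0 ∧
      ∀ a, evalAt x V hxV a = 0 → ∃ g b, evalAt x V hxV g ≠ 0 ∧ g * a = v * b := by
  let p : Spec (.of ℂ) := IsLocalRing.closedPoint ℂ
  obtain ⟨U, hU, V', hV', hxV', e, hs⟩ :=
    SmoothOfRelativeDimension.exists_isStandardSmoothOfRelativeDimension (n := 1) (f := f) (x p)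
  have hpV : x p ∈ V := hxV trivial
  have hUV' : U ≤ x ⁻¹ᵁ V' := le_top.trans (top_le_preimage x hxV')
  have hpU : p ∈ U := by
    have h1 := e hxV'
    have h2 : (x ≫ f) p = p := by rw [hx]; rfl
    change f (x p) ∈ U at h1
    rwa [← Scheme.Hom.comp_apply, h2] at h1
  -- The base is a single point, so the open subset of the base that comes with the chart is
  -- everything.
  have hUtop : U = ⊤ := top_le_iff.1 fun q _ => by rwa [Subsingleton.elim q p]
  subst hUtop
  have : Nonempty V' := ⟨⟨_, hxV'⟩⟩
  have : Nonempty V := ⟨⟨_, hpV⟩⟩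
  algebraize [(f.appLE ⊤ V' e).hom]
  -- The point is a section of the structure morphism, so evaluation there is a retraction onto the
  -- base ring.
  let χ : Γ(X, V') →ₐ[Γ(Spec (.of ℂ), ⊤)] Γ(Spec (.of ℂ), ⊤) :=
    { (x.appLE V' ⊤ hUV').hom with
      commutes' := fun r => by
        have h1 := Scheme.Hom.appLE_comp_appLE x f ⊤ V' ⊤ e hUV'
        have h2 : (x ≫ f).appLE ⊤ ⊤ le_top = 𝟙 _ := by
          rw [hx]
          exact (Scheme.Hom.appLE_eq_app (𝟙 (Spec (.of ℂ))) (U := ⊤)).trans (Scheme.Hom.id_app ⊤)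
        exact congr($(h1.trans h2) r) }
  obtain ⟨hne, u, hu, hle⟩ := exists_le_span_sup_sq χ
  let _ := X.presheaf.algebra_section_stalk ⟨x p, hpV⟩
  let _ := X.presheaf.algebra_section_stalk ⟨x p, hxV'⟩
  have hlocV := hV.isLocalization_stalk ⟨x p, hpV⟩
  have hlocV' := hV'.isLocalization_stalk ⟨x p, hxV'⟩
  have hmem : ∀ {W : X.Opens} (hW : IsAffineOpen W) (hxW : x p ∈ W) (a : Γ(X, W)),
      a ∈ (hW.primeIdealOf ⟨x p, hxW⟩).asIdeal ↔ evalAt x W (top_le_preimage x hxW) a = 0 := by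
    intro W hW hxW a
    let _ := X.presheaf.algebra_section_stalk ⟨x p, hxW⟩
    have := hW.isLocalization_stalk ⟨x p, hxW⟩
    rw [← not_iff_not, ← ne_eq, evalAt_ne_zero_iff x W _ a p, Scheme.mem_basicOpen X a (x p) hxW]
    exact (IsLocalization.AtPrime.isUnit_to_map_iff (X.presheaf.stalk (x p))
      (hW.primeIdealOf ⟨x p, hxW⟩).asIdeal a).symm
  have hker : RingHom.ker χ = (hV'.primeIdealOf ⟨x p, hxV'⟩).asIdeal := by
    ext a
    rw [hmem, RingHom.mem_ker]
    exact (map_eq_zero_iff (Scheme.ΓSpecIso (.of ℂ)).commRingCatIsoToRingEquiv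
      (RingEquiv.injective _)).symm
  have hsm : Smooth f := SmoothOfRelativeDimension.smooth 1 f
  have hnoeth : IsNoetherianRing Γ(X, V') :=
    have := LocallyOfFiniteType.isLocallyNoetherian f
    IsLocallyNoetherian.component_noetherian ⟨V', hV'⟩
  rw [hker] at hne hu hle
  obtain ⟨hne', v, hv, h⟩ := exists_local_generator (O := X.presheaf.stalk (x p))
    (hV.primeIdealOf ⟨x p, hpV⟩).asIdeal (hV'.primeIdealOf ⟨x p, hxV'⟩).asIdeal
    (IsNoetherian.noetherian _) hne hu hle
  refine ⟨fun h0 => hne' ?_, v, (hmem hV hpV v).1 hv, fun a ha => ?_⟩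
  · ext a
    rw [hmem, ← h0]
    rfl
  · obtain ⟨g, b, hg, hb⟩ := h a ((hmem hV hpV a).2 ha)
    exact ⟨g, b, fun h0 => hg ((hmem hV hpV g).2 h0), hb⟩

end Smooth

/-! ### Affine opens and parameters through finitely many points of the curve. -/

section Curve

/-- The constant functions on an open subset of a scheme over `ℂ`. -/
def constMap {X : Scheme.{0}} (f : X ⟶ Spec (.of ℂ)) (V : X.Opens) : ℂ →+* Γ(X, V) :=
  ((Scheme.ΓSpecIso (.of ℂ)).inv ≫ f.appLE ⊤ V le_top).hom

theorem evalAt_constMap {X : Scheme.{0}} (f : X ⟶ Spec (.of ℂ)) (x : Spec (.of ℂ) ⟶ X)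
    (hx : x ≫ f = 𝟙 _) (V : X.Opens) (hxV : ⊤ ≤ x ⁻¹ᵁ V) (c : ℂ) :
    evalAt x V hxV (constMap f V c) = c := by
  have h1 := Scheme.Hom.appLE_comp_appLE x f ⊤ V ⊤ le_top hxV
  have h2 : (x ≫ f).appLE ⊤ ⊤ le_top = 𝟙 _ := by
    rw [hx]
    exact (Scheme.Hom.appLE_eq_app (𝟙 (Spec (.of ℂ))) (U := ⊤)).trans (Scheme.Hom.id_app ⊤)
  have h3 := congr((Scheme.ΓSpecIso (.of ℂ)).hom ($(h1.trans h2) ((Scheme.ΓSpecIso (.of ℂ)).inv c)))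
  exact h3.trans congr($((Scheme.ΓSpecIso (.of ℂ)).inv_hom_id) c)

theorem appLE_constMap {X Y : Scheme.{0}} (f : X ⟶ Spec (.of ℂ)) (g : Y ⟶ Spec (.of ℂ)) (h : X ⟶ Y)
    (w : h ≫ g = f) (V : Y.Opens) (W : X.Opens) (e : W ≤ h ⁻¹ᵁ V) (c : ℂ) :
    h.appLE V W e (constMap g V c) = constMap f W c := by
  subst w
  have h1 := Scheme.Hom.appLE_comp_appLE h g ⊤ V W le_top e
  exact congr($h1 ((Scheme.ΓSpecIso (.of ℂ)).inv c))

theorem res_constMap {X : Scheme.{0}} (f : X ⟶ Spec (.of ℂ)) {V W : X.Opens} (e : W ≤ V) (c : ℂ) :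
    X.presheaf.map (homOfLE e).op (constMap f V c) = constMap f W c := by
  have h1 := Scheme.Hom.appLE_map f (U := ⊤) le_top (homOfLE e).op
  exact congr($h1 ((Scheme.ΓSpecIso (.of ℂ)).inv c))

-- Some linear form on projective space vanishes at none of the given points, because ℂ is infinite;
-- the complement of its hyperplane is affine and meets the closed curve in an affine open.
attribute [local instance] MvPolynomial.gradedAlgebra in
theorem exists_isAffineOpen_of_finite {C : SchC} (hC : IsSmoothProjectiveCurve C)
    {s : Set C.left} (hs : s.Finite) : ∃ V : C.left.Opens, IsAffineOpen V ∧ s ⊆ V := by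
  obtain ⟨n, i, hi⟩ := hC.projective
  let 𝒜 := MvPolynomial.homogeneousSubmodule (Fin (n + 1)) ℂ
  let j : C.left ⟶ Proj 𝒜 := i.left
  have hj : IsClosedImmersion j := hi
  have := hs.to_subtype
  let q : s → Submodule ℂ (𝒜 1) := fun x =>
    (Submodule.restrictScalars ℂ (j x).asHomogeneousIdeal.toIdeal).comap (𝒜 1).subtype
  have hq : ∀ x, q x ≠ ⊤ := by
    intro x htop
    -- If every linear form vanished at a point, its homogeneous prime would contain all variables
    -- and hence the irrelevant ideal.
    refine (j x).not_irrelevant_le fun a ha => ?_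
    have hX : ∀ l, (MvPolynomial.X l : MvPolynomial (Fin (n + 1)) ℂ) ∈
        (j x).asHomogeneousIdeal.toIdeal := fun l => by
      have h1 : (⟨MvPolynomial.X l, MvPolynomial.isHomogeneous_X ℂ l⟩ : 𝒜 1) ∈ q x :=
        htop ▸ trivial
      exact h1
    have h2 : Ideal.span (MvPolynomial.X '' (Set.univ : Set (Fin (n + 1)))) ≤
        (j x).asHomogeneousIdeal.toIdeal := by
      rw [Ideal.span_le]
      rintro _ ⟨l, -, rfl⟩
      exact hX l
    refine h2 (MvPolynomial.mem_ideal_span_X_image.2 fun m hm => ?_)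
    by_contra hcon
    push Not at hcon
    have hm0 : m = 0 := Finsupp.ext fun l => hcon l trivial
    rw [HomogeneousIdeal.mem_irrelevant_iff, GradedRing.proj_apply] at ha
    have h3 : MvPolynomial.homogeneousComponent 0 a = 0 := by
      rw [← ha]
      exact (MvPolynomial.decomposition.decompose'_apply a 0).symm
    rw [MvPolynomial.homogeneousComponent_zero] at h3
    have h4 : a.coeff 0 = 0 := by simpa using h3
    rw [hm0, MvPolynomial.mem_support_iff] at hm
    exact hm h4
  obtain ⟨l, hl⟩ : ∃ l : 𝒜 1, ∀ x, l ∉ q x := by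
    by_contra hcon
    push Not at hcon
    have hcov : ⋃ x, (q x : Set (𝒜 1)) = Set.univ := by
      ext x
      simpa using hcon x
    obtain ⟨x, hx⟩ := Subspace.exists_eq_top_of_iUnion_eq_univ hcov
    exact hq x hx
  refine ⟨j ⁻¹ᵁ Proj.basicOpen 𝒜 l.1,
    (Proj.isAffineOpen_basicOpen 𝒜 l.1 l.2 one_pos).preimage j, fun x hx => ?_⟩
  change j x ∈ Proj.basicOpen 𝒜 l.1
  rw [Proj.mem_basicOpen]
  exact hl ⟨x, hx⟩

/-- After shrinking to the locus where the common denominator `g` of `exists_parameter` is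
invertible, t minus its value divides every function vanishing at the corresponding point. -/
theorem exists_affine_parameter {C : SchC} (hC : IsSmoothProjectiveCurve C) {ι : Type} [Finite ι]
    [Nonempty ι] (x : ι → (Spec (.of ℂ) ⟶ C.left)) (hx : ∀ i, x i ≫ C.hom = 𝟙 _) :
    ∃ (V : C.left.Opens) (_ : IsAffineOpen V) (hxV : ∀ i, ⊤ ≤ x i ⁻¹ᵁ V) (t : Γ(C.left, V)),
      (@Transcendental ℂ _ _ _ (constMap C.hom V).toAlgebra t) ∧
      ∀ i a, evalAt (x i) V (hxV i) a = 0 →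
        ∃ b, a = (t - constMap C.hom V (evalAt (x i) V (hxV i) t)) * b := by
  have := hC.integral
  have := hC.smooth
  have : Smooth C.hom := SmoothOfRelativeDimension.smooth 1 C.hom
  let p : Spec (.of ℂ) := IsLocalRing.closedPoint ℂ
  obtain ⟨V₀, hV₀, hs⟩ := exists_isAffineOpen_of_finite hC (Set.finite_range fun i => x i p)
  have hxV₀ : ∀ i, ⊤ ≤ x i ⁻¹ᵁ V₀ := fun i => top_le_preimage (x i) (hs ⟨i, rfl⟩)
  have : Nonempty V₀ := ⟨⟨_, hs ⟨Classical.arbitrary ι, rfl⟩⟩⟩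
  have : IsNoetherianRing Γ(C.left, V₀) :=
    have := LocallyOfFiniteType.isLocallyNoetherian C.hom
    IsLocallyNoetherian.component_noetherian ⟨V₀, hV₀⟩
  let _ : Algebra ℂ Γ(C.left, V₀) := (constMap C.hom V₀).toAlgebra
  let χ : ι → (Γ(C.left, V₀) →ₐ[ℂ] ℂ) := fun i =>
    { evalAt (x i) V₀ (hxV₀ i) with
      commutes' := fun c => evalAt_constMap C.hom (x i) (hx i) V₀ (hxV₀ i) c }
  choose hne u hu0 hu using fun i => exists_generator_at_point C.hom (x i) (hx i) hV₀ (hxV₀ i)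
  obtain ⟨t, g, ht, hg, h⟩ := exists_parameter χ hne u hu hu0
  have hgV : C.left.basicOpen g ≤ V₀ := C.left.basicOpen_le g
  have hxg : ∀ i, x i p ∈ C.left.basicOpen g := fun i =>
    (evalAt_ne_zero_iff (x i) V₀ (hxV₀ i) g p).1 (hg i)
  have : Nonempty (C.left.basicOpen g) := ⟨⟨_, hxg (Classical.arbitrary ι)⟩⟩
  let r : Γ(C.left, V₀) →+* Γ(C.left, C.left.basicOpen g) :=
    (C.left.presheaf.map (homOfLE hgV).op).hom
  have hr : Function.Injective r := map_injective_of_isIntegral C.left (homOfLE hgV)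
  have hloc := hV₀.isLocalization_basicOpen g
  have hgu : IsUnit (r g) := IsLocalization.Away.algebraMap_isUnit (S := Γ(C.left, C.left.basicOpen g)) g
  refine ⟨C.left.basicOpen g, hV₀.basicOpen g, fun i => top_le_preimage (x i) (hxg i), r t, ?_, ?_⟩
  · let _ : Algebra ℂ Γ(C.left, C.left.basicOpen g) := (constMap C.hom _).toAlgebra
    let r' : Γ(C.left, V₀) →ₐ[ℂ] Γ(C.left, C.left.basicOpen g) :=
      { r with commutes' := fun c => res_constMap C.hom hgV c }
    intro halg
    exact ht ((isAlgebraic_algHom_iff r' hr).1 halg)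
  · intro i a ha
    obtain ⟨m, a₀, ha₀⟩ := IsLocalization.Away.surj g a
    have ha₀' : a * r g ^ m = r a₀ := ha₀
    have h1 : χ i a₀ = 0 := by
      have h2 := evalAt_res (x i) hgV (top_le_preimage (x i) (hxg i)) (hxV₀ i) a₀
      refine h2.symm.trans ?_
      refine (congrArg (evalAt (x i) _ _) ha₀'.symm).trans ?_
      rw [map_mul, ha, zero_mul]
    obtain ⟨b, hb⟩ := h i a₀ h1
    -- The exponent `m` clears the denominator of `a`; the extra factor is the `g` in the
    -- divisibility relation.
    obtain ⟨w, hw⟩ := (hgu.pow (m + 1)).exists_right_inv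
    refine ⟨r b * w, ?_⟩
    have h3 : evalAt (x i) _ (top_le_preimage (x i) (hxg i)) (r t) = χ i t :=
      evalAt_res (x i) hgV _ (hxV₀ i) t
    have h4 : constMap C.hom (C.left.basicOpen g) (χ i t) = r (algebraMap ℂ _ (χ i t)) :=
      (res_constMap C.hom hgV (χ i t)).symm
    rw [h3, h4, ← map_sub, ← mul_assoc, ← map_mul, ← hb, map_mul, ← ha₀']
    calc a = a * (r g ^ (m + 1) * w) := by rw [hw, mul_one]
      _ = _ := by ring

end Curve

/-! ### Morphisms to and from spectra of section rings. -/

section Affine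

variable {X Y : Scheme.{0}}

theorem fromSpec_appLE {V : X.Opens} (hV : IsAffineOpen V) :
    hV.fromSpec.appLE V ⊤ hV.fromSpec_preimage_self.ge = (Scheme.ΓSpecIso Γ(X, V)).inv := by
  rw [Scheme.Hom.appLE, hV.fromSpec_app_self, Category.assoc, ← Functor.map_comp]
  exact (congrArg _ ((Spec Γ(X, V)).presheaf.map_id _)).trans (Category.comp_id _)

theorem preimage_comp_fromSpec {R : CommRingCat.{0}} {V : X.Opens} (hV : IsAffineOpen V)
    (φ : Γ(X, V) ⟶ R) : ⊤ ≤ (Spec.map φ ≫ hV.fromSpec) ⁻¹ᵁ V := by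
  rw [Scheme.Hom.comp_preimage, hV.fromSpec_preimage_self]
  exact le_rfl

theorem comp_fromSpec_appLE {R : CommRingCat.{0}} {V : X.Opens} (hV : IsAffineOpen V)
    (φ : Γ(X, V) ⟶ R) :
    (Spec.map φ ≫ hV.fromSpec).appLE V ⊤ (preimage_comp_fromSpec hV φ) =
      φ ≫ (Scheme.ΓSpecIso R).inv := by
  rw [← Scheme.Hom.appLE_comp_appLE _ _ V ⊤ ⊤ hV.fromSpec_preimage_self.ge le_rfl, fromSpec_appLE,
    Scheme.ΓSpecIso_inv_naturality]
  exact congrArg _ (Scheme.Hom.appLE_eq_app (Spec.map φ))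

theorem toSpecΓ_appLE_fromSpec (f : X ⟶ Y) {V : Y.Opens} (hV : IsAffineOpen V) (W : X.Opens)
    (e : W ≤ f ⁻¹ᵁ V) : W.toSpecΓ ≫ Spec.map (f.appLE V W e) ≫ hV.fromSpec = W.ι ≫ f := by
  rw [Scheme.Opens.toSpecΓ_SpecMap_appLE_assoc, hV.toSpecΓ_fromSpec, Scheme.Hom.resLE_comp_ι]

theorem comp_eq_SpecMap (f : X ⟶ Spec (.of ℂ)) {V : X.Opens} (hV : IsAffineOpen V) :
    hV.fromSpec ≫ f = Spec.map (CommRingCat.ofHom (constMap f V)) := by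
  apply ext_of_isAffine
  have h1 := Scheme.Hom.appLE_comp_appLE hV.fromSpec f ⊤ V ⊤ le_top hV.fromSpec_preimage_self.ge
  rw [fromSpec_appLE] at h1
  rw [Scheme.Hom.appTop, ← Scheme.Hom.appLE_eq_app]
  refine h1.symm.trans ?_
  have h2 := Scheme.ΓSpecIso_inv_naturality (CommRingCat.ofHom (constMap f V))
  have h3 : CommRingCat.ofHom (constMap f V) =
    (Scheme.ΓSpecIso (.of ℂ)).inv ≫ f.appLE ⊤ V le_top := rfl
  rw [← cancel_epi (Scheme.ΓSpecIso (.of ℂ)).inv, ← h2, h3, Category.assoc]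
  rfl

theorem toSpecΓ_constMap (f : X ⟶ Spec (.of ℂ)) (W : X.Opens) :
    W.toSpecΓ ≫ Spec.map (CommRingCat.ofHom (constMap f W)) = W.ι ≫ f := by
  have h1 := Scheme.Opens.toSpecΓ_SpecMap_appLE f ⊤ W le_top
  have h2 : Spec.map (CommRingCat.ofHom (constMap f W)) =
      Spec.map (f.appLE ⊤ W le_top) ≫ Spec.map (Scheme.ΓSpecIso (.of ℂ)).inv := by
    rw [← Spec.map_comp]
    rfl
  rw [h2, ← Category.assoc]
  refine (congrArg (· ≫ _) h1).trans ?_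
  rw [Scheme.Opens.toSpecΓ_top, Category.assoc, Category.assoc]
  refine (congrArg (fun z => _ ≫ _ ≫ z) (toSpecΓ_SpecMap_ΓSpecIso_inv (.of ℂ))).trans ?_
  rw [Category.comp_id]
  exact Scheme.Hom.resLE_comp_ι f _

theorem topIso_inv_appTop {W : Y.Opens} (s : X ⟶ W.toScheme) (f : X ⟶ Y) (hs : s ≫ W.ι = f)
    (e : ⊤ ≤ f ⁻¹ᵁ W) : W.topIso.inv ≫ s.appTop = f.appLE W ⊤ e := by
  subst hs
  have h1 := Scheme.Hom.appLE_comp_appLE s W.ι W ⊤ ⊤ W.ι_preimage_self.ge le_rfl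
  have h2 : W.ι.appLE W ⊤ W.ι_preimage_self.ge = W.topIso.inv := by
    rw [Scheme.Opens.ι_appLE]
    rfl
  rw [h2] at h1
  exact (congrArg (W.topIso.inv ≫ ·) (Scheme.Hom.appLE_eq_app s).symm).trans h1

end Affine

/-- The ring `R` is made a ℂ-algebra through `f`; agreement on constants makes `g` an algebra map as
well, so the universal property of the tensor power applies. -/
theorem piTensor_ringHom_ext {k : ℕ} {A R : Type} [CommRing A] [Algebra ℂ A] [CommRing R]
    {f g : (⨂[ℂ] _ : Fin k, A) →+* R} (hc : ∀ c, f (algebraMap ℂ _ c) = g (algebraMap ℂ _ c))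
    (hs : ∀ i a, f (PiTensorProduct.singleAlgHom (R := ℂ) (A := fun _ : Fin k => A) i a) =
      g (PiTensorProduct.singleAlgHom (R := ℂ) (A := fun _ : Fin k => A) i a)) : f = g := by
  let _ : Algebra ℂ R := (f.comp (algebraMap ℂ _)).toAlgebra
  let f' : (⨂[ℂ] _ : Fin k, A) →ₐ[ℂ] R := { f with commutes' := fun _ => rfl }
  let g' : (⨂[ℂ] _ : Fin k, A) →ₐ[ℂ] R := { g with commutes' := fun c => (hc c).symm }
  have h : f' = g' := PiTensorProduct.algHom_ext fun i => AlgHom.ext fun a => hs i a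
  exact RingHom.ext fun x => DFunLike.congr_fun h x

/-! ### Affine opens V^k of C^k and their functions. -/

section Power

variable (C : SchC) (k : ℕ)

/-- The projection `C^k ⟶ C` onto the `i`-th factor. -/
abbrev powerProj (i : Fin k) : (power C k).left ⟶ C.left := (Pi.π (fun _ : Fin k => C) i).left

theorem powerProj_hom (i : Fin k) : powerProj C k i ≫ C.hom = (power C k).hom :=
  Over.w (Pi.π (fun _ : Fin k => C) i)

variable {C}

/-- The open subset `V^k` of `C^k`. -/
def powerOpen (V : C.left.Opens) : (power C k).left.Opens :=
  ⟨⋂ i, (powerProj C k i ⁻¹ᵁ V : (power C k).left.Opens),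
    isOpen_iInter_of_finite fun i => (powerProj C k i ⁻¹ᵁ V).isOpen⟩

variable {k}

theorem mem_powerOpen {V : C.left.Opens} {x : (power C k).left} :
    x ∈ powerOpen k V ↔ ∀ i, powerProj C k i x ∈ V := Set.mem_iInter

theorem powerOpen_le (V : C.left.Opens) (i : Fin k) : powerOpen k V ≤ powerProj C k i ⁻¹ᵁ V :=
  fun _ hx => mem_powerOpen.1 hx i

/-- Pullback of functions along the projection `V^k ⟶ V` onto the `i`-th factor. -/
def powerPull (V : C.left.Opens) (i : Fin k) : Γ(C.left, V) →+* Γ((power C k).left, powerOpen k V) :=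
  ((powerProj C k i).appLE V (powerOpen k V) (powerOpen_le V i)).hom

theorem powerPull_constMap (V : C.left.Opens) (i : Fin k) (c : ℂ) :
    powerPull V i (constMap C.hom V c) = constMap (power C k).hom (powerOpen k V) c :=
  appLE_constMap _ _ _ (powerProj_hom C k i) _ _ _ c

section

variable (V : C.left.Opens)

local instance instAlgebraCurve : Algebra ℂ Γ(C.left, V) := (constMap C.hom V).toAlgebra

local instance instAlgebraPower : Algebra ℂ Γ((power C k).left, powerOpen k V) :=
  (constMap (power C k).hom (powerOpen k V)).toAlgebra

/-- The homomorphism `𝒪(V)^{⊗k} ⟶ 𝒪(V^k)`. -/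
def powerTensor : (⨂[ℂ] _ : Fin k, Γ(C.left, V)) →ₐ[ℂ] Γ((power C k).left, powerOpen k V) :=
  PiTensorProduct.liftAlgHom
    ((MultilinearMap.mkPiAlgebra ℂ (Fin k) Γ((power C k).left, powerOpen k V)).compLinearMap
      fun i => (AlgHom.mk (powerPull V i) (powerPull_constMap V i)).toLinearMap)
    (by simp) (fun x y => by simp [Finset.prod_mul_distrib])

theorem powerTensor_tprod (a : Fin k → Γ(C.left, V)) :
    powerTensor V (PiTensorProduct.tprod ℂ a) = ∏ i, powerPull V i (a i) := by
  refine (PiTensorProduct.lift.tprod a).trans ?_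
  rfl

theorem powerTensor_single (i : Fin k) (a : Γ(C.left, V)) :
    powerTensor V (PiTensorProduct.singleAlgHom (R := ℂ) (A := fun _ : Fin k => Γ(C.left, V)) i a) =
      powerPull V i a := by
  rw [PiTensorProduct.singleAlgHom_apply, powerTensor_tprod, Finset.prod_eq_single i]
  · simp
  · intro j _ hj
    simp [hj]
  · simp

variable {V}

/-- Both objects have the universal property of a k-fold product: the k maps 𝒪(V) → 𝒪(V)^{⊗k} give a
morphism from the spectrum to C^k, landing in V^k. Working with `toSpecΓ` lets affineness of V^k
come out as a consequence. -/
theorem exists_inverse_powerTensor (hV : IsAffineOpen V) :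
    ∃ s : Spec (.of (⨂[ℂ] _ : Fin k, Γ(C.left, V))) ⟶ (powerOpen k V).toScheme,
      (powerOpen k V).toSpecΓ ≫ Spec.map (CommRingCat.ofHom (powerTensor V).toRingHom) ≫ s = 𝟙 _ ∧
      s ≫ (powerOpen k V).toSpecΓ ≫ Spec.map (CommRingCat.ofHom (powerTensor V).toRingHom) = 𝟙 _ := by
  let B := ⨂[ℂ] _ : Fin k, Γ(C.left, V)
  let ζ : Fin k → (Γ(C.left, V) ⟶ .of B) := fun i => CommRingCat.ofHom
    (PiTensorProduct.singleAlgHom (R := ℂ) (A := fun _ : Fin k => Γ(C.left, V)) i).toRingHom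
  let T : SchC := Over.mk (Spec.map (CommRingCat.ofHom (algebraMap ℂ B)))
  have hζ : ∀ i, CommRingCat.ofHom (constMap C.hom V) ≫ ζ i = CommRingCat.ofHom (algebraMap ℂ B) :=
    fun i => CommRingCat.hom_ext (RingHom.ext fun c => (PiTensorProduct.singleAlgHom (R := ℂ)
      (A := fun _ : Fin k => Γ(C.left, V)) i).commutes c)
  let τ : Fin k → (T ⟶ C) := fun i => Over.homMk (Spec.map (ζ i) ≫ hV.fromSpec) (by
    change (Spec.map (ζ i) ≫ hV.fromSpec) ≫ C.hom = Spec.map (CommRingCat.ofHom (algebraMap ℂ B))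
    rw [Category.assoc, comp_eq_SpecMap, ← Spec.map_comp, hζ])
  let s₀ : T ⟶ power C k := Pi.lift τ
  have hs₀ : ∀ i, s₀.left ≫ powerProj C k i = Spec.map (ζ i) ≫ hV.fromSpec := fun i => by
    rw [← Over.comp_left]
    exact congrArg Over.Hom.left (Pi.lift_π τ i)
  have hrange : ⊤ ≤ s₀.left ⁻¹ᵁ powerOpen k V := by
    intro x _
    refine mem_powerOpen.2 fun i => ?_
    have h1 := preimage_comp_fromSpec hV (ζ i) (x := x) trivial
    rw [← hs₀] at h1
    exact h1
  let s : Spec (.of B) ⟶ (powerOpen k V).toScheme := IsOpenImmersion.lift (powerOpen k V).ι s₀.left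
    (by
      rw [Scheme.Opens.range_ι]
      rintro _ ⟨x, rfl⟩
      exact hrange (x := x) trivial)
  have hs : s ≫ (powerOpen k V).ι = s₀.left := IsOpenImmersion.lift_fac _ _ _
  let θ : CommRingCat.of B ⟶ Γ((power C k).left, powerOpen k V) :=
    CommRingCat.ofHom (powerTensor V).toRingHom
  have hζθ : ∀ i, ζ i ≫ θ = (powerProj C k i).appLE V (powerOpen k V) (powerOpen_le V i) :=
    fun i => CommRingCat.hom_ext (RingHom.ext fun a => powerTensor_single V i a)
  have hθ : CommRingCat.ofHom (algebraMap ℂ B) ≫ θ =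
      CommRingCat.ofHom (constMap (power C k).hom (powerOpen k V)) :=
    CommRingCat.hom_ext (RingHom.ext fun c => (powerTensor V).commutes c)
  refine ⟨s, ?_, ?_⟩
  · rw [← cancel_mono (powerOpen k V).ι, Category.id_comp, Category.assoc, Category.assoc, hs]
    let W : SchC := Over.mk ((powerOpen k V).ι ≫ (power C k).hom)
    let m₁ : W ⟶ power C k := Over.homMk ((powerOpen k V).toSpecΓ ≫ Spec.map θ ≫ s₀.left) (by
      have h1 : s₀.left ≫ (power C k).hom = Spec.map (CommRingCat.ofHom (algebraMap ℂ B)) :=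
        Over.w s₀
      rw [Category.assoc, Category.assoc, h1, ← Spec.map_comp, hθ, toSpecΓ_constMap]
      rfl)
    let m₂ : W ⟶ power C k := Over.homMk (powerOpen k V).ι
    -- Morphisms to C^k are compared on each projection, as morphisms over ℂ.
    have h2 : m₁ = m₂ := by
      refine Limits.Pi.hom_ext _ _ fun i => Over.OverMorphism.ext ?_
      change ((powerOpen k V).toSpecΓ ≫ Spec.map θ ≫ s₀.left) ≫ powerProj C k i =
        (powerOpen k V).ι ≫ powerProj C k i
      rw [Category.assoc, Category.assoc, hs₀, ← Spec.map_comp_assoc, hζθ, toSpecΓ_appLE_fromSpec]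
    exact congrArg Over.Hom.left h2
  -- On the affine side it suffices to compare ring maps on constants and on each tensor factor.
  · have h1 : θ ≫ s₀.left.appLE (powerOpen k V) ⊤ hrange = (Scheme.ΓSpecIso (.of B)).inv := by
      have hsi : ∀ i, ζ i ≫ θ ≫ s₀.left.appLE (powerOpen k V) ⊤ hrange =
          ζ i ≫ (Scheme.ΓSpecIso (.of B)).inv := by
        intro i
        rw [← Category.assoc, hζθ, Scheme.Hom.appLE_comp_appLE, ← comp_fromSpec_appLE hV (ζ i)]
        congr 1
        exact hs₀ i
      refine CommRingCat.hom_ext (piTensor_ringHom_ext (fun c => ?_) fun i a => congr($(hsi i) a))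
      have hc : constMap (power C k).hom (powerOpen k V) c = θ (algebraMap ℂ B c) :=
        congr($(hθ.symm) c)
      have h2 := appLE_constMap T.hom (power C k).hom s₀.left (Over.w s₀) (powerOpen k V) ⊤ hrange c
      rw [hc] at h2
      refine h2.trans ?_
      have h3 := Scheme.ΓSpecIso_inv_naturality (CommRingCat.ofHom (algebraMap ℂ B))
      refine Eq.trans ?_ congr($(h3.symm) c)
      exact congr($(Scheme.Hom.appLE_eq_app (Spec.map (CommRingCat.ofHom (algebraMap ℂ B))))
        ((Scheme.ΓSpecIso (.of ℂ)).inv c))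
    have h2 := topIso_inv_appTop s s₀.left hs hrange
    apply ext_of_isAffine
    rw [Scheme.Hom.comp_appTop, Scheme.Hom.comp_appTop, Scheme.Opens.toSpecΓ_appTop]
    have h4 := Scheme.ΓSpecIso_naturality θ
    rw [← Category.assoc, h4, Category.assoc, Category.assoc, h2, h1]
    exact Iso.hom_inv_id _

theorem isAffineOpen_powerOpen (hV : IsAffineOpen V) : IsAffineOpen (powerOpen k V) := by
  obtain ⟨s, h1, h2⟩ := exists_inverse_powerTensor (k := k) hV
  let e : (powerOpen k V).toScheme ≅ Spec (.of (⨂[ℂ] _ : Fin k, Γ(C.left, V))) :=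
    ⟨(powerOpen k V).toSpecΓ ≫ Spec.map (CommRingCat.ofHom (powerTensor V).toRingHom), s,
      by rw [Category.assoc, h1], h2⟩
  have := e.isIso_hom
  exact IsAffine.of_isIso e.hom

theorem powerTensor_bijective (hV : IsAffineOpen V) :
    Function.Bijective (powerTensor (k := k) V) := by
  obtain ⟨s, h1, h2⟩ := exists_inverse_powerTensor (k := k) hV
  have : IsIso (powerOpen k V).toSpecΓ :=
    (isAffineOpen_powerOpen hV).isoSpec.isIso_hom
  let θ := CommRingCat.ofHom (powerTensor (k := k) V).toRingHom
  have h3 : IsIso ((powerOpen k V).toSpecΓ ≫ Spec.map θ) :=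
    ⟨s, by rw [Category.assoc, h1], h2⟩
  have h4 : IsIso (Spec.map θ) := IsIso.of_isIso_comp_left (powerOpen k V).toSpecΓ _
  exact isIso_SpecMap_iff.1 h4

/-- The scalar in front of a pure tensor is absorbed into the factor of index 0, which is where `k ≠
0` enters. -/
theorem closure_powerPull_eq_top [NeZero k] (hV : IsAffineOpen V) :
    AddSubgroup.closure {y | ∃ a : Fin k → Γ(C.left, V), ∏ i, powerPull V i (a i) = y} = ⊤ := by
  refine top_le_iff.1 fun y _ => ?_
  obtain ⟨x, rfl⟩ := (powerTensor_bijective hV).2 y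
  induction x using PiTensorProduct.induction_on with
  | smul_tprod r a =>
    refine AddSubgroup.subset_closure ⟨Function.update a 0 (r • a 0), ?_⟩
    rw [← powerTensor_tprod, MultilinearMap.map_update_smul, Function.update_eq_self]
  | add x y hx hy =>
    rw [map_add]
    exact add_mem (hx trivial) (hy trivial)

theorem powerPull_sub_mem_nonZeroDivisors [IsIntegral C.left] [Nonempty V] (hV : IsAffineOpen V)
    {t : Γ(C.left, V)} (ht : Transcendental ℂ t) {i j : Fin k} (hij : i ≠ j) :
    powerPull V i t - powerPull V j t ∈ nonZeroDivisors Γ((power C k).left, powerOpen k V) := by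
  let e := AlgEquiv.ofBijective (powerTensor (k := k) V) (powerTensor_bijective hV)
  have h1 := singleAlgHom_sub_mem_nonZeroDivisors (k := k) ht hij
  have h2 := (MulEquivClass.map_nonZeroDivisors e).le (Submonoid.mem_map_of_mem _ h1)
  rw [← powerTensor_single, ← powerTensor_single, ← map_sub]
  exact h2

end

end Power

/-! ### Integrality and surjectivity of quotient maps. -/

section Quotient

/-- Every `x` is a root of the product of X − ρ(σ)x over the group, whose coefficients are
invariant. -/
theorem isIntegral_of_invariants {R P G : Type} [CommRing R] [CommRing P] [Group G] [Finite G]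
    (φ : R →+* P) (ρ : G → (P →+* P)) (hone : ∀ x, ρ 1 x = x)
    (hmul : ∀ σ τ x, ρ σ (ρ τ x) = ρ (σ * τ) x) (hinv : ∀ x, (∀ σ, ρ σ x = x) → ∃ r, φ r = x) :
    φ.IsIntegral := by
  cases nonempty_fintype G
  intro x
  rcases subsingleton_or_nontrivial P with hP | hP
  · exact ⟨1, Polynomial.monic_one, Subsingleton.elim _ _⟩
  let F : Polynomial P := ∏ σ, (Polynomial.X - Polynomial.C (ρ σ x))
  have hF : F.Monic := Polynomial.monic_prod_of_monic _ _ fun σ _ => Polynomial.monic_X_sub_C _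
  have hFρ : ∀ τ, F.map (ρ τ) = F := by
    intro τ
    rw [Polynomial.map_prod]
    refine Fintype.prod_equiv (Equiv.mulLeft τ) _ _ fun σ => ?_
    simp [hmul]
  have hlift : F ∈ Polynomial.lifts φ := by
    rw [Polynomial.lifts_iff_coeff_lifts]
    intro n
    refine hinv _ fun τ => ?_
    conv_rhs => rw [← hFρ τ]
    rw [Polynomial.coeff_map]
  obtain ⟨q, hq, -, hmon⟩ := Polynomial.lifts_and_natDegree_eq_and_monic hlift hF
  refine ⟨q, hmon, ?_⟩
  rw [Polynomial.eval₂_eq_eval_map, hq, Polynomial.eval_prod]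
  exact Finset.prod_eq_zero (Finset.mem_univ 1) (by simp [hone])

variable {X Y : Scheme.{0}} {G : Type} {ρ : G → (X ⟶ X)} {π : X ⟶ Y}

theorem IsQuotient.preimage_le (h : IsQuotient ρ π) (U : Y.Opens) (g : G) :
    π ⁻¹ᵁ U ≤ ρ g ⁻¹ᵁ π ⁻¹ᵁ U := by
  rw [← Scheme.Hom.comp_preimage, h.invariant]

theorem IsQuotient.isIntegralHom [Group G] [Finite G] (h : IsQuotient ρ π) (hone : ρ 1 = 𝟙 X)
    (hmul : ∀ σ τ, ρ σ ≫ ρ τ = ρ (σ * τ)) : IsIntegralHom π where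
  toIsAffineHom := h.affine
  isIntegral_app U hU := by
    refine isIntegral_of_invariants _
      (fun g => ((ρ g).appLE (π ⁻¹ᵁ U) (π ⁻¹ᵁ U) (h.preimage_le U g)).hom) (fun x => ?_)
      (fun σ τ x => ?_) fun x hx => h.surjective U x fun g _ => hx g
    · have h1 : (ρ 1).appLE (π ⁻¹ᵁ U) (π ⁻¹ᵁ U) (h.preimage_le U 1) = 𝟙 _ := by
        have h2 : ∀ (f : X ⟶ X) (hf : f = 𝟙 X) (e : π ⁻¹ᵁ U ≤ f ⁻¹ᵁ π ⁻¹ᵁ U),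
            f.appLE (π ⁻¹ᵁ U) (π ⁻¹ᵁ U) e = 𝟙 _ := by
          rintro _ rfl e
          exact (Scheme.Hom.appLE_eq_app (𝟙 X)).trans (Scheme.Hom.id_app _)
        exact h2 _ hone _
      exact congr($h1 x)
    · have h1 := Scheme.Hom.appLE_comp_appLE (ρ σ) (ρ τ) (π ⁻¹ᵁ U) (π ⁻¹ᵁ U) (π ⁻¹ᵁ U)
        (h.preimage_le U τ) (h.preimage_le U σ)
      have h2 : ∀ (f g : X ⟶ X) (hf : f = g) (e : π ⁻¹ᵁ U ≤ f ⁻¹ᵁ π ⁻¹ᵁ U)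
          (e' : π ⁻¹ᵁ U ≤ g ⁻¹ᵁ π ⁻¹ᵁ U), f.appLE (π ⁻¹ᵁ U) (π ⁻¹ᵁ U) e =
            g.appLE (π ⁻¹ᵁ U) (π ⁻¹ᵁ U) e' := by
        rintro f _ rfl e e'
        rfl
      exact congr($(h1.trans (h2 _ _ (hmul σ τ) _ (h.preimage_le U _))) x)

theorem eq_bot_of_subsingleton (U : Y.Opens) [Subsingleton Γ(Y, U)] : U = ⊥ := by
  have h1 : Y.basicOpen (1 : Γ(Y, U)) = U := Scheme.basicOpen_of_isUnit _ isUnit_one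
  rw [Subsingleton.elim (1 : Γ(Y, U)) 0, Scheme.basicOpen_zero] at h1
  exact h1.symm

/-- Functions on the complement of the closed image inject into functions on the empty set, so that
complement has zero ring of functions and is empty. -/
theorem surjective_of_app_injective (hπ : ∀ U : Y.Opens, Function.Injective (π.app U))
    (hc : IsClosed (Set.range π)) : Function.Surjective π := by
  let U : Y.Opens := ⟨(Set.range π)ᶜ, hc.isOpen_compl⟩
  have h1 : π ⁻¹ᵁ U = ⊥ := by
    ext x
    simp [U]
  have : Subsingleton Γ(X, π ⁻¹ᵁ U) := by
    rw [h1]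
    infer_instance
  have : Subsingleton Γ(Y, U) := (hπ U).subsingleton
  have h2 := eq_bot_of_subsingleton U
  intro y
  by_contra hy
  have h3 : y ∈ U := hy
  rw [h2] at h3
  exact h3

theorem IsQuotient.surjective_base [IsIntegralHom π] (h : IsQuotient ρ π) :
    Function.Surjective π :=
  surjective_of_app_injective h.injective π.isClosedMap.isClosed_range

end Quotient

/-! ### Finiteness of C^k → C_k. -/

section Curve

theorem finiteType_constMap {X : Scheme.{0}} (f : X ⟶ Spec (.of ℂ)) [LocallyOfFiniteType f]
    {V : X.Opens} (hV : IsAffineOpen V) : (constMap f V).FiniteType := by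
  have h1 := f.finiteType_appLE (isAffineOpen_top _) hV le_top
  have h2 : ((Scheme.ΓSpecIso (.of ℂ)).inv.hom).FiniteType :=
    RingHom.FiniteType.of_surjective _ (ConcreteCategory.bijective_of_isIso
      (Scheme.ΓSpecIso (.of ℂ)).inv).2
  exact h1.comp h2

theorem finiteType_piTensorProduct {K A : Type} [Field K] [CommRing A] [Algebra K A]
    [Algebra.FiniteType K A] (k : ℕ) : Algebra.FiniteType K (⨂[K] _ : Fin k, A) := by
  classical
  obtain ⟨s, hs⟩ := Algebra.FiniteType.out (R := K) (A := A)
  let ζ : Fin k → (A →ₐ[K] ⨂[K] _ : Fin k, A) := fun i =>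
    PiTensorProduct.singleAlgHom (R := K) (A := fun _ : Fin k => A) i
  refine ⟨⟨Finset.univ.biUnion fun i => s.image (ζ i), top_le_iff.1 fun x _ => ?_⟩⟩
  let B := Algebra.adjoin K
    (↑(Finset.univ.biUnion fun i => s.image (ζ i)) : Set (⨂[K] _ : Fin k, A))
  have h1 : ∀ i a, ζ i a ∈ B := by
    intro i a
    have h2 : (⊤ : Subalgebra K A) ≤ B.comap (ζ i) := by
      rw [← hs]
      refine Algebra.adjoin_le fun b hb => Algebra.subset_adjoin ?_
      simp only [Finset.coe_biUnion, Set.mem_iUnion, Finset.coe_image]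
      exact ⟨i, Finset.mem_coe.2 (Finset.mem_univ i), b, hb, rfl⟩
    exact h2 trivial
  induction x using PiTensorProduct.induction_on with
  | smul_tprod r a =>
    have h3 : PiTensorProduct.tprod K a = ∏ i, ζ i (a i) := by
      simp only [ζ, PiTensorProduct.singleAlgHom_apply]
      rw [← PiTensorProduct.tprod_prod]
      congr 1
      funext j
      rw [Finset.prod_apply, Finset.prod_eq_single j]
      · simp
      · intro i _ hij
        simp [hij.symm]
      · simp
    rw [h3]
    exact B.smul_mem (B.prod_mem fun i _ => h1 i (a i)) r
  | add x y hx hy => exact B.add_mem (hx trivial) (hy trivial)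

variable {C : SchC} (hC : IsSmoothProjectiveCurve C) {k : ℕ}
include hC

theorem IsSmoothProjectiveCurve.locallyOfFiniteType : LocallyOfFiniteType C.hom := by
  have := hC.smooth
  have : Smooth C.hom := SmoothOfRelativeDimension.smooth 1 C.hom
  infer_instance

attribute [local instance] MvPolynomial.gradedAlgebra in
theorem IsSmoothProjectiveCurve.isSeparated : IsSeparated C.hom := by
  obtain ⟨n, i, hi⟩ := hC.projective
  have h1 : i.left ≫ projStr n = C.hom := Over.w i
  rw [← h1]
  have : IsSeparated (projStr n) := by
    unfold projStr
    infer_instance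
  infer_instance

theorem exists_mem_powerOpen {s : Set (power C k).left} (hs : s.Finite) :
    ∃ V : C.left.Opens, IsAffineOpen V ∧ s ⊆ powerOpen k V := by
  obtain ⟨V, hV, hsV⟩ := exists_isAffineOpen_of_finite hC
    (Set.finite_iUnion fun i : Fin k => hs.image (powerProj C k i))
  exact ⟨V, hV, fun x hx => mem_powerOpen.2 fun i => hsV (Set.mem_iUnion.2 ⟨i, x, hx, rfl⟩)⟩

/-- Each point of C^k lies in some V^k with `V` affine, because its finitely many coordinates have a
common affine neighbourhood, and the ring of V^k is a quotient of a tensor power of 𝒪(V). -/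
theorem locallyOfFiniteType_power : LocallyOfFiniteType (power C k).hom := by
  have := hC.locallyOfFiniteType
  refine (HasRingHomProperty.iff_exists_appLE (P := @LocallyOfFiniteType)
    (RingHom.finiteType_stableUnderComposition.stableUnderCompositionWithLocalizationAway
      RingHom.finiteType_holdsForLocalizationAway).left).2 fun x => ?_
  obtain ⟨V, hV, hx⟩ := exists_mem_powerOpen hC (Set.finite_singleton x)
  refine ⟨⟨⊤, isAffineOpen_top _⟩, ⟨powerOpen k V, isAffineOpen_powerOpen hV⟩, hx rfl, le_top, ?_⟩
  refine RingHom.FiniteType.of_comp_finiteType (f := (Scheme.ΓSpecIso (.of ℂ)).inv.hom) ?_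
  let _ : Algebra ℂ Γ(C.left, V) := (constMap C.hom V).toAlgebra
  let _ : Algebra ℂ Γ((power C k).left, powerOpen k V) :=
    (constMap (power C k).hom (powerOpen k V)).toAlgebra
  have h1 : Algebra.FiniteType ℂ Γ(C.left, V) := finiteType_constMap C.hom hV
  have h2 := finiteType_piTensorProduct (K := ℂ) (A := Γ(C.left, V)) k
  exact Algebra.FiniteType.of_surjective (powerTensor V) (powerTensor_bijective hV).2

omit hC

theorem permute_one (k : ℕ) : permute C (1 : Equiv.Perm (Fin k)) = 𝟙 _ :=
  Limits.Pi.hom_ext _ _ fun i => by simp [permute]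

theorem permute_comp_permute (σ τ : Equiv.Perm (Fin k)) :
    permute C σ ≫ permute C τ = permute C (σ * τ) :=
  Limits.Pi.hom_ext _ _ fun i => by simp [permute]

theorem permute_powerProj (σ : Equiv.Perm (Fin k)) (i : Fin k) :
    (permute C σ).left ≫ powerProj C k i = powerProj C k (σ i) := by
  rw [← Over.comp_left]
  simp [permute]

variable {Ck : SchC} {π : power C k ⟶ Ck} (hπ : IsSymmetricProduct C π)
include hπ

theorem IsSymmetricProduct.isIntegralHom : IsIntegralHom π.left :=
  IsQuotient.isIntegralHom hπ (congrArg Over.Hom.left (permute_one k)) fun σ τ => by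
    rw [← Over.comp_left, permute_comp_permute]

theorem IsSymmetricProduct.surjective_base : Function.Surjective π.left :=
  have := hπ.isIntegralHom
  IsQuotient.surjective_base hπ

include hC

/-- Integrality comes from the group action, and finite type from that of C^k over ℂ. -/
theorem IsSymmetricProduct.isFinite : IsFinite π.left := by
  have := hπ.isIntegralHom
  have := locallyOfFiniteType_power hC (k := k)
  have h1 : π.left ≫ Ck.hom = (power C k).hom := Over.w π
  have : LocallyOfFiniteType (π.left ≫ Ck.hom) := by rwa [h1]
  have := locallyOfFiniteType_of_comp π.left Ck.hom
  exact (IsFinite.iff_isIntegralHom_and_locallyOfFiniteType _).2 ⟨inferInstance, inferInstance⟩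

end Curve

/-! ### Reduction to closed points. -/

section JacobsonPoints

/-- A property of points that holds on open sets and at the images of all closed points holds
everywhere. -/
theorem forall_of_forall_isClosed {X Y : Type} [TopologicalSpace X] [TopologicalSpace Y]
    [JacobsonSpace X] {f : X → Y} (hf : Continuous f) (hs : Function.Surjective f) {p : Y → Prop}
    (h : ∀ x : X, IsClosed {x} → ∃ U : Set Y, IsOpen U ∧ f x ∈ U ∧ ∀ y ∈ U, p y) (y : Y) : p y := by
  by_contra hy
  let B : Set Y := ⋃₀ {U | IsOpen U ∧ ∀ y ∈ U, p y}
  have hB : IsOpen B := isOpen_sUnion fun U hU => hU.1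
  have hyB : y ∉ B := by
    rintro ⟨U, ⟨-, hU⟩, hyU⟩
    exact hy (hU y hyU)
  obtain ⟨x, rfl⟩ := hs y
  have hcl : IsClosed (f ⁻¹' Bᶜ) := hB.isClosed_compl.preimage hf
  -- If the bad locus were nonempty, its closed preimage would contain a closed point of `X`, and
  -- `h` applies there.
  have h1 := JacobsonSpace.closure_inter_closedPoints hcl
  have hx : x ∈ closure (f ⁻¹' Bᶜ ∩ closedPoints X) := by
    rw [h1]
    exact hyB
  obtain ⟨z, -, hz, hzc⟩ := mem_closure_iff.1 hx Set.univ isOpen_univ trivial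
  obtain ⟨U, hU, hzU, hp⟩ := h z hzc
  exact hz ⟨U, ⟨hU, hp⟩, hzU⟩

end JacobsonPoints

/-! ### Prime avoidance on affine opens. -/

section Avoidance

variable {X : Scheme.{0}}

/-- The prime ideal of functions vanishing at a point. -/
def vanishingPrime (U : X.Opens) (x : X) (hx : x ∈ U) : Ideal Γ(X, U) :=
  (IsLocalRing.maximalIdeal (X.presheaf.stalk x)).comap (X.presheaf.germ U x hx).hom

theorem mem_vanishingPrime {U : X.Opens} {x : X} {hx : x ∈ U} {a : Γ(X, U)} :
    a ∈ vanishingPrime U x hx ↔ x ∉ X.basicOpen a := by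
  rw [Scheme.mem_basicOpen X a x hx]
  exact Iff.rfl

/-- The functions vanishing on `W` outside `O` form an ideal contained in none of the primes of the
given points, so prime avoidance finds one that is nonzero at all of them. -/
theorem IsAffineOpen.exists_basicOpen_of_finite {W : X.Opens} (hW : IsAffineOpen W) (O : X.Opens)
    {s : Set X} (hs : s.Finite) (hsW : s ⊆ W) (hsO : s ⊆ O) :
    ∃ g : Γ(X, W), X.basicOpen g ≤ O ∧ s ⊆ X.basicOpen g := by
  classical
  have := hs.fintype
  let p : s → Ideal Γ(X, W) := fun x => vanishingPrime W x (hsW x.2)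
  let I : Ideal Γ(X, W) := ⨅ (y : X) (hy : y ∈ W) (_ : y ∉ O), vanishingPrime W y hy
  have hI : ∀ g, g ∈ I ↔ X.basicOpen g ≤ O := by
    intro g
    simp only [I, Submodule.mem_iInf, mem_vanishingPrime]
    constructor
    · intro h y hy
      by_contra hyO
      exact h y (X.basicOpen_le g hy) hyO hy
    · intro h y _ hyO hyg
      exact hyO (h hyg)
  rcases isEmpty_or_nonempty s with hs0 | ⟨⟨a⟩⟩
  · exact ⟨0, by simp, fun x hx => (hs0.false ⟨x, hx⟩).elim⟩
  have h1 : ¬ ((I : Set Γ(X, W)) ⊆ ⋃ i ∈ (↑(Finset.univ : Finset s) : Set s), p i) := by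
    intro h
    obtain ⟨x, -, hx⟩ := (Ideal.subset_union_prime (f := p) a a
      fun i _ _ _ => Ideal.comap_isPrime _ _).1 h
    obtain ⟨g, hg, hxg⟩ := hW.exists_basicOpen_le (V := O) ⟨x, hsO x.2⟩ (hsW x.2)
    exact mem_vanishingPrime.1 (hx ((hI g).2 hg)) hxg
  obtain ⟨g, hgI, hg⟩ := Set.not_subset.1 h1
  simp only [Set.mem_iUnion, not_exists] at hg
  refine ⟨g, (hI g).1 hgI, fun x hx => ?_⟩
  by_contra hxg
  exact hg ⟨x, hx⟩ (by simp) (mem_vanishingPrime.2 hxg)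

end Avoidance

/-! ### Functions on products of affine opens. -/

section Product

variable (A B : SchC)

theorem isPullback_tensor :
    IsPullback (fst A B).left (snd A B).left A.hom B.hom := IsPullback.of_hasPullback A.hom B.hom

variable {A B}

/-- The open subset `V × N` of a product. -/
def prodOpen (V : A.left.Opens) (N : B.left.Opens) : (A ⊗ B).left.Opens :=
  (fst A B).left ⁻¹ᵁ V ⊓ (snd A B).left ⁻¹ᵁ N

theorem isAffineOpen_prodOpen {V : A.left.Opens} {N : B.left.Opens} (hV : IsAffineOpen V)
    (hN : IsAffineOpen N) : IsAffineOpen (prodOpen V N) := by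
  have : IsAffine _ := hV
  have : IsAffine _ := hN
  have h := Scheme.Hom.isPullback_resLE (isPullback_tensor A B) (US := ⊤) (UT := N) (UX := V)
    le_top le_top (UY := prodOpen V N) rfl
  have : IsAffine (⊤ : (Spec (.of ℂ)).Opens) := isAffineOpen_top (Spec (.of ℂ))
  exact .of_isIso h.isoPullback.hom

theorem closure_prodOpen {V : A.left.Opens} {N : B.left.Opens} (hV : IsAffineOpen V)
    (hN : IsAffineOpen N) : AddSubgroup.closure {x : Γ((A ⊗ B).left, prodOpen V N) |
      ∃ (r : Γ(B.left, N)) (a : Γ(A.left, V)),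
        x = (snd A B).left.appLE N (prodOpen V N) inf_le_right r *
          (fst A B).left.appLE V (prodOpen V N) inf_le_left a} = ⊤ := by
  have h1 := isIso_pushoutSection_of_isAffineOpen (isPullback_tensor A B) (US := ⊤) (UT := N)
    (UX := V) le_top le_top (UY := prodOpen V N) rfl (isAffineOpen_top _) hN hV
  have h2 := (isIso_pushoutSection_iff _ _ _ _).1 h1
  exact IsPushout.exists_sum_mul h2

end Product

/-! ### The universal divisor and its incidence diagrams. -/

section Divisor

variable {C : SchC} {k : ℕ} {Ck : SchC} (π : power C k ⟶ Ck) [NeZero k]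

/-- The morphism `C^k ⟶ 𝒟`, `(x₁, …, x_k) ↦ (x₁, x₁ + ⋯ + x_k)`. -/
def toDivisor : power C k ⟶ universalDivisor π :=
  Over.homMk (incidence π).left.toImage (by
    change (incidence π).left.toImage ≫ (incidence π).left.imageι ≫ (C ⊗ Ck).hom = _
    rw [Scheme.Hom.toImage_imageι_assoc]
    exact Over.w (incidence π))

theorem toDivisor_ι : toDivisor π ≫ universalDivisorι π = incidence π :=
  Over.OverMorphism.ext (Scheme.Hom.toImage_imageι _)

instance : Mono (universalDivisorι π) := by
  have : Mono (universalDivisorι π).left :=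
    inferInstanceAs (Mono (incidence π).left.imageι)
  exact Over.mono_of_mono_left _

/-- The projection `𝒟 ⟶ C_k`. -/
def divisorQ : universalDivisor π ⟶ Ck := universalDivisorι π ≫ snd C Ck

/-- The projection `𝒟 ⟶ C`. -/
def divisorP : universalDivisor π ⟶ C := universalDivisorι π ≫ fst C Ck

/-- The morphism `C^k ⟶ 𝒟`, `(x₁, …, x_k) ↦ (x_i, x₁ + ⋯ + x_k)`. -/
def divisorMap (i : Fin k) : power C k ⟶ universalDivisor π :=
  permute C (Equiv.swap 0 i) ≫ toDivisor π

theorem divisorMap_zero : divisorMap π 0 = toDivisor π := by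
  have h : Equiv.swap (0 : Fin k) 0 = 1 := Equiv.swap_self 0
  rw [divisorMap, h, permute_one, Category.id_comp]

variable {π} (hπ : IsSymmetricProduct C π)
include hπ

omit [NeZero k] in
theorem permute_comp (σ : Equiv.Perm (Fin k)) : permute C σ ≫ π = π :=
  Over.OverMorphism.ext (hπ.invariant σ)

theorem divisorMap_ι (i : Fin k) : divisorMap π i ≫ universalDivisorι π =
    lift (Pi.π (fun _ : Fin k => C) i) π := by
  rw [divisorMap, Category.assoc, toDivisor_ι, incidence, comp_lift, permute_comp hπ]
  simp [permute]

theorem divisorMap_q (i : Fin k) : divisorMap π i ≫ divisorQ π = π := by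
  rw [divisorQ, ← Category.assoc, divisorMap_ι hπ, lift_snd]

theorem divisorMap_p (i : Fin k) : divisorMap π i ≫ divisorP π = Pi.π (fun _ : Fin k => C) i := by
  rw [divisorP, ← Category.assoc, divisorMap_ι hπ, lift_fst]

theorem permute_divisorMap (σ : Equiv.Perm (Fin k)) (i : Fin k) :
    permute C σ ≫ divisorMap π (σ.symm i) = divisorMap π i := by
  rw [← cancel_mono (universalDivisorι π), Category.assoc, divisorMap_ι hπ, divisorMap_ι hπ,
    comp_lift, permute_comp hπ]
  simp [permute]

/-- The incidence diagram of `C^k ⟶ 𝒟 ⟶ C_k`. -/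
def baseIncidence : Incidence (power C k).left (universalDivisor π).left Ck.left C.left k where
  π := π.left
  q := (divisorQ π).left
  p := (divisorP π).left
  d i := (divisorMap π i).left
  pr i := powerProj C k i
  ρ σ := (permute C σ).left
  d_q i := congrArg Over.Hom.left (divisorMap_q hπ i)
  d_p i := congrArg Over.Hom.left (divisorMap_p hπ i)
  ρ_d σ i := congrArg Over.Hom.left (permute_divisorMap hπ σ i)
  ρ_pr σ i := by rw [permute_powerProj, Equiv.apply_symm_apply]
  ρ_π σ := hπ.invariant σ

variable (S : SchC)

/-- The incidence diagram of `C^k × S ⟶ 𝒟 × S ⟶ C_k × S`. -/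
def incidenceS : Incidence (power C k ⊗ S).left (universalDivisor π ⊗ S).left (Ck ⊗ S).left
    (C ⊗ S).left k where
  π := (π ▷ S).left
  q := (divisorQ π ▷ S).left
  p := (divisorP π ▷ S).left
  d i := (divisorMap π i ▷ S).left
  pr i := (projS C S i).left
  ρ σ := (permuteS C S σ).left
  d_q i := by rw [← Over.comp_left, ← comp_whiskerRight, divisorMap_q hπ]
  d_p i := by rw [← Over.comp_left, ← comp_whiskerRight, divisorMap_p hπ]; rfl
  ρ_d σ i := by rw [← Over.comp_left, permuteS, ← comp_whiskerRight, permute_divisorMap hπ]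
  ρ_pr σ i := permuteS_projS C S σ i
  ρ_π σ := permuteS_quotient S hπ σ

end Divisor

/-! ### Two topological lemmas. -/

section Topology

/-- The complement of the image of the closed set outside `W` is the required neighbourhood. -/
theorem exists_isOpen_of_isClosedMap {X Y : Type} [TopologicalSpace X] [TopologicalSpace Y]
    {f : X → Y} (hf : IsClosedMap f) {W : Set X} (hW : IsOpen W) {y : Y} (hy : f ⁻¹' {y} ⊆ W) :
    ∃ O : Set Y, IsOpen O ∧ y ∈ O ∧ f ⁻¹' O ⊆ W := by
  refine ⟨(f '' Wᶜ)ᶜ, (hf _ hW.isClosed_compl).isOpen_compl, ?_, ?_⟩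
  · rintro ⟨x, hx, rfl⟩
    exact hx (hy rfl)
  · intro x hx
    by_contra hxW
    exact hx ⟨x, hxW, rfl⟩

/-- In a Jacobson space the closed points are dense in the closed set `F`; as there are finitely
many, they already form a closed set and exhaust `F`. -/
theorem isClosed_singleton_of_finite {X : Type} [TopologicalSpace X] [JacobsonSpace X]
    {F : Set X} (hF : F.Finite) (hc : IsClosed F) {w : X} (hw : w ∈ F) : IsClosed {w} := by
  have h1 : IsClosed (F ∩ closedPoints X) := by
    have h2 : F ∩ closedPoints X = ⋃ x ∈ F ∩ closedPoints X, {x} :=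
      (Set.biUnion_of_singleton _).symm
    rw [h2]
    exact (hF.inter_of_left _).isClosed_biUnion fun x hx => hx.2
  have h3 := JacobsonSpace.closure_inter_closedPoints hc
  rw [h1.closure_eq] at h3
  rw [← h3] at hw
  exact hw.2

end Topology

theorem mem_basicOpen_prod {X : Scheme.{0}} {U : X.Opens} {ι : Type} [Fintype ι]
    (g : ι → Γ(X, U)) {x : X} (hx : x ∈ U) :
    x ∈ X.basicOpen (∏ i, g i) ↔ ∀ i, x ∈ X.basicOpen (g i) := by
  rw [Scheme.mem_basicOpen X _ x hx, map_prod, IsUnit.prod_univ_iff]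
  exact forall_congr' fun i => (Scheme.mem_basicOpen X _ x hx).symm

/-! ### Neighbourhoods in C_k adapted to an open V^k. -/

section Curve

variable {C : SchC} {k : ℕ} {Ck : SchC} {π : power C k ⟶ Ck}

theorem powerOpen_le_permute (V : C.left.Opens) (σ : Equiv.Perm (Fin k)) :
    powerOpen k V ≤ (permute C σ).left ⁻¹ᵁ powerOpen k V := by
  intro x hx
  refine mem_powerOpen.2 fun i => ?_
  rw [← Scheme.Hom.comp_apply, permute_powerProj]
  exact mem_powerOpen.1 hx _

variable (hπ : IsSymmetricProduct C π)
include hπ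

/-- The norm of a function cutting out a small neighbourhood of the fibre is invariant, so it
descends to C_k and becomes a unit on its nonvanishing locus N. Thus the functions on π⁻¹ N are
those on V^k with the norm inverted, the inverse coming from C_k. -/
theorem exists_isLocalization_away {V : C.left.Opens} (hV : IsAffineOpen V) {ξ : Ck.left}
    (hξ : π.left ⁻¹' {ξ} ⊆ (powerOpen k V : Set (power C k).left))
    (hfin : (π.left ⁻¹' {ξ}).Finite) :
    ∃ (N : Ck.left.Opens) (_ : IsAffineOpen N) (_ : ξ ∈ N) (h : π.left ⁻¹ᵁ N ≤ powerOpen k V)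
      (r : Γ((power C k).left, powerOpen k V)) (u : Γ(Ck.left, N)),
      IsUnit u ∧ π.left.app N u = (power C k).left.presheaf.map (homOfLE h).op r ∧
      @IsLocalization.Away _ _ r Γ((power C k).left, π.left ⁻¹ᵁ N) _
        ((power C k).left.presheaf.map (homOfLE h).op).hom.toAlgebra := by
  have := hπ.isIntegralHom
  obtain ⟨O, hO, hξO, hOW⟩ := exists_isOpen_of_isClosedMap π.left.isClosedMap
    (powerOpen k V).isOpen hξ
  obtain ⟨N₁, hN₁, hξN₁, hN₁O⟩ := exists_isAffineOpen_mem_and_subset (U := ⟨O, hO⟩) hξO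
  have hN₁W : π.left ⁻¹ᵁ N₁ ≤ powerOpen k V := fun x hx => hOW (hN₁O hx)
  obtain ⟨g, hgN, hgF⟩ := IsAffineOpen.exists_basicOpen_of_finite (isAffineOpen_powerOpen hV)
    (π.left ⁻¹ᵁ N₁) hfin hξ (fun x hx => by
      change π.left x ∈ N₁
      rwa [show π.left x = ξ from hx])
  let τ : Equiv.Perm (Fin k) → (Γ((power C k).left, powerOpen k V) →+*
      Γ((power C k).left, powerOpen k V)) := fun σ =>
    ((permute C σ).left.appLE _ _ (powerOpen_le_permute V σ)).hom
  have hτ : ∀ σ σ' a, τ σ (τ σ' a) = τ (σ * σ') a := by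
    intro σ σ' a
    have h1 := Scheme.Hom.appLE_comp_appLE (permute C σ).left (permute C σ').left _ _ _
      (powerOpen_le_permute V σ') (powerOpen_le_permute V σ)
    have h2 : (permute C σ).left ≫ (permute C σ').left = (permute C (σ * σ')).left := by
      rw [← Over.comp_left, permute_comp_permute]
    have h3 : ∀ (f g : (power C k).left ⟶ (power C k).left) (_ : f = g) (e e'),
        f.appLE (powerOpen k V) (powerOpen k V) e = g.appLE (powerOpen k V) (powerOpen k V) e' := by
      rintro f _ rfl _ _
      rfl
    exact congr($(h1.trans (h3 _ _ h2 _ _)) a)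
  have hD : ∀ σ (a : Γ((power C k).left, powerOpen k V)) x, x ∈ powerOpen k V →
      (x ∈ (power C k).left.basicOpen (τ σ a) ↔
        (permute C σ).left x ∈ (power C k).left.basicOpen a) := by
    intro σ a x hx
    have h1 := Scheme.basicOpen_appLE (permute C σ).left _ _ (powerOpen_le_permute V σ) a
    have h2 : (power C k).left.basicOpen (τ σ a) = powerOpen k V ⊓
      (permute C σ).left ⁻¹ᵁ (power C k).left.basicOpen a := h1
    rw [h2]
    exact ⟨fun h => h.2, fun h => ⟨hx, h⟩⟩
  let r : Γ((power C k).left, powerOpen k V) := ∏ σ, τ σ g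
  have hr : ∀ σ, τ σ r = r := by
    intro σ
    rw [map_prod]
    exact Fintype.prod_equiv (Equiv.mulLeft σ) _ _ fun σ' => hτ σ σ' g
  have hDr : ∀ x ∈ powerOpen k V, (x ∈ (power C k).left.basicOpen r ↔
      ∀ σ, (permute C σ).left x ∈ (power C k).left.basicOpen g) := fun x hx =>
    (mem_basicOpen_prod _ hx).trans (forall_congr' fun σ => hD σ g x hx)
  have hrN : (power C k).left.basicOpen r ≤ π.left ⁻¹ᵁ N₁ := by
    intro x hx
    have h1 := (hDr x ((power C k).left.basicOpen_le r hx)).1 hx 1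
    rw [permute_one] at h1
    exact hgN h1
  have hrF : π.left ⁻¹' {ξ} ⊆ ((power C k).left.basicOpen r : Set (power C k).left) := by
    intro x hx
    refine (hDr x (hξ hx)).2 fun σ => hgF ?_
    change π.left ((permute C σ).left x) = ξ
    rw [← Scheme.Hom.comp_apply, hπ.invariant]
    exact hx
  obtain ⟨r₁, hr₁⟩ := hπ.surjective N₁ ((power C k).left.presheaf.map (homOfLE hN₁W).op r) (by
    intro σ e
    have h1 := Scheme.Hom.appLE_map (permute C σ).left (powerOpen_le_permute V σ) (homOfLE hN₁W).op
    have h2 := Scheme.Hom.map_appLE (permute C σ).left e (homOfLE hN₁W).op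
    refine congr($(h2.trans h1.symm) r).trans ?_
    exact congrArg ((power C k).left.presheaf.map (homOfLE hN₁W).op) (hr σ))
  have hpre : π.left ⁻¹ᵁ Ck.left.basicOpen r₁ = (power C k).left.basicOpen r := by
    rw [Scheme.preimage_basicOpen, hr₁, Scheme.basicOpen_res]
    exact inf_eq_right.2 hrN
  have hle : π.left ⁻¹ᵁ Ck.left.basicOpen r₁ ≤ powerOpen k V :=
    hpre.le.trans ((power C k).left.basicOpen_le r)
  have hξ' : ξ ∈ Ck.left.basicOpen r₁ := by
    obtain ⟨x, rfl⟩ := hπ.surjective_base ξ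
    change x ∈ π.left ⁻¹ᵁ Ck.left.basicOpen r₁
    rw [hpre]
    exact hrF rfl
  refine ⟨Ck.left.basicOpen r₁, hN₁.basicOpen r₁, hξ', hle, r,
    Ck.left.presheaf.map (homOfLE (Ck.left.basicOpen_le r₁)).op r₁,
    RingedSpace.isUnit_res_basicOpen _ r₁, ?_,
    (isAffineOpen_powerOpen hV).isLocalization_of_eq_basicOpen r (homOfLE hle) hpre⟩
  have h1 := π.left.naturality (homOfLE (Ck.left.basicOpen_le r₁)).op
  refine congr($h1 r₁).trans ?_
  refine (congrArg _ hr₁).trans ?_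
  exact congr($((power C k).left.presheaf.map_comp (homOfLE hN₁W).op _) r).symm

end Curve

theorem appLE_congr_hom {X Y : Scheme.{0}} {f g : X ⟶ Y} (h : f = g) {U : Y.Opens} {V : X.Opens}
    (e : V ≤ f ⁻¹ᵁ U) (e' : V ≤ g ⁻¹ᵁ U) : f.appLE U V e = g.appLE U V e' := by
  subst h
  rfl

/-! ### Splitting near the image of a closed point. -/

section Divisor

variable {C : SchC} {k : ℕ} {Ck : SchC} {π : power C k ⟶ Ck} [NeZero k]
  (hC : IsSmoothProjectiveCurve C) (hπ : IsSymmetricProduct C π)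
include hC hπ

/-- Followed by the separated projection to C_k, the incidence map is the integral morphism `π`. -/
theorem isIntegralHom_incidence : IsIntegralHom (incidence π).left := by
  have := hC.isSeparated
  have := hπ.isIntegralHom
  have h1 : (incidence π).left ≫ (snd C Ck).left = π.left := by
    rw [← Over.comp_left, incidence, lift_snd]
  have : IsIntegralHom ((incidence π).left ≫ (snd C Ck).left) := by rwa [h1]
  have : IsSeparated (snd C Ck).left :=
    inferInstanceAs (IsSeparated (pullback.snd C.hom Ck.hom))
  exact IsIntegralHom.of_comp _ (snd C Ck).left

theorem isIntegralHom_toDivisor : IsIntegralHom (toDivisor π).left := by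
  have := isIntegralHom_incidence hC hπ
  have : IsIntegralHom ((incidence π).left.toImage ≫ (incidence π).left.imageι) := by
    rwa [Scheme.Hom.toImage_imageι]
  exact IsIntegralHom.of_comp (incidence π).left.toImage (incidence π).left.imageι

/-- The map onto a scheme-theoretic image is dominant, and being integral it is closed. -/
theorem surjective_toDivisor : Function.Surjective (toDivisor π).left := by
  have := isIntegralHom_incidence hC hπ
  have := isIntegralHom_toDivisor hC hπ
  have h1 : IsDominant (toDivisor π).left :=
    inferInstanceAs (IsDominant (incidence π).left.toImage)
  have h2 := h1.denseRange.closure_range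
  rw [(toDivisor π).left.isClosedMap.isClosed_range.closure_eq] at h2
  exact Set.range_eq_univ.1 h2

theorem divisorQ_le {V : C.left.Opens} {N : Ck.left.Opens} (h : π.left ⁻¹ᵁ N ≤ powerOpen k V) :
    (divisorQ π).left ⁻¹ᵁ N ≤ (divisorP π).left ⁻¹ᵁ V := by
  intro e he
  obtain ⟨x, rfl⟩ := surjective_toDivisor hC hπ e
  have h1 : toDivisor π ≫ divisorQ π = π := by rw [← divisorMap_zero, divisorMap_q hπ]
  have h2 : toDivisor π ≫ divisorP π = Pi.π (fun _ : Fin k => C) 0 := by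
    rw [← divisorMap_zero, divisorMap_p hπ]
  have h3 : (toDivisor π).left ≫ (divisorQ π).left = π.left := by rw [← Over.comp_left, h1]
  have h4 : (toDivisor π).left ≫ (divisorP π).left = powerProj C k 0 := by rw [← Over.comp_left, h2]
  have h5 : π.left x ∈ N := by rwa [← h3]
  have h6 := mem_powerOpen.1 (h h5) 0
  rwa [← h4] at h6

theorem divisorQ_preimage {V : C.left.Opens} {N : Ck.left.Opens}
    (h : π.left ⁻¹ᵁ N ≤ powerOpen k V) :
    (divisorQ π).left ⁻¹ᵁ N = (incidence π).left.imageι ⁻¹ᵁ prodOpen V N := by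
  have h1 := divisorQ_le hC hπ h
  exact le_antisymm (fun e he => ⟨h1 he, he⟩) fun e he => he.2

/-- Over N the divisor is closed in V × N, so its functions are restrictions from an affine product,
where they are sums of products. -/
theorem closure_divisor {V : C.left.Opens} (hV : IsAffineOpen V) {N : Ck.left.Opens}
    (hN : IsAffineOpen N) (h : π.left ⁻¹ᵁ N ≤ powerOpen k V) :
    AddSubgroup.closure {x : Γ((universalDivisor π).left, (divisorQ π).left ⁻¹ᵁ N) |
      ∃ (r : Γ(Ck.left, N)) (a : Γ(C.left, V)), x = (divisorQ π).left.app N r *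
        (divisorP π).left.appLE V ((divisorQ π).left ⁻¹ᵁ N) (divisorQ_le hC hπ h) a} = ⊤ := by
  have he := divisorQ_preimage hC hπ h
  let f : Γ((C ⊗ Ck).left, prodOpen V N) →+*
      Γ((universalDivisor π).left, (divisorQ π).left ⁻¹ᵁ N) :=
    ((incidence π).left.imageι.appLE (prodOpen V N) ((divisorQ π).left ⁻¹ᵁ N) he.le).hom
  have hf : Function.Surjective f := by
    have h1 := (incidence π).left.imageι.app_surjective (prodOpen V N) (isAffineOpen_prodOpen hV hN)
    have h2 : ∀ (W : (universalDivisor π).left.Opens)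
        (e : W = (incidence π).left.imageι ⁻¹ᵁ prodOpen V N),
        Function.Surjective ((incidence π).left.imageι.appLE (prodOpen V N) W e.le) := by
      rintro _ rfl
      rw [Scheme.Hom.appLE_eq_app]
      exact h1
    exact h2 _ he
  have h3 := congrArg (AddSubgroup.map f.toAddMonoidHom) (closure_prodOpen (A := C) hV hN)
  rw [AddMonoidHom.map_closure, AddSubgroup.map_top_of_surjective _ hf] at h3
  refine top_le_iff.1 (h3.ge.trans (AddSubgroup.closure_mono ?_))
  rintro _ ⟨_, ⟨r, a, rfl⟩, rfl⟩
  refine ⟨r, a, (map_mul f _ _).trans ?_⟩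
  have h4 := Scheme.Hom.appLE_comp_appLE (incidence π).left.imageι (snd C Ck).left N (prodOpen V N)
    ((divisorQ π).left ⁻¹ᵁ N) inf_le_right he.le
  have h5 := Scheme.Hom.appLE_comp_appLE (incidence π).left.imageι (fst C Ck).left V (prodOpen V N)
    ((divisorQ π).left ⁻¹ᵁ N) inf_le_left he.le
  have h6 : (divisorQ π).left.appLE N ((divisorQ π).left ⁻¹ᵁ N) le_rfl = (divisorQ π).left.app N :=
    Scheme.Hom.appLE_eq_app _
  exact congrArg₂ (· * ·) congr($(h4.trans h6) r) congr($h5 a)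

/-- The divisor is a scheme-theoretic image, so functions on it inject into functions on C^k; the
marking of index 0 is the map that defines it. -/
theorem injective_dHom_zero {V : C.left.Opens} (hV : IsAffineOpen V) {N : Ck.left.Opens}
    (hN : IsAffineOpen N) (h : π.left ⁻¹ᵁ N ≤ powerOpen k V) :
    Function.Injective ((baseIncidence hπ).dHom N 0) := by
  have := isIntegralHom_incidence hC hπ
  have he := divisorQ_preimage hC hπ h
  have h1 := (incidence π).left.toImage_app_injective ⟨prodOpen V N, isAffineOpen_prodOpen hV hN⟩
  have h2 : ∀ (f : (power C k).left ⟶ (incidence π).left.image) (_ : f = (incidence π).left.toImage)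
      (W : (incidence π).left.image.Opens) (_ : W = (incidence π).left.imageι ⁻¹ᵁ prodOpen V N)
      (W' : (power C k).left.Opens) (e : W' = f ⁻¹ᵁ W), Function.Injective (f.appLE W W' e.le) := by
    rintro _ rfl _ rfl _ rfl
    rw [Scheme.Hom.appLE_eq_app]
    exact h1
  exact h2 _ (congrArg Over.Hom.left (divisorMap_zero π)) _ he _
    ((baseIncidence hπ).preimage_π N 0)

/-- The geometric input is assembled here for `exists_isSplitAway`: a parameter t at the
coordinates, an adapted neighbourhood N, and the spanning and regularity statements for functions
over N. -/
theorem exists_isSplitAway_at {z : (power C k).left} (hz : IsClosed {z}) :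
    ∃ (N : Ck.left.Opens) (_ : IsAffineOpen N) (_ : IsAffineOpen ((divisorQ π).left ⁻¹ᵁ N))
      (r : Γ(Ck.left, N)), π.left z ∈ Ck.left.basicOpen r ∧ IsSplitAway r ((baseIncidence hπ).π.app N).hom
        ((baseIncidence hπ).q.app N).hom ((baseIncidence hπ).dHom N) := by
  have := hC.integral
  have := hC.locallyOfFiniteType
  have := hπ.isFinite hC
  have := locallyOfFiniteType_power hC (k := k)
  have : JacobsonSpace (power C k).left := LocallyOfFiniteType.jacobsonSpace (power C k).hom
  let F : Set (power C k).left := π.left ⁻¹' {π.left z}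
  have hF : F.Finite := π.left.finite_preimage_singleton _
  have hFc : IsClosed F := by
    have h1 := π.left.isClosedMap _ hz
    rw [Set.image_singleton] at h1
    exact h1.preimage π.left.continuous
  have hcl : ∀ w : F, IsClosed {w.1} := fun w => isClosed_singleton_of_finite hF hFc w.2
  let z' : F := ⟨z, rfl⟩
  have := hF.to_subtype
  let pt : F → (Spec (.of ℂ) ⟶ (power C k).left) := fun w =>
    pointOfClosedPoint (power C k).hom w.1 (hcl w)
  have hpt : ∀ w, pt w ≫ (power C k).hom = 𝟙 _ := fun w => pointOfClosedPoint_comp _ _ _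
  have hpt' : ∀ w a, pt w a = w.1 := fun w a => pointOfClosedPoint_apply _ _ _ a
  have : Nonempty (F × Fin k) := ⟨⟨z', 0⟩⟩
  -- The coordinates of all points of the fibre are included so that the whole fibre lies in V^k;
  -- the parameter property is used only at the coordinates of `z`.
  obtain ⟨V, hV, hxV, t, ht, hgen⟩ := exists_affine_parameter hC (ι := F × Fin k)
    (fun j => pt j.1 ≫ powerProj C k j.2) fun j => by
      rw [Category.assoc, powerProj_hom, hpt]
  let p : Spec (.of ℂ) := IsLocalRing.closedPoint ℂ
  have hFW : F ⊆ (powerOpen k V : Set (power C k).left) := by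
    intro w hw
    refine mem_powerOpen.2 fun i => ?_
    have h1 : (pt ⟨w, hw⟩ ≫ powerProj C k i) p ∈ V := hxV (⟨w, hw⟩, i) (x := p) trivial
    rw [Scheme.Hom.comp_apply, hpt'] at h1
    exact h1
  obtain ⟨N, hN, hzN, hNW, r₀, u, hu, hur, hloc⟩ := exists_isLocalization_away hπ hV hFW hF
  have : Nonempty V := ⟨⟨_, mem_powerOpen.1 (hFW (a := z) rfl) 0⟩⟩
  let I := baseIncidence hπ
  let _ : Algebra ℂ Γ(C.left, V) := (constMap C.hom V).toAlgebra
  have : Algebra.FiniteType ℂ Γ(C.left, V) := finiteType_constMap C.hom hV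
  have hqp := divisorQ_le hC hπ hNW
  let α : Γ(C.left, V) →+* Γ((universalDivisor π).left, I.q ⁻¹ᵁ N) :=
    ((divisorP π).left.appLE V ((divisorQ π).left ⁻¹ᵁ N) hqp).hom
  let res' : Γ((power C k).left, powerOpen k V) →+* Γ((power C k).left, I.π ⁻¹ᵁ N) :=
    ((power C k).left.presheaf.map (homOfLE hNW).op).hom
  have hδα : ∀ i a, I.dHom N i (α a) = res' (powerPull V i a) := by
    intro i a
    have h1 := Scheme.Hom.appLE_comp_appLE (I.d i) I.p V (I.q ⁻¹ᵁ N) (I.π ⁻¹ᵁ N) hqp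
      (preimage_comp_eq (I.d_q i) N).le
    have h2 := Scheme.Hom.appLE_map (powerProj C k i) (powerOpen_le V i) (homOfLE hNW).op
    exact congr($((h1.trans (appLE_congr_hom (I.d_p i) _ _)).trans h2.symm) a)
  have hpψ : ∀ i x, I.dHom N i ((I.q.app N).hom x) = (I.π.app N).hom x := by
    intro i x
    have h1 := Scheme.Hom.appLE_comp_appLE (I.d i) I.q N (I.q ⁻¹ᵁ N) (I.π ⁻¹ᵁ N) le_rfl
      (preimage_comp_eq (I.d_q i) N).le
    have h2 : I.π.appLE N (I.π ⁻¹ᵁ N) le_rfl = I.π.app N := Scheme.Hom.appLE_eq_app _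
    have h3 : I.q.appLE N (I.q ⁻¹ᵁ N) le_rfl = I.q.app N := Scheme.Hom.appLE_eq_app _
    rw [h3] at h1
    exact congr($((h1.trans (appLE_congr_hom (I.d_q i) _ _)).trans h2) x)
  have hφκ : ∀ c, I.π.app N (constMap Ck.hom N c) = constMap (power C k).hom (I.π ⁻¹ᵁ N) c := by
    intro c
    have h1 := appLE_constMap (power C k).hom Ck.hom I.π (Over.w π) N (I.π ⁻¹ᵁ N) le_rfl c
    rw [Scheme.Hom.appLE_eq_app] at h1
    exact h1
  have hzpre : ⊤ ≤ pt z' ⁻¹ᵁ (I.π ⁻¹ᵁ N) := top_le_preimage (pt z') (p := p) (by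
    rw [hpt']
    exact hzN)
  have hevα : ∀ i a, evalAt (pt z') (I.π ⁻¹ᵁ N) hzpre (I.dHom N i (α a)) =
      evalAt (pt z' ≫ powerProj C k i) V (hxV (z', i)) a := by
    intro i a
    rw [hδα]
    refine (evalAt_res (pt z') hNW hzpre (hzpre.trans fun x hx => hNW hx) _).trans ?_
    exact evalAt_appLE (pt z') (powerProj C k i) rfl (powerOpen k V) _ V (powerOpen_le V i) _ a
  let _ : Algebra Γ((power C k).left, powerOpen k V) Γ((power C k).left, I.π ⁻¹ᵁ N) :=
    res'.toAlgebra
  have hloc' : IsLocalization.Away r₀ Γ((power C k).left, I.π ⁻¹ᵁ N) := hloc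
  have hP : AddSubgroup.closure {x : Γ((power C k).left, I.π ⁻¹ᵁ N) |
      ∃ (r : Γ(Ck.left, N)) (a : Fin k → Γ(C.left, V)),
        x = (I.π.app N).hom r * ∏ i, I.dHom N i (α (a i))} = ⊤ := by
    refine top_le_iff.1 fun x _ => ?_
    obtain ⟨m, y, hy⟩ := IsLocalization.Away.surj r₀ x
    obtain ⟨v, hv⟩ := (hu.pow m).exists_right_inv
    -- Denominators are powers of `r₀`, which equals the image of the unit `u`, so they can be moved
    -- into the coefficient from C_k.
    have hx : x = (I.π.app N).hom v * res' y := by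
      have h1 : x * res' r₀ ^ m = res' y := hy
      have h2 : (I.π.app N).hom u = res' r₀ := hur
      rw [← h1, ← h2, ← map_pow, mul_left_comm, ← map_mul, mul_comm v, hv, map_one, mul_one]
    rw [hx]
    clear hy hx
    have hy' : y ∈ AddSubgroup.closure
        {y | ∃ a : Fin k → Γ(C.left, V), ∏ i, powerPull V i (a i) = y} := by
      rw [closure_powerPull_eq_top hV]
      trivial
    induction hy' using AddSubgroup.closure_induction with
    | mem y h =>
      obtain ⟨a, rfl⟩ := h
      refine AddSubgroup.subset_closure ⟨v, a, ?_⟩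
      rw [map_prod]
      exact congrArg _ (Finset.prod_congr rfl fun i _ => (hδα i (a i)).symm)
    | zero => rw [map_zero, mul_zero]; exact zero_mem _
    | add a b _ _ ha hb => rw [map_add, mul_add]; exact add_mem ha hb
    | neg a _ ha => rw [map_neg, mul_neg]; exact neg_mem ha
  obtain ⟨r, hr, hs⟩ := exists_isSplitAway (φ := (I.π.app N).hom) (ψ := (I.q.app N).hom)
    (δ := I.dHom N) (hπ.injective N) hpψ (injective_dHom_zero hC hπ hV hN hNW)
    (ρ := I.ρHom N) (I.ρHom_dHom N) (fun x hx => hπ.surjective N x fun σ _ => hx σ) α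
    (constMap Ck.hom N) (fun c => by
      have h1 := appLE_constMap (universalDivisor π).hom Ck.hom I.q (Over.w (divisorQ π)) N
        (I.q ⁻¹ᵁ N) le_rfl c
      rw [Scheme.Hom.appLE_eq_app] at h1
      exact h1.trans (appLE_constMap (universalDivisor π).hom C.hom (divisorP π).left
        (Over.w (divisorP π)) V _ hqp c).symm)
    (closure_divisor hC hπ hV hN hNW) hP (evalAt (pt z') (I.π ⁻¹ᵁ N) hzpre)
    (fun c => (congrArg _ (hφκ c)).trans
      (evalAt_constMap (power C k).hom (pt z') (hpt z') _ hzpre c)) t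
    (fun i a h => by
      rw [hevα] at h ⊢
      exact hgen (z', i) a h)
    (fun i j hij => by
      rw [hδα, hδα, ← map_sub]
      exact IsLocalization.map_nonZeroDivisors_le (Submonoid.powers r₀) _
        (Submonoid.mem_map_of_mem _ (powerPull_sub_mem_nonZeroDivisors hV ht hij)))
  have hqN : IsAffineOpen ((divisorQ π).left ⁻¹ᵁ N) := by
    rw [divisorQ_preimage hC hπ hNW]
    exact (isAffineOpen_prodOpen hV hN).preimage (incidence π).left.imageι
  refine ⟨N, hN, hqN, r, ?_, hs⟩
  have h1 := (evalAt_ne_zero_iff (pt z') (I.π ⁻¹ᵁ N) hzpre _ p).1 hr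
  rw [hpt'] at h1
  have h2 := Scheme.preimage_basicOpen I.π r
  have h3 : z ∈ I.π ⁻¹ᵁ Ck.left.basicOpen r := by
    rw [h2]
    exact h1
  exact h3

end Divisor

/-! ### Products with S as base change. -/

section BaseChange

variable {A B : SchC} (f : A ⟶ B) (S : SchC)

/-- Pasting: both products with S are pullbacks over the point, so the square between them is one
too. -/
theorem isPullback_whiskerRight :
    IsPullback (fst A S).left (f ▷ S).left f.left (fst B S).left := by
  have h1 := (isPullback_tensor B S).flip
  have h2 := (isPullback_tensor A S).flip
  have e1 : (f ▷ S).left ≫ (snd B S).left = (snd A S).left := by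
    rw [← Over.comp_left, whiskerRight_snd]
  have e2 : f.left ≫ B.hom = A.hom := Over.w f
  have e3 : (f ▷ S).left ≫ (fst B S).left = (fst A S).left ≫ f.left := by
    rw [← Over.comp_left, whiskerRight_fst, Over.comp_left]
  rw [← e1, ← e2] at h2
  exact (IsPullback.of_right h2 e3 h1).flip

theorem whiskerRight_preimage {N : B.left.Opens} {V : (B ⊗ S).left.Opens}
    (hV : V ≤ (fst B S).left ⁻¹ᵁ N) :
    (f ▷ S).left ⁻¹ᵁ V = (fst A S).left ⁻¹ᵁ f.left ⁻¹ᵁ N ⊓ (f ▷ S).left ⁻¹ᵁ V := by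
  refine (inf_eq_right.2 fun x hx => ?_).symm
  have h1 : (fst B S).left ((f ▷ S).left x) ∈ N := hV hx
  rw [← Scheme.Hom.comp_apply, ← (isPullback_whiskerRight f S).w] at h1
  exact h1

theorem isPushout_whiskerRight {N : B.left.Opens} (hN : IsAffineOpen N)
    (hfN : IsAffineOpen (f.left ⁻¹ᵁ N)) {V : (B ⊗ S).left.Opens} (hVa : IsAffineOpen V)
    (hV : V ≤ (fst B S).left ⁻¹ᵁ N) :
    IsPushout (f.left.app N) ((fst B S).left.appLE N V hV)
      ((fst A S).left.appLE (f.left ⁻¹ᵁ N) ((f ▷ S).left ⁻¹ᵁ V)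
        ((whiskerRight_preimage f S hV).le.trans inf_le_left)) ((f ▷ S).left.app V) := by
  have h1 := isIso_pushoutSection_of_isAffineOpen (isPullback_whiskerRight f S) hV le_rfl
    (whiskerRight_preimage f S hV) hN hVa hfN
  have h2 := (isIso_pushoutSection_iff _ _ _ _).1 h1
  rw [Scheme.Hom.appLE_eq_app] at h2
  have h3 : (f ▷ S).left.appLE V ((f ▷ S).left ⁻¹ᵁ V) le_rfl = (f ▷ S).left.app V :=
    Scheme.Hom.appLE_eq_app _
  rw [← h3]
  exact h2

theorem isUnit_appLE {X Y : Scheme.{0}} (f : X ⟶ Y) {N : Y.Opens} {V : X.Opens} (r : Γ(Y, N))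
    (h : V ≤ f ⁻¹ᵁ N) (hr : V ≤ f ⁻¹ᵁ Y.basicOpen r) : IsUnit (f.appLE N V h r) := by
  have h1 : IsUnit (Y.presheaf.map (homOfLE (Y.basicOpen_le r)).op r) :=
    RingedSpace.isUnit_res_basicOpen _ r
  have h2 := h1.map (f.appLE (Y.basicOpen r) V hr).hom
  have h3 := Scheme.Hom.map_appLE f hr (homOfLE (Y.basicOpen_le r)).op
  have h4 := congr($h3 r)
  rw [← h4]
  exact h2

end BaseChange

/-! ### Splitting over C_k × S. -/

section Split

variable {C : SchC} {k : ℕ} {Ck : SchC} {π : power C k ⟶ Ck} [NeZero k]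
  (hC : IsSmoothProjectiveCurve C) (hπ : IsSymmetricProduct C π) (S : SchC)

/-- The projection C_k × S → C_k is flat, as a base change of a morphism to the spectrum of a field,
and the rings upstairs over `V` are pushouts of those over `N`. -/
theorem isSplit_incidenceS {N : Ck.left.Opens} (hN : IsAffineOpen N)
    (hqN : IsAffineOpen ((divisorQ π).left ⁻¹ᵁ N)) {r : Γ(Ck.left, N)}
    (h : IsSplitAway r ((baseIncidence hπ).π.app N).hom ((baseIncidence hπ).q.app N).hom
      ((baseIncidence hπ).dHom N)) {V : (Ck ⊗ S).left.Opens} (hV : IsAffineOpen V)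
    (hr : V ≤ (fst Ck S).left ⁻¹ᵁ Ck.left.basicOpen r) :
    IsSplit ((incidenceS hπ S).π.app V).hom ((incidenceS hπ S).q.app V).hom
      ((incidenceS hπ S).dHom V) := by
  have := hπ.affine
  have hVN : V ≤ (fst Ck S).left ⁻¹ᵁ N := hr.trans fun x hx => Ck.left.basicOpen_le r hx
  have hflat : Flat (fst Ck S).left := by
    have h1 : Flat S.hom := inferInstance
    exact inferInstanceAs (Flat (pullback.fst Ck.hom S.hom))
  refine h.isSplit_of_flat (f := ((fst Ck S).left.appLE N V hVN).hom)
    ((fst Ck S).left.flat_appLE hN hV hVN)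
    (isPushout_whiskerRight (divisorQ π) S hN hqN hV hVN)
    (isPushout_whiskerRight π S hN (hN.preimage π.left) hV hVN) (fun i e => ?_) (fun i x => ?_)
    (isUnit_appLE _ r _ hr)
  · have h1 := Scheme.Hom.appLE_comp_appLE (divisorMap π i ▷ S).left (fst (universalDivisor π) S).left
      ((divisorQ π).left ⁻¹ᵁ N) ((divisorQ π ▷ S).left ⁻¹ᵁ V) ((π ▷ S).left ⁻¹ᵁ V)
      ((whiskerRight_preimage (divisorQ π) S hVN).le.trans inf_le_left)
      (preimage_comp_eq ((incidenceS hπ S).d_q i) V).le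
    have h2 := Scheme.Hom.appLE_comp_appLE (fst (power C k) S).left (divisorMap π i).left
      ((divisorQ π).left ⁻¹ᵁ N) (π.left ⁻¹ᵁ N) ((π ▷ S).left ⁻¹ᵁ V)
      (preimage_comp_eq ((baseIncidence hπ).d_q i) N).le
      ((whiskerRight_preimage π S hVN).le.trans inf_le_left)
    have h3 : (divisorMap π i ▷ S).left ≫ (fst (universalDivisor π) S).left =
        (fst (power C k) S).left ≫ (divisorMap π i).left := by
      rw [← Over.comp_left, whiskerRight_fst, Over.comp_left]
    exact congr($((h1.trans (appLE_congr_hom h3 _ _)).trans h2.symm) e)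
  · let I := incidenceS hπ S
    have h1 := Scheme.Hom.appLE_comp_appLE (I.d i) I.q V (I.q ⁻¹ᵁ V) (I.π ⁻¹ᵁ V) le_rfl
      (preimage_comp_eq (I.d_q i) V).le
    have h2 : I.π.appLE V (I.π ⁻¹ᵁ V) le_rfl = I.π.app V := Scheme.Hom.appLE_eq_app _
    have h3 : I.q.appLE V (I.q ⁻¹ᵁ V) le_rfl = I.q.app V := Scheme.Hom.appLE_eq_app _
    rw [h3] at h1
    exact congr($((h1.trans (appLE_congr_hom (I.d_q i) _ _)).trans h2) x)

include hC

/-- The condition on a point is open, so it spreads from images of closed points to all of C_k. -/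
theorem exists_isSplitAway_mem (ξ : Ck.left) :
    ∃ (N : Ck.left.Opens) (_ : IsAffineOpen N) (_ : IsAffineOpen ((divisorQ π).left ⁻¹ᵁ N))
      (r : Γ(Ck.left, N)), ξ ∈ Ck.left.basicOpen r ∧ IsSplitAway r
        ((baseIncidence hπ).π.app N).hom ((baseIncidence hπ).q.app N).hom
        ((baseIncidence hπ).dHom N) := by
  have := locallyOfFiniteType_power hC (k := k)
  have : JacobsonSpace (power C k).left := LocallyOfFiniteType.jacobsonSpace (power C k).hom
  revert ξ
  refine forall_of_forall_isClosed π.left.continuous hπ.surjective_base fun z hz => ?_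
  obtain ⟨N, hN, hqN, r, hr, hs⟩ := exists_isSplitAway_at hC hπ hz
  exact ⟨Ck.left.basicOpen r, (Ck.left.basicOpen r).isOpen, hr, fun ξ hξ => ⟨N, hN, hqN, r, hξ, hs⟩⟩

/-- Near every point of `C_k × S` the incidence diagram is split over all small affine opens. -/
theorem exists_isSplit_incidenceS (y : (Ck ⊗ S).left) :
    ∃ O : (Ck ⊗ S).left.Opens, y ∈ O ∧ ∀ V : (Ck ⊗ S).left.Opens, IsAffineOpen V → V ≤ O →
      IsSplit ((incidenceS hπ S).π.app V).hom ((incidenceS hπ S).q.app V).hom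
        ((incidenceS hπ S).dHom V) := by
  obtain ⟨N, hN, hqN, r, hr, hs⟩ := exists_isSplitAway_mem hC hπ ((fst Ck S).left y)
  exact ⟨(fst Ck S).left ⁻¹ᵁ Ck.left.basicOpen r, hr, fun V hV hVO =>
    isSplit_incidenceS hπ S hN hqN hs hV hVO⟩

end Split

/-! ### Extending sections of a line bundle; frames near finite sets. -/

section Extension

variable {X : Scheme.{0}} {L : X.Modules}

theorem IsFrame.exists_smul {U : X.Opens} {e : Γ(L, U)} (he : IsFrame L e) (s : Γ(L, U)) :
    ∃ a : Γ(X, U), s = a • e := by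
  obtain ⟨a, ha⟩ := (he U le_rfl).2 s
  refine ⟨a, ha.symm.trans ?_⟩
  exact congrArg (a • ·) (res_id L _ e)

theorem IsFrame.eq_zero_of_smul {U : X.Opens} {e : Γ(L, U)} (he : IsFrame L e) {a : Γ(X, U)}
    (ha : a • e = 0) : a = 0 := by
  refine (he U le_rfl).1 ?_
  exact (congrArg (a • ·) (res_id L _ e)).trans (ha.trans (zero_smul _ _).symm)

/-- In a frame the section is a function on a basic open, and a power of `f` clears its denominator.
-/
theorem IsFrame.exists_extend {W W' : X.Opens} (hW : IsAffineOpen W) {e : Γ(L, W)}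
    (he : IsFrame L e) (f : Γ(X, W)) (hW' : W' = X.basicOpen f) (h : W' ≤ W) (s : Γ(L, W')) :
    ∃ (n : ℕ) (t : Γ(L, W)),
      res L (homOfLE h) t = X.presheaf.map (homOfLE h).op f ^ n • s := by
  obtain ⟨a, rfl⟩ := (he.restrict h).exists_smul s
  let _ : Algebra Γ(X, W) Γ(X, W') := (X.presheaf.map (homOfLE h).op).hom.toAlgebra
  have hloc : IsLocalization.Away f Γ(X, W') := hW.isLocalization_of_eq_basicOpen f (homOfLE h) hW'
  obtain ⟨n, b, hb⟩ := IsLocalization.Away.surj f a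
  have hb' : a * X.presheaf.map (homOfLE h).op f ^ n = X.presheaf.map (homOfLE h).op b := hb
  exact ⟨n, b • e, by rw [res_smul, ← hb', smul_smul, mul_comm]⟩

theorem IsFrame.exists_pow_smul_eq_zero {W W' : X.Opens} (hW : IsAffineOpen W) {e : Γ(L, W)}
    (he : IsFrame L e) (f : Γ(X, W)) (hW' : W' = X.basicOpen f) (h : W' ≤ W) {t : Γ(L, W)}
    (ht : res L (homOfLE h) t = 0) : ∃ n : ℕ, f ^ n • t = 0 := by
  obtain ⟨b, rfl⟩ := he.exists_smul t
  rw [res_smul] at ht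
  have h1 := (he.restrict h).eq_zero_of_smul ht
  let _ : Algebra Γ(X, W) Γ(X, W') := (X.presheaf.map (homOfLE h).op).hom.toAlgebra
  have hloc : IsLocalization.Away f Γ(X, W') := hW.isLocalization_of_eq_basicOpen f (homOfLE h) hW'
  obtain ⟨⟨_, n, rfl⟩, hn⟩ := (IsLocalization.map_eq_zero_iff (Submonoid.powers f) Γ(X, W') b).1 h1
  refine ⟨n, ?_⟩
  rw [smul_smul]
  exact (congrArg (· • e) hn).trans (zero_smul _ _)

theorem exists_finite_frames (hL : IsLineBundle L) {U : X.Opens} (hU : IsAffineOpen U) :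
    ∃ (ι : Type) (_ : Fintype ι) (g : ι → Γ(X, U)) (e : ∀ i, Γ(L, X.basicOpen (g i))),
      U ≤ ⨆ i, X.basicOpen (g i) ∧ ∀ i, IsFrame L (e i) := by
  have h1 : ∀ x : U, ∃ (g : Γ(X, U)) (e : Γ(L, X.basicOpen g)), x.1 ∈ X.basicOpen g ∧ IsFrame L e := by
    intro x
    obtain ⟨V, hxV, m, hm⟩ := exists_isFrame hL x.1
    obtain ⟨g, hg, hxg⟩ := hU.exists_basicOpen_le (V := V) ⟨x.1, hxV⟩ x.2
    exact ⟨g, res L (homOfLE hg) m, hxg, hm.restrict hg⟩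
  choose g e hx he using h1
  obtain ⟨T, hT⟩ := hU.isCompact.elim_finite_subcover (fun x : U => (X.basicOpen (g x) : Set X))
    (fun x => (X.basicOpen (g x)).isOpen) fun x hxU => Set.mem_iUnion.2 ⟨⟨x, hxU⟩, hx ⟨x, hxU⟩⟩
  refine ⟨T, inferInstance, fun i => g i.1, fun i => e i.1, fun x hxU => ?_, fun i => he i.1⟩
  obtain ⟨i, hi, hxi⟩ := Set.mem_iUnion₂.1 (hT hxU)
  exact TopologicalSpace.Opens.mem_iSup.2 ⟨⟨i, hi⟩, hxi⟩

/-- A section of a line bundle over a basic open subset of an affine open subset extends after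
multiplication by a power of the equation. -/
theorem exists_extend (hL : IsLineBundle L) {U : X.Opens} (hU : IsAffineOpen U) (f : Γ(X, U))
    (s : Γ(L, X.basicOpen f)) : ∃ (n : ℕ) (t : Γ(L, U)),
      res L (homOfLE (X.basicOpen_le f)) t =
        X.presheaf.map (homOfLE (X.basicOpen_le f)).op f ^ n • s := by
  obtain ⟨ι, _, g, e, hcov, he⟩ := exists_finite_frames hL hU
  let W : ι → X.Opens := fun i => X.basicOpen (g i)
  have hWU : ∀ i, W i ≤ U := fun i => X.basicOpen_le (g i)
  have hW : ∀ i, IsAffineOpen (W i) := fun i => hU.basicOpen (g i)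
  let F : ∀ (V : X.Opens), V ≤ U → Γ(X, V) := fun V h => X.presheaf.map (homOfLE h).op f
  have hF : ∀ (V V' : X.Opens) (h : V ≤ U) (h' : V' ≤ V),
      X.presheaf.map (homOfLE h').op (F V h) = F V' (h'.trans h) := fun V V' h h' =>
    congr($(X.presheaf.map_comp (homOfLE h).op (homOfLE h').op) f).symm
  have hD : ∀ (V : X.Opens) (h : V ≤ U), V ⊓ X.basicOpen f = X.basicOpen (F V h) := fun V h =>
    (Scheme.basicOpen_res X f (homOfLE h).op).symm
  have h1 : ∀ i, ∃ (n : ℕ) (t : Γ(L, W i)), res L (homOfLE (inf_le_left : W i ⊓ X.basicOpen f ≤ W i)) t =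
      F (W i ⊓ X.basicOpen f) (inf_le_left.trans (hWU i)) ^ n •
        res L (homOfLE (inf_le_right : W i ⊓ X.basicOpen f ≤ X.basicOpen f)) s := by
    intro i
    obtain ⟨n, t, h⟩ := (he i).exists_extend (hW i) (F (W i) (hWU i)) (hD _ _) inf_le_left
      (res L (homOfLE inf_le_right) s)
    rw [hF] at h
    exact ⟨n, t, h⟩
  choose n t ht using h1
  -- The sum serves as an upper bound for all exponents; the same device gives `m₁` below.
  let n₁ := ∑ i, n i
  obtain ⟨t₁, ht₁⟩ : ∃ t₁ : ∀ i, Γ(L, W i), ∀ i,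
      res L (homOfLE (inf_le_left : W i ⊓ X.basicOpen f ≤ W i)) (t₁ i) =
      F (W i ⊓ X.basicOpen f) (inf_le_left.trans (hWU i)) ^ n₁ •
        res L (homOfLE (inf_le_right : W i ⊓ X.basicOpen f ≤ X.basicOpen f)) s := by
    refine ⟨fun i => F (W i) (hWU i) ^ (n₁ - n i) • t i, fun i => ?_⟩
    rw [res_smul, ht, map_pow, hF, smul_smul, ← pow_add, Nat.sub_add_cancel]
    exact Finset.single_le_sum (f := n) (fun _ _ => Nat.zero_le _) (Finset.mem_univ i)
  have hWW : ∀ i j, W i ⊓ W j ≤ U := fun i j => inf_le_left.trans (hWU i)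
  have hWWa : ∀ i j, IsAffineOpen (W i ⊓ W j) := by
    intro i j
    have h2 : W i ⊓ W j = X.basicOpen (X.presheaf.map (homOfLE (hWU i)).op (g j)) :=
      (Scheme.basicOpen_res X (g j) (homOfLE (hWU i)).op).symm
    rw [h2]
    exact (hW i).basicOpen _
  -- The local extensions agree where `f` is invertible, so on each overlap their difference is
  -- killed by a power of `f`.
  have h2 : ∀ i j, ∃ m : ℕ, F (W i ⊓ W j) (hWW i j) ^ m • (res L (homOfLE inf_le_left) (t₁ i) -
      res L (homOfLE inf_le_right) (t₁ j) : Γ(L, W i ⊓ W j)) = 0 := by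
    intro i j
    refine ((he i).restrict inf_le_left).exists_pow_smul_eq_zero (hWWa i j) _ (hD _ _)
      inf_le_left ?_
    have h3 := congrArg (res L (homOfLE (show W i ⊓ W j ⊓ X.basicOpen f ≤ W i ⊓ X.basicOpen f from
      inf_le_inf_right _ inf_le_left))) (ht₁ i)
    have h4 := congrArg (res L (homOfLE (show W i ⊓ W j ⊓ X.basicOpen f ≤ W j ⊓ X.basicOpen f from
      inf_le_inf_right _ inf_le_right))) (ht₁ j)
    rw [res_smul, map_pow, hF, res_res, res_res] at h3 h4
    rw [map_sub, res_res, res_res, sub_eq_zero]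
    exact h3.trans h4.symm
  choose m hm using h2
  let m₁ := ∑ i, ∑ j, m i j
  have hm₁ : ∀ i j, F (W i ⊓ W j) (hWW i j) ^ m₁ • (res L (homOfLE inf_le_left) (t₁ i) -
      res L (homOfLE inf_le_right) (t₁ j) : Γ(L, W i ⊓ W j)) = 0 := by
    intro i j
    have h3 : m i j ≤ m₁ :=
      (Finset.single_le_sum (f := m i) (fun _ _ => Nat.zero_le _) (Finset.mem_univ j)).trans
        (Finset.single_le_sum (f := fun i => ∑ j, m i j) (fun _ _ => Nat.zero_le _)
          (Finset.mem_univ i))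
    rw [← Nat.sub_add_cancel h3, pow_add, mul_smul, hm, smul_zero]
  obtain ⟨u, hu⟩ := exists_glue L W (fun i => homOfLE (hWU i)) hcov
    (fun i => F (W i) (hWU i) ^ m₁ • t₁ i) (by
      intro i j
      have h3 := hm₁ i j
      rw [smul_sub, sub_eq_zero] at h3
      rw [res_smul, res_smul, map_pow, map_pow, hF, hF]
      exact h3)
  refine ⟨m₁ + n₁, u, eq_of_locally_eq L fun x hx => ?_⟩
  obtain ⟨i, hi⟩ := TopologicalSpace.Opens.mem_iSup.1 (hcov (X.basicOpen_le f hx))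
  refine ⟨W i ⊓ X.basicOpen f, homOfLE inf_le_right, ⟨hi, hx⟩, ?_⟩
  have h3 := congrArg (res L (homOfLE (inf_le_left : W i ⊓ X.basicOpen f ≤ W i))) (hu i)
  rw [res_smul, ht₁, res_res, map_pow, hF, smul_smul, ← pow_add] at h3
  rw [res_res, res_smul, map_pow]
  refine h3.trans ?_
  exact congrArg (fun z => z ^ (m₁ + n₁) • res L (homOfLE inf_le_right) s) (hF _ _ _ _).symm

theorem IsFrame.unit_smul {U : X.Opens} {e : Γ(L, U)} (he : IsFrame L e) {u : Γ(X, U)}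
    (hu : IsUnit u) : IsFrame L (u • e) := by
  intro W h
  have hu' := hu.map (X.presheaf.map (homOfLE h).op).hom
  obtain ⟨v, hv⟩ := hu'
  have h1 : (fun r : Γ(X, W) => r • res L (homOfLE h) (u • e)) =
      (fun r => r • res L (homOfLE h) e) ∘ fun r : Γ(X, W) => r * v := by
    funext r
    rw [res_smul, smul_smul, Function.comp_apply, hv]
  rw [h1]
  exact (he W h).comp v.mulRight_bijective

theorem isFrame_of_cover {U : X.Opens} {m : Γ(L, U)} {ι : Type} (V : ι → X.Opens)
    (hV : ∀ i, V i ≤ U) (hcov : U ≤ iSup V) (hm : ∀ i, IsFrame L (res L (homOfLE (hV i)) m)) :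
    IsFrame L m := by
  have key : ∀ (i : ι) (W : X.Opens) (h : W ≤ V i),
      Function.Bijective fun r : Γ(X, W) => r • res L (homOfLE (h.trans (hV i))) m := by
    intro i W h
    have h1 := hm i W h
    simp only [res_res] at h1
    exact h1
  refine isFrame_of_locally (fun W h r hr => ?_) fun W h s x hx => ?_
  · refine TopCat.Sheaf.eq_of_locally_eq' X.sheaf (fun i => W ⊓ V i) W
      (fun i => homOfLE inf_le_left) (fun x hx => ?_) r 0 fun i => ?_
    · obtain ⟨i, hi⟩ := TopologicalSpace.Opens.mem_iSup.1 (hcov (h hx))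
      exact TopologicalSpace.Opens.mem_iSup.2 ⟨i, hx, hi⟩
    · refine (key i (W ⊓ V i) inf_le_right).1 ?_
      have h1 := congrArg (res L (homOfLE (inf_le_left : W ⊓ V i ≤ W))) hr
      rw [res_smul, res_res, map_zero] at h1
      refine h1.trans ?_
      exact ((congrArg (· • _) (map_zero (X.presheaf.map (homOfLE
        (inf_le_left : W ⊓ V i ≤ W)).op).hom)).trans (zero_smul _ _)).symm
  · obtain ⟨i, hi⟩ := TopologicalSpace.Opens.mem_iSup.1 (hcov (h hx))
    obtain ⟨r, hr⟩ := (key i (W ⊓ V i) inf_le_right).2 (res L (homOfLE inf_le_left) s)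
    exact ⟨W ⊓ V i, inf_le_left, r, ⟨hx, hi⟩, hr⟩

/-- A line bundle is trivial near a finite set of points of an affine open subset. -/
theorem exists_isFrame_of_finite (c : X ⟶ Spec (.of ℂ)) (hL : IsLineBundle L) {U : X.Opens}
    (hU : IsAffineOpen U) {T : Set X} (hT : T.Finite) (hTU : T ⊆ U) :
    ∃ (Q : X.Opens) (l : Γ(L, Q)), IsFrame L l ∧ T ⊆ Q := by
  classical
  have := hT.fintype
  have h1 : ∀ x : T, ∃ (g : Γ(X, U)) (e : Γ(L, X.basicOpen g)), x.1 ∈ X.basicOpen g ∧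
      IsFrame L e := by
    intro x
    obtain ⟨V, hxV, m, hm⟩ := exists_isFrame hL x.1
    obtain ⟨g, hg, hxg⟩ := hU.exists_basicOpen_le (V := V) ⟨x.1, hxV⟩ (hTU x.2)
    exact ⟨g, res L (homOfLE hg) m, hxg, hm.restrict hg⟩
  choose g e hx he using h1
  have hle : ∀ x, X.basicOpen (g x) ≤ U := fun x => X.basicOpen_le (g x)
  choose n s hs using fun x => exists_extend hL hU (g x) (e x)
  choose a ha using fun x y => (he x).exists_smul (res L (homOfLE (hle x)) (s y))
  -- The section `s x` restricts to a power of the unit `g x` times the frame `e x`, so its own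
  -- coordinate does not vanish at `x`.
  have hxx : ∀ x : T, x.1 ∈ X.basicOpen (a x x) := by
    intro x
    have h2 : a x x = X.presheaf.map (homOfLE (hle x)).op (g x) ^ n x := by
      refine sub_eq_zero.1 ((he x).eq_zero_of_smul ?_)
      rw [sub_smul, ← ha, hs, sub_self]
    have h3 : IsUnit (X.presheaf.map (homOfLE (hle x)).op (g x)) :=
      RingedSpace.isUnit_res_basicOpen _ (g x)
    rw [h2, Scheme.basicOpen_of_isUnit _ (h3.pow _)]
    exact hx x
  let _ : ∀ x : T, Algebra ℂ Γ(X, X.basicOpen (g x)) := fun x => (constMap c _).toAlgebra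
  -- `P x` holds the coefficient vectors for which the combination of the extended sections vanishes
  -- at `x`. It is proper by `hxx`, and finitely many proper subspaces do not cover the space.
  let P : T → Submodule ℂ (T → ℂ) := fun x =>
    ((vanishingPrime (X.basicOpen (g x)) x.1 (hx x)).restrictScalars ℂ).comap
      (Fintype.linearCombination ℂ (a x))
  have hP : ∀ x, P x ≠ ⊤ := by
    intro x htop
    have h2 : Pi.single x 1 ∈ P x := htop ▸ trivial
    have h3 : Fintype.linearCombination ℂ (a x) (Pi.single x 1) ∈
      vanishingPrime (X.basicOpen (g x)) x.1 (hx x) := h2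
    rw [Fintype.linearCombination_apply_single, one_smul] at h3
    exact mem_vanishingPrime.1 h3 (hxx x)
  obtain ⟨v, hv⟩ : ∃ v : T → ℂ, ∀ x, v ∉ P x := by
    by_contra hcon
    push Not at hcon
    obtain ⟨x, hx⟩ := Subspace.exists_eq_top_of_iUnion_eq_univ (p := P) (by
      ext v
      simpa using hcon v)
    exact hP x hx
  let b : ∀ x : T, Γ(X, X.basicOpen (g x)) := fun x => Fintype.linearCombination ℂ (a x) v
  have hb : ∀ x, x.1 ∈ X.basicOpen (b x) := by
    intro x
    by_contra h
    exact hv x (mem_vanishingPrime.2 h)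
  let w : Γ(L, U) := ∑ y, constMap c U (v y) • s y
  have hw : ∀ x, res L (homOfLE (hle x)) w = b x • e x := by
    intro x
    rw [map_sum, show b x = ∑ y, constMap c _ (v y) * a x y from rfl, Finset.sum_smul]
    refine Finset.sum_congr rfl fun y _ => ?_
    rw [res_smul, ha, smul_smul, res_constMap]
  have hbU : ∀ x, X.basicOpen (b x) ≤ U := fun x => (X.basicOpen_le (b x)).trans (hle x)
  refine ⟨⨆ x, X.basicOpen (b x), res L (homOfLE (iSup_le hbU)) w,
    isFrame_of_cover (fun x => X.basicOpen (b x)) (fun x => le_iSup (fun x => X.basicOpen (b x)) x)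
      le_rfl fun x => ?_, fun x hxT => TopologicalSpace.Opens.mem_iSup.2 ⟨⟨x, hxT⟩, hb _⟩⟩
  have h2 := congrArg (res L (homOfLE (X.basicOpen_le (b x)))) (hw x)
  rw [res_res, res_smul] at h2
  rw [res_res]
  refine h2 ▸ ((he x).restrict (X.basicOpen_le (b x))).unit_smul ?_
  exact RingedSpace.isUnit_res_basicOpen _ (b x)

end Extension

/-! ### Frames of L adapted to fibres, and the isomorphism. -/

section Frames

variable {C : SchC} {k : ℕ} {Ck : SchC} {π : power C k ⟶ Ck} [NeZero k]
  (hC : IsSmoothProjectiveCurve C) (hπ : IsSymmetricProduct C π) (S : SchC)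
include hC hπ

omit [NeZero k] in
theorem isFinite_whiskerRight : IsFinite (π ▷ S).left := by
  have := hπ.isFinite hC
  exact MorphismProperty.of_isPullback (P := @IsFinite) (isPullback_whiskerRight π S) this

theorem surjective_toDivisor_whiskerRight : Function.Surjective (toDivisor π ▷ S).left := by
  have h1 : Surjective (toDivisor π).left := ⟨surjective_toDivisor hC hπ⟩
  exact (MorphismProperty.of_isPullback (P := @Surjective)
    (isPullback_whiskerRight (toDivisor π) S) h1).surj

variable {L : (C ⊗ S).left.Modules} (hL : IsLineBundle L)
include hL

/-- The fibre over `y` is finite, so `L` has a frame near all its projections to C × S. Since `π ▷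
S` is closed, this frame serves a whole neighbourhood of `y`, and surjectivity onto 𝒟 × S carries
the inclusion to the divisor. -/
theorem exists_isFrame_incidenceS (y : (Ck ⊗ S).left) :
    ∃ O : (Ck ⊗ S).left.Opens, y ∈ O ∧ ∃ (Q : (C ⊗ S).left.Opens) (l : Γ(L, Q)), IsFrame L l ∧
      (incidenceS hπ S).q ⁻¹ᵁ O ≤ (incidenceS hπ S).p ⁻¹ᵁ Q := by
  have := isFinite_whiskerRight hC hπ S
  let I := incidenceS hπ S
  let F : Set (power C k ⊗ S).left := (π ▷ S).left ⁻¹' {y}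
  have hF : F.Finite := (π ▷ S).left.finite_preimage_singleton y
  let T : Set (C ⊗ S).left := ⋃ i, I.pr i '' F
  have hT : T.Finite := Set.finite_iUnion fun i => hF.image _
  have hTs : ∀ x ∈ T, (snd C S).left x = (snd Ck S).left y := by
    intro x hx
    obtain ⟨i, w, hw, rfl⟩ := Set.mem_iUnion.1 hx
    have h1 : (projS C S i).left ≫ (snd C S).left = (π ▷ S).left ≫ (snd Ck S).left := by
      rw [← Over.comp_left, ← Over.comp_left, projS, whiskerRight_snd, whiskerRight_snd]
    have h2 : (π ▷ S).left w = y := hw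
    rw [← h2]
    exact congr($h1 w)
  -- The points of `T` all lie over one point of `S`, so an affine open of `C` times an affine open
  -- of `S` contains them.
  obtain ⟨V, hV, hTV⟩ := exists_isAffineOpen_of_finite hC (hT.image (fst C S).left)
  obtain ⟨W, hW, hsW, -⟩ := exists_isAffineOpen_mem_and_subset (U := ⊤)
    (x := (snd Ck S).left y) trivial
  obtain ⟨Q, l, hl, hTQ⟩ := exists_isFrame_of_finite (C ⊗ S).hom hL (isAffineOpen_prodOpen hV hW)
    hT fun x hx => ⟨hTV ⟨x, hx, rfl⟩, by
      change (snd C S).left x ∈ W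
      rwa [hTs x hx]⟩
  obtain ⟨O, hO, hyO, hOG⟩ := exists_isOpen_of_isClosedMap (π ▷ S).left.isClosedMap
    (W := ⋂ i, I.pr i ⁻¹ᵁ Q) (isOpen_iInter_of_finite fun i => (I.pr i ⁻¹ᵁ Q).isOpen) (y := y)
    fun w hw => Set.mem_iInter.2 fun i => hTQ (Set.mem_iUnion.2 ⟨i, w, hw, rfl⟩)
  refine ⟨⟨O, hO⟩, hyO, Q, l, hl, fun d hd => ?_⟩
  obtain ⟨x, rfl⟩ := surjective_toDivisor_whiskerRight hC hπ S d
  have h0 : (toDivisor π ▷ S).left = I.d 0 := by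
    change _ = (divisorMap π 0 ▷ S).left
    rw [divisorMap_zero]
  rw [h0] at hd ⊢
  have h1 : (I.d 0 ≫ I.q) x ∈ O := hd
  rw [I.d_q] at h1
  have h2 : I.pr 0 x ∈ Q := Set.mem_iInter.1 (hOG h1) 0
  rw [← I.d_p] at h2
  exact h2

theorem isIso_detLift_incidenceS : IsIso ((incidenceS hπ S).detLift L) := by
  refine (incidenceS hπ S).isIso_detLift_of_isSplit L fun y U hy => ?_
  obtain ⟨O₁, hy₁, h₁⟩ := exists_isSplit_incidenceS hC hπ S y
  obtain ⟨O₂, hy₂, Q, l, hl, h₂⟩ := exists_isFrame_incidenceS hC hπ S hL y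
  obtain ⟨V, hV, hyV, hVU⟩ := exists_isAffineOpen_mem_and_subset (U := U ⊓ (O₁ ⊓ O₂))
    (x := y) ⟨hy, hy₁, hy₂⟩
  refine ⟨V, hyV, hVU.trans inf_le_left, ?_, h₁ V hV fun x hx => (hVU hx).2.1, Q, l, hl,
    fun d hd => h₂ (hVU hd).2.2⟩
  -- k! is a unit because the base field has characteristic zero.
  rw [← map_natCast (constMap (Ck ⊗ S).hom V)]
  exact (isUnit_iff_ne_zero.2 (Nat.cast_ne_zero.2 k.factorial_ne_zero)).map _

end Frames

end SymmetricProduct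

end

theorem mainTheorem8 (C : SchC) (hC : IsSmoothProjectiveCurve C) (S : SchC) (hS : IsNormalVariety S)
    (k : ℕ) [NeZero k] (Ck : SchC) (π : power C k ⟶ Ck) (hπ : IsSymmetricProduct C π)
    (L : (C ⊗ S).left.Modules) (hL : IsLineBundle L) :
    Nonempty (symmetrization S hπ 0 L ≅ bundleT S hπ L) ∧
      Nonempty (symmetrization S hπ 1 L ≅ bundleN S π L) := by
  -- For μ = 0 the sign factor is 1, so both sheaves are built from the same action.
  have h : twistedAction C S 0 L = permAction (k := k) C S L := by
    funext σ
    rw [twistedAction, pow_zero, one_smul]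
  refine ⟨⟨eqToIso ?_⟩, ?_⟩
  · rw [symmetrization, bundleT, h]
  · have := isIso_detLift_incidenceS hC hπ S hL
    -- The source and target of `Incidence.detLift` for this diagram unfold to ⋀^k E_L and to the
    -- sign-twisted symmetrization.
    exact ⟨(asIso ((incidenceS hπ S).detLift L)).symm⟩
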